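/- All graphs are finite, simple and undirected. For a graph $G$ and a set $S$ of vertices, $S$ is an independent cutset of $G$ if its vertices are pairwise nonadjacent and $G-S$ is disconnected (it has at least two components). A graph is $P_5$-free if it has no induced path on five vertices, and a set $X$ of vertices of $G$ is a $P_5$-hitting set of $G$ if $G-X$ is $P_5$-free. Independent Cutset is the problem of returning an independent cutset of a given connected graph $G$, or reporting correctly that there is none. Algorithms are programs for a random access machine whose operations are addition, truncated subtraction, array access and zero tests, at unit cost. The input is the number $n$ of vertices and the adjacency matrix of $G$, together with a number $k$ where the input is a pair $(G,k)$. A running time is $\mathcal{O}^*(g(k))$ if it is at most $g(k)\,p(n)$ for some polynomial $p$. (1) Let $f:\mathbb{N}\to[0,\infty)$ be any function and let $\mathcal{D}$ be any set of pairs $(G,k)$ where $G$ is a connected graph and $k\ge 0$ is an integer (for instance all such pairs, or all those where $G$ has a $P_5$-hitting set with at most $k$ vertices). Suppose that there is an algorithm that on every input $(G,k)\in\mathcal{D}$ takes $\mathcal{O}^*(f(k))$ time and returns a $P_5$-hitting set of $G$ with at most $k$ vertices, or reports correctly that there is none. Then there is an algorithm that on every input $(G,k)\in\mathcal{D}$ takes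 $\mathcal{O}^*(f(k)+3^k)$ time and solves Independent Cutset for $G$ if $G$ has a $P_5$-hitting set with at most $k$ vertices, and reports correctly that $G$ has no such set otherwise. (2) Independent Cutset can be solved in polynomial time (in $n$) on connected $P_5$-free graphs. -/

import Mathlib

open scoped NNReal Polynomial

/-! ### Graph notions -/

/-- `G` has no induced path on five vertices. -/
def P5Free {V : Type*} (G : SimpleGraph V) : Prop :=
  ¬ (SimpleGraph.pathGraph 5).IsIndContained G

/-- Deleting `X` from `G` leaves a `P₅`-free graph. -/
def IsP5HittingSet {V : Type*} (G : SimpleGraph V) (X : Set V) : Prop :=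
  P5Free (G.induce Xᶜ)

/-- `G - S` is disconnected: it has two vertices that are not joined by a walk.
In particular the empty graph is not disconnected. -/
def IsCutset {V : Type*} (G : SimpleGraph V) (S : Set V) : Prop :=
  ¬ (G.induce Sᶜ).Preconnected

/-- A cutset whose vertices are pairwise nonadjacent. -/
def IsIndependentCutset {V : Type*} (G : SimpleGraph V) (S : Set V) : Prop :=
  G.IsIndepSet S ∧ IsCutset G S

/-! ### The machine model

A random access machine with structured control flow. Its memory consists of arrays of natural
numbers with two indices, named by natural numbers; a program mentions only finitely many names.
The arithmetic operations are addition and truncated subtraction, so that in `t` steps the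
bit length of a stored number increases by `O(t)`. Every write, every test and every `skip` takes
one step; the expressions in it have a size that is fixed with the program. -/

/-- A memory: the entry of array `a` at index `(i, j)` is `m a i j`. -/
abbrev Memory := ℕ → ℕ → ℕ → ℕ

/-- Arithmetic expressions over the memory. -/
inductive Expr : Type where
  | const (c : ℕ) : Expr
  | read (a : ℕ) (i j : Expr) : Expr
  | add (e₁ e₂ : Expr) : Expr
  | sub (e₁ e₂ : Expr) : Expr

/-- The value of an expression. -/
def Expr.val (m : Memory) : Expr → ℕ
  | .const c => c
  | .read a i j => m a (i.val m) (j.val m)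
  | .add e₁ e₂ => e₁.val m + e₂.val m
  | .sub e₁ e₂ => e₁.val m - e₂.val m

/-- Programs. A test succeeds if the value of its expression is not zero. -/
inductive Program : Type where
  | skip : Program
  | write (a : ℕ) (i j e : Expr) : Program
  | seq (P Q : Program) : Program
  | cond (e : Expr) (P Q : Program) : Program
  | loop (e : Expr) (P : Program) : Program

/-- The memory after setting the entry of array `a` at index `(i, j)` to `v`. -/
def Memory.set (m : Memory) (a i j v : ℕ) : Memory :=
  fun b x y => if b = a ∧ x = i ∧ y = j then v else m b x y

/-- `P.Run m m' t`: started on the memory `m`, the program `P` halts after exactly `t` steps, and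
then the memory is `m'`. -/
inductive Program.Run : Program → Memory → Memory → ℕ → Prop where
  | skip (m : Memory) : Run .skip m m 1
  | write (m : Memory) (a : ℕ) (i j e : Expr) :
      Run (.write a i j e) m (m.set a (i.val m) (j.val m) (e.val m)) 1
  | seq {P Q : Program} {m m' m'' : Memory} {t t' : ℕ} :
      Run P m m' t → Run Q m' m'' t' → Run (.seq P Q) m m'' (t + t')
  | cond_true {e : Expr} {P Q : Program} {m m' : Memory} {t : ℕ} :
      e.val m ≠ 0 → Run P m m' t → Run (.cond e P Q) m m' (t + 1)
  | cond_false {e : Expr} {P Q : Program} {m m' : Memory} {t : ℕ} :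
      e.val m = 0 → Run Q m m' t → Run (.cond e P Q) m m' (t + 1)
  | loop_true {e : Expr} {P : Program} {m m' m'' : Memory} {t t' : ℕ} :
      e.val m ≠ 0 → Run P m m' t → Run (.loop e P) m' m'' t' → Run (.loop e P) m m'' (t + t' + 1)
  | loop_false {e : Expr} {P : Program} {m : Memory} :
      e.val m = 0 → Run (.loop e P) m m 1

/-- Programs are deterministic: result and number of steps are determined by the start. -/
theorem Program.Run.deterministic {P : Program} {m m₁ m₂ : Memory} {t₁ t₂ : ℕ}
    (h₁ : P.Run m m₁ t₁) (h₂ : P.Run m m₂ t₂) : m₁ = m₂ ∧ t₁ = t₂ := by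
  induction h₁ generalizing m₂ t₂ with
  | skip m => cases h₂; exact ⟨rfl, rfl⟩
  | write m a i j e => cases h₂; exact ⟨rfl, rfl⟩
  | seq _ _ ih ih' =>
    cases h₂ with
    | seq h h' =>
      obtain ⟨rfl, rfl⟩ := ih h
      obtain ⟨rfl, rfl⟩ := ih' h'
      exact ⟨rfl, rfl⟩
  | cond_true he _ ih =>
    cases h₂ with
    | cond_true _ h => obtain ⟨rfl, rfl⟩ := ih h; exact ⟨rfl, rfl⟩
    | cond_false he' _ => exact absurd he' he
  | cond_false he _ ih =>
    cases h₂ with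
    | cond_true he' _ => exact absurd he he'
    | cond_false _ h => obtain ⟨rfl, rfl⟩ := ih h; exact ⟨rfl, rfl⟩
  | loop_true he _ _ ih ih' =>
    cases h₂ with
    | loop_true _ h h' =>
      obtain ⟨rfl, rfl⟩ := ih h
      obtain ⟨rfl, rfl⟩ := ih' h'
      exact ⟨rfl, rfl⟩
    | loop_false he' => exact absurd he' he
  | loop_false he =>
    cases h₂ with
    | loop_true he' _ _ => exact absurd he he'
    | loop_false _ => exact ⟨rfl, rfl⟩

/-! ### Input and output -/

open Classical in
/-- The memory that holds a graph `G` with vertices `0, …, n - 1` and a number `k`: array `0` holds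
`n` at `(0, 0)`, array `1` is the adjacency matrix of `G`, array `2` holds `k` at `(0, 0)`, and all
other entries are zero. -/
noncomputable def input {n : ℕ} (G : SimpleGraph (Fin n)) (k : ℕ) : Memory := fun a i j =>
  if a = 0 ∧ i = 0 ∧ j = 0 then n
  else if a = 1 ∧ ∃ (hi : i < n) (hj : j < n), G.Adj ⟨i, hi⟩ ⟨j, hj⟩ then 1
  else if a = 2 ∧ i = 0 ∧ j = 0 then k
  else 0

/-- The answer code of a final memory: array `3` at `(0, 0)`. -/
def answer (m : Memory) : ℕ := m 3 0 0

/-- The vertex set written in a final memory: `v` belongs to it if the entry of array `4` at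
`(v, 0)` is not zero. -/
def outputSet (n : ℕ) (m : Memory) : Set (Fin n) := {v | m 4 v 0 ≠ 0}

/-- The final memory `m` is a correct solution of the task to find a `P₅`-hitting set of `G` with
at most `k` vertices: the answer is `1` and such a set is returned, or the answer is `0` and
there is no such set. -/
def SolvesP5Hitting {n : ℕ} (G : SimpleGraph (Fin n)) (k : ℕ) (m : Memory) : Prop :=
  (answer m = 1 ∧ IsP5HittingSet G (outputSet n m) ∧ (outputSet n m).ncard ≤ k) ∨
  (answer m = 0 ∧ ¬ ∃ X : Set (Fin n), IsP5HittingSet G X ∧ X.ncard ≤ k)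

/-- The final memory `m` is a correct solution of the independent cutset problem for `G`: the
answer is `1` and an independent cutset is returned, or the answer is `0` and there is none. -/
def SolvesIndependentCutset {n : ℕ} (G : SimpleGraph (Fin n)) (m : Memory) : Prop :=
  (answer m = 1 ∧ IsIndependentCutset G (outputSet n m)) ∨
  (answer m = 0 ∧ ¬ ∃ S : Set (Fin n), IsIndependentCutset G S)

/-- A set of pairs `(G, k)`. -/
abbrev InstanceSet := ∀ n : ℕ, SimpleGraph (Fin n) → ℕ → Prop

/-- On each input `(G, k)` in `D`, where `G` has `n` vertices, the program `P` halts after at most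
`f(k)` times a polynomial in `n` many steps, and the final memory satisfies `Spec`. -/
def SolvesInOStar (P : Program) (D : InstanceSet)
    (Spec : ∀ n : ℕ, SimpleGraph (Fin n) → ℕ → Memory → Prop) (f : ℕ → ℝ≥0) : Prop :=
  ∃ p : ℕ[X], ∀ (n : ℕ) (G : SimpleGraph (Fin n)) (k : ℕ), D n G k →
    ∃ (m : Memory) (t : ℕ), P.Run (input G k) m t ∧ (t : ℝ≥0) ≤ f k * (p.eval n : ℕ) ∧
      Spec n G k m

/-!
An independent cutset `S` of `G` is encoded by a labelling of the vertices: `S` gets the label `0`,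
one component of `G - S` the label `1`, and the other components the label `2`. Then the labels at
the ends of an edge never add up to a multiple of `3` (`IsLabelling`), and conversely every such
labelling in which both `1` and `2` occur gives an independent cutset. Given a `P₅`-hitting set `X`, the algorithm goes through the
`3 ^ |X|` labellings of `X` and, for each of them, through all pairs of a vertex with label `1` and
a vertex with label `2`. Then the components of `G - X` can be treated independently of each other.

On a single component `C`, two labels per vertex can be handled as in the limited backtracking
algorithm for 2-SAT: choose a label for a vertex, propagate, and keep the result unless some vertex
has no label left. Such a commitment never loses solvability (`IsLabelling.exists_relabelling`). So
it suffices to reduce to at most two labels per vertex by polynomially many guesses. If `1` or `2`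
does not occur in `C`, then excluding that label is such a guess. Otherwise some vertex `s` of `C`
with label `0` has a neighbour `a` with label `1` and a neighbour `b` with label `2`
(`IsLabelling.exists_separating_vertex`). Choose each of `a` and `b`, among the neighbours of `s`
with its label, with as many neighbours as possible outside the closed neighbourhood of `s`. As `C` has no induced `P₅`, every vertex of `C`
has distance at most three from `s`, and fixing the labels of `a`, `s`, `b` excludes by unit
propagation at least one label at each vertex of `C` (`IsLabelling.exists_triple`).

A labelling that has been found is checked before it is returned, so soundness does not depend on
the search (`SoundAnswer`); completeness is carried by `attempt_spec`, `labelAll_spec` and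
`searchAll_spec`.

The programs are written as terms of type `Code`, whose only loops are counting loops. Their effect
is a total function (`Code.exec`), and the time bound is polynomial by `Code.Ok.run` and
`Code.exists_polynomial_cost`; only the loop over the labellings of `X` is treated separately. An
algorithm for hitting sets is run on a copy of the input in arrays that the rest of the program does
not use otherwise (`Program.Run.shift`).

Besides the arrays for input and output, the programs use array `5` for the set `X`, array `6` for
the labels of `X`, array `10` for the excluded labels, with a copy in array `11`, array `12` for the
labels found so far, and array `104` for the hitting set returned by the given algorithm. The other
arrays below `100` are registers: `7` and `8` bound and count the rounds of the search, `9` is a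
carry, `13` and `14` are loop bounds, `20`, `21` hold the guessed vertices with labels `1` and `2`,
`22` a vertex of the current component, `23` to `26` the parameters of an attempt, `30` to `34` are
loop counters, and `35` is a flag.
-/

/-! ### Labellings -/

/-- The labelling form of an independent cutset: label `0` marks the cutset and labels `1` and `2`
mark two sides. The forbidden pairs on an edge are `0, 0` and `1, 2`, that is, the pairs whose sum
is divisible by `3`. -/
structure IsLabelling {V : Type*} (G : SimpleGraph V) (f : V → ℕ) : Prop where
  lt_three : ∀ u, f u < 3
  adj : ∀ u v, G.Adj u v → (f u + f v) % 3 ≠ 0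

/-- If `Z u c` says that label `c` is excluded at the vertex `u`, then `Forces Z u d` says that
every label except possibly `d` is excluded at `u`. -/
def Forces {V : Type*} (Z : V → ℕ → Prop) (u : V) (d : ℕ) : Prop :=
  ∀ c < 3, c ≠ d → Z u c

/-- The exclusions `Z` are closed under unit propagation: a vertex that is forced to have the
label `d` excludes at its neighbours the label in conflict with `d`. -/
def UnitClosed {V : Type*} (G : SimpleGraph V) (Z : V → ℕ → Prop) : Prop :=
  ∀ u v d c, G.Adj u v → d < 3 → c < 3 → Forces Z u d → (d + c) % 3 = 0 → Z v c

/-- No five vertices induce a path. That the vertices are distinct follows from the listed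
adjacencies and nonadjacencies. -/
def NoInducedP5 {V : Type*} (K : SimpleGraph V) : Prop :=
  ∀ p₀ p₁ p₂ p₃ p₄, K.Adj p₀ p₁ → K.Adj p₁ p₂ → K.Adj p₂ p₃ → K.Adj p₃ p₄ →
    ¬ K.Adj p₀ p₂ → ¬ K.Adj p₀ p₃ → ¬ K.Adj p₀ p₄ → ¬ K.Adj p₁ p₃ → ¬ K.Adj p₁ p₄ →
    ¬ K.Adj p₂ p₄ → False

theorem Forces.mono {V : Type*} {Z Z' : V → ℕ → Prop} {u : V} {d : ℕ}
    (h : Forces Z u d) (hZ : ∀ c < 3, Z u c → Z' u c) : Forces Z' u d :=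
  fun c hc hcd => hZ c hc (h c hc hcd)

section Structure

variable {V : Type*} {K : SimpleGraph V} {f : V → ℕ}

/-- In a connected graph whose labelling uses both `1` and `2`, some vertex labelled `0` has
neighbours of both kinds: follow a path from a `1` to a `2`. -/
theorem IsLabelling.exists_separating_vertex (hf : IsLabelling K f) {a b : V}
    (hab : K.Reachable a b) (ha : f a = 1) (hb : f b = 2) :
    ∃ s x y, K.Reachable a s ∧ f s = 0 ∧ K.Adj s x ∧ f x = 1 ∧ K.Adj s y ∧ f y = 2 := by
  by_contra hno
  have key : ∀ v, Relation.ReflTransGen K.Adj a v →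
      f v = 1 ∨ (f v = 0 ∧ ∃ x, K.Adj v x ∧ f x = 1) := by
    intro v hv
    induction hv with
    | refl => exact Or.inl ha
    | @tail v w hav hvw ih =>
      have h1 := hf.adj v w hvw
      have h2 := hf.lt_three w
      rcases ih with h | ⟨h, x, hx, hx1⟩
      · rcases (show f w = 0 ∨ f w = 1 by omega) with h0 | h0
        · exact Or.inr ⟨h0, v, hvw.symm, h⟩
        · exact Or.inl h0
      · rcases (show f w = 1 ∨ f w = 2 by omega) with h0 | h0
        · exact Or.inl h0
        · exact absurd ⟨v, x, w, (SimpleGraph.reachable_iff_reflTransGen _ _).2 hav, h, hx, hx1,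
            hvw, h0⟩ hno
  have := key b ((SimpleGraph.reachable_iff_reflTransGen _ _).1 hab)
  omega

/-- A vertex at distance two from `s`, reached through a neighbour `w` of `s` on the same side as
`a`, loses a label once `a`, `s` and `b` are fixed, provided that `a` has the most neighbours
outside the closed neighbourhood of `s` among the neighbours of `s` on its side. -/
theorem exists_excluded_of_dist_two (hP : NoInducedP5 K) (hfin : ∀ v, (K.neighborSet v).Finite)
    (hf : IsLabelling K f) {Z : V → ℕ → Prop} (hZ : UnitClosed K Z) {a s b w u : V} {α β : ℕ}
    (hα : f a = α) (hβ : f b = β) (hαβ : α + β = 3) (hα0 : 0 < α) (hβ0 : 0 < β)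
    (hs : Forces Z s 0) (ha : Forces Z a α) (hb : Forces Z b β)
    (hsa : K.Adj s a) (hsb : K.Adj s b)
    (hmax : ∀ w, K.Adj s w → f w = α →
      {x | K.Adj w x ∧ x ≠ s ∧ ¬ K.Adj s x}.ncard ≤ {x | K.Adj a x ∧ x ≠ s ∧ ¬ K.Adj s x}.ncard)
    (hsw : K.Adj s w) (hw : f w = α) (hwu : K.Adj w u) (hus : u ≠ s) (hsu : ¬ K.Adj s u) :
    ∃ c < 3, Z u c := by
  by_cases hau : K.Adj a u
  · exact ⟨β, by omega, hZ a u α β hau (by omega) (by omega) ha (by omega)⟩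
  by_cases hbu : K.Adj b u
  · exact ⟨α, by omega, hZ b u β α hbu (by omega) (by omega) hb (by omega)⟩
  by_cases haw : K.Adj a w
  · refine ⟨β, by omega, hZ w u α β hwu (by omega) (by omega) ?_ (by omega)⟩
    intro c hc hcα
    rcases (show c = 0 ∨ c = β by omega) with rfl | rfl
    · exact hZ s w 0 0 hsw (by omega) (by omega) hs (by omega)
    · exact hZ a w α c haw (by omega) (by omega) ha (by omega)
  have hab : ¬ K.Adj b a := fun h => hf.adj _ _ h (by omega)
  -- Maximality of `a` gives a private neighbour of `a` with respect to `w`.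
  obtain ⟨x, hax, hxs, hsx, hwx⟩ : ∃ x, K.Adj a x ∧ x ≠ s ∧ ¬ K.Adj s x ∧ ¬ K.Adj w x := by
    by_contra! hno
    have hlt : {x | K.Adj a x ∧ x ≠ s ∧ ¬ K.Adj s x}.ncard
        < {x | K.Adj w x ∧ x ≠ s ∧ ¬ K.Adj s x}.ncard := by
      apply Set.ncard_lt_ncard _ ((hfin w).subset fun x hx => hx.1)
      refine ⟨fun x hx => ⟨hno x hx.1 hx.2.1 hx.2.2, hx.2⟩, fun h => ?_⟩
      exact hau (h (⟨hwu, hus, hsu⟩ : u ∈ {x | K.Adj w x ∧ x ≠ s ∧ ¬ K.Adj s x})).1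
    exact absurd (hmax w hsw hw) (by omega)
  have hxu : K.Adj x u := by
    by_contra hxu
    exact hP x a s w u hax.symm hsa.symm hsw hwu (fun h => hsx h.symm) (fun h => hwx h.symm) hxu
      haw hau hsu
  have hbx : K.Adj b x := by
    by_contra hbx
    exact hP b s a x u hsb.symm hsa hax hxu hab hbx hbu hsx hsu hau
  refine ⟨0, by omega, hZ x u 0 0 hxu (by omega) (by omega) ?_ (by omega)⟩
  intro c hc hc0
  rcases (show c = α ∨ c = β by omega) with rfl | rfl
  · exact hZ b x β c hbx (by omega) (by omega) hb (by omega)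
  · exact hZ a x α c hax (by omega) (by omega) ha (by omega)

/-- In a graph without induced `P₅`, every vertex has distance at most three from `s`. -/
theorem NoInducedP5.dist_le_three (hP : NoInducedP5 K) {s u : V} (h : K.Reachable s u) :
    (u = s ∨ K.Adj s u) ∨ (∃ w, K.Adj s w ∧ K.Adj w u) ∨
      ∃ w v, K.Adj s w ∧ K.Adj w v ∧ K.Adj v u := by
  rw [SimpleGraph.reachable_iff_reflTransGen] at h
  induction h with
  | refl => exact Or.inl (Or.inl rfl)
  | @tail u u' _ huu' ih =>
    rcases ih with (rfl | h) | ⟨w, h1, h2⟩ | ⟨w, v, h1, h2, h3⟩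
    · exact Or.inl (Or.inr huu')
    · exact Or.inr (Or.inl ⟨u, h, huu'⟩)
    · exact Or.inr (Or.inr ⟨w, u, h1, h2, huu'⟩)
    · by_contra hno
      push Not at hno
      obtain ⟨⟨h4, h5⟩, h6, h7⟩ := hno
      exact hP s w v u u' h1 h2 h3 huu' (fun h => h7 v u h h3 huu') (fun h => h6 u h huu') h5
        (fun h => h7 w u h1 h huu') (h6 w h1) (h7 w v h1 h2)

/-- The structural heart of the algorithm. If both sides occur in a component of a graph without
induced `P₅`, then fixing the labels of three suitable vertices leaves at most two labels at every
vertex of the component after unit propagation. -/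
theorem IsLabelling.exists_triple (hP : NoInducedP5 K) (hfin : ∀ v, (K.neighborSet v).Finite)
    (hf : IsLabelling K f) {r a₀ b₀ : V} (hra : K.Reachable r a₀) (hrb : K.Reachable r b₀)
    (ha₀ : f a₀ = 1) (hb₀ : f b₀ = 2) :
    ∃ a s b, K.Reachable r s ∧ K.Adj s a ∧ K.Adj s b ∧ f a = 1 ∧ f s = 0 ∧ f b = 2 ∧
      ∀ Z, UnitClosed K Z → Forces Z a 1 → Forces Z s 0 → Forces Z b 2 →
        ∀ u, K.Reachable r u → ∃ c < 3, Z u c := by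
  obtain ⟨s, x, y, hs, hs0, hsx, hx, hsy, hy⟩ :=
    hf.exists_separating_vertex (hra.symm.trans hrb) ha₀ hb₀
  have hmax : ∀ α x, K.Adj s x → f x = α → ∃ a, (K.Adj s a ∧ f a = α) ∧
      ∀ w, K.Adj s w → f w = α → {x | K.Adj w x ∧ x ≠ s ∧ ¬ K.Adj s x}.ncard ≤
        {x | K.Adj a x ∧ x ≠ s ∧ ¬ K.Adj s x}.ncard := by
    intro α x hsx hx
    obtain ⟨a, ha, hmax⟩ := Set.exists_max_image {w | K.Adj s w ∧ f w = α}
      (fun w => {x | K.Adj w x ∧ x ≠ s ∧ ¬ K.Adj s x}.ncard)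
      ((hfin s).subset fun w hw => hw.1) ⟨x, hsx, hx⟩
    exact ⟨a, ha, fun w h1 h2 => hmax w ⟨h1, h2⟩⟩
  obtain ⟨a, ⟨hsa, ha⟩, hamax⟩ := hmax 1 x hsx hx
  obtain ⟨b, ⟨hsb, hb⟩, hbmax⟩ := hmax 2 y hsy hy
  have hrs : K.Reachable r s := hra.trans hs
  refine ⟨a, s, b, hrs, hsa, hsb, ha, hs0, hb, fun Z hZ hFa hFs hFb u hu => ?_⟩
  by_cases hus : u = s
  · subst hus
    exact ⟨1, by omega, hFs 1 (by omega) (by omega)⟩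
  by_cases hsu : K.Adj s u
  · exact ⟨0, by omega, hZ s u 0 0 hsu (by omega) (by omega) hFs (by omega)⟩
  by_cases h2 : ∃ w, K.Adj s w ∧ K.Adj w u
  · obtain ⟨w, hsw, hwu⟩ := h2
    have h1 := hf.adj s w hsw
    have h2 := hf.lt_three w
    rcases (show f w = 1 ∨ f w = 2 by omega) with hw | hw
    · exact exists_excluded_of_dist_two hP hfin hf hZ ha hb rfl (by omega) (by omega) hFs hFa hFb
        hsa hsb hamax hsw hw hwu hus hsu
    · exact exists_excluded_of_dist_two hP hfin hf hZ hb ha rfl (by omega) (by omega) hFs hFb hFa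
        hsb hsa hbmax hsw hw hwu hus hsu
  rcases hP.dist_le_three (hrs.symm.trans hu) with (h | h) | h | ⟨w, v, hsw, hwv, hvu⟩
  · exact absurd h hus
  · exact absurd h hsu
  · exact absurd h h2
  have hsv : ¬ K.Adj s v := fun h => h2 ⟨v, h, hvu⟩
  have hwu : ¬ K.Adj w u := fun h => h2 ⟨w, hsw, h⟩
  have hau : ¬ K.Adj a u := fun h => h2 ⟨a, hsa, h⟩
  have hbu : ¬ K.Adj b u := fun h => h2 ⟨b, hsb, h⟩
  have hab : ¬ K.Adj a b := fun h => hf.adj _ _ h (by omega)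
  by_cases hav : K.Adj a v <;> by_cases hbv : K.Adj b v
  · refine ⟨0, by omega, hZ v u 0 0 hvu (by omega) (by omega) ?_ (by omega)⟩
    intro c hc hc0
    rcases (show c = 1 ∨ c = 2 by omega) with rfl | rfl
    · exact hZ b v 2 1 hbv (by omega) (by omega) hFb (by omega)
    · exact hZ a v 1 2 hav (by omega) (by omega) hFa (by omega)
  · exact (hP u v a s b hvu.symm hav.symm hsa.symm hsb (fun h => hau h.symm) (fun h => hsu h.symm)
      (fun h => hbu h.symm) (fun h => hsv h.symm) (fun h => hbv h.symm) hab).elim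
  · exact (hP u v b s a hvu.symm hbv.symm hsb.symm hsa (fun h => hbu h.symm) (fun h => hsu h.symm)
      (fun h => hau h.symm) (fun h => hsv h.symm) (fun h => hav h.symm) (fun h => hab h.symm)).elim
  · have h1 := hf.adj s w hsw
    have h3 := hf.lt_three w
    rcases (show f w = 1 ∨ f w = 2 by omega) with hw | hw
    · exact (hP u v w s b hvu.symm hwv.symm hsw.symm hsb (fun h => hwu h.symm)
        (fun h => hsu h.symm) (fun h => hbu h.symm) (fun h => hsv h.symm) (fun h => hbv h.symm)
        (fun h => hf.adj _ _ h (by omega))).elim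
    · exact (hP u v w s a hvu.symm hwv.symm hsw.symm hsa (fun h => hwu h.symm)
        (fun h => hsu h.symm) (fun h => hau h.symm) (fun h => hsv h.symm) (fun h => hav h.symm)
        (fun h => hf.adj _ _ h (by omega))).elim

end Structure

/-! ### Two labels per vertex -/

/-- The correctness of committing to a successful trial when at most two labels are left at each
vertex of `C`. Let `Z'` be closed and leave a label everywhere in `C`. Every vertex of `C` whose
old label is excluded by `Z'` is forced by `Z'` to have another label; relabelling these vertices
keeps the labelling valid. The vertices of `X` already have their labels forced by `Z`, and they
separate `C` from the rest. -/
theorem IsLabelling.exists_relabelling {V : Type*} {G : SimpleGraph V} {f : V → ℕ}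
    (hf : IsLabelling G f) {Z Z' : V → ℕ → Prop} {C X : V → Prop}
    (hZZ : ∀ u, C u ∨ X u → ∀ c < 3, Z u c → Z' u c) (hZ' : UnitClosed G Z')
    (hne : ∀ u, C u → ∃ c < 3, ¬ Z' u c) (hfZ : ∀ u, C u → ¬ Z u (f u))
    (htwo : ∀ u, C u → ∃ c < 3, Z u c) (hX : ∀ u, X u → Forces Z u (f u))
    (hC : ∀ u v, C u → ¬ C v → G.Adj u v → X u ∨ X v) :
    ∃ f', IsLabelling G f' ∧ (∀ u, C u → ¬ Z' u (f' u)) ∧ ∀ u, ¬ C u → f' u = f u := by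
  classical
  have hkey : ∀ u, C u → ∃ d < 3, ¬ Z' u d ∧ (d = f u ∨ Forces Z' u d) := by
    intro u hu
    by_cases h : Z' u (f u)
    · obtain ⟨d, hd, hdZ⟩ := hne u hu
      obtain ⟨c, hc, hcZ⟩ := htwo u hu
      have h1 : c ≠ f u := by rintro rfl; exact hfZ u hu hcZ
      have h2 : Z' u c := hZZ u (Or.inl hu) c hc hcZ
      have h3 : c ≠ d := by rintro rfl; exact hdZ h2
      have h4 : f u ≠ d := by rintro rfl; exact hdZ h
      refine ⟨d, hd, hdZ, Or.inr fun e he hed => ?_⟩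
      have := hf.lt_three u
      rcases (show e = c ∨ e = f u by omega) with rfl | rfl
      · exact h2
      · exact h
    · exact ⟨f u, hf.lt_three u, h, Or.inl rfl⟩
  choose! g hg3 hgZ hg using hkey
  have hgX : ∀ u, C u → X u → g u = f u := by
    intro u hu hx
    by_contra hne
    exact hgZ u hu (hZZ u (Or.inl hu) _ (hg3 u hu) (hX u hx _ (hg3 u hu) hne))
  refine ⟨fun u => if C u then g u else f u, ⟨fun u => ?_, ?_⟩, ?_, ?_⟩
  · by_cases hu : C u
    · simpa [hu] using hg3 u hu
    · simpa [hu] using hf.lt_three u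
  · have hmixed : ∀ u v, C u → ¬ C v → G.Adj u v → (g u + f v) % 3 ≠ 0 := by
      intro u v hu hv huv hcon
      rcases hC u v hu hv huv with h | h
      · rw [hgX u hu h] at hcon
        exact hf.adj u v huv hcon
      · refine hgZ u hu (hZ' v u (f v) (g u) huv.symm (hf.lt_three v) (hg3 u hu) ?_ (by omega))
        exact (hX v h).mono (hZZ v (Or.inr h))
    intro u v huv
    by_cases hu : C u <;> by_cases hv : C v <;> simp only [hu, hv, if_true, if_false]
    · intro hcon
      rcases hg u hu with h1 | h1
      · rcases hg v hv with h2 | h2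
        · rw [h1, h2] at hcon
          exact hf.adj u v huv hcon
        · exact hgZ u hu (hZ' v u _ _ huv.symm (hg3 v hv) (hg3 u hu) h2 (by omega))
      · exact hgZ v hv (hZ' u v _ _ huv (hg3 u hu) (hg3 v hv) h1 hcon)
    · exact hmixed u v hu hv huv
    · rw [add_comm]
      exact hmixed v u hv hu huv.symm
    · exact hf.adj u v huv
  · intro u hu
    simpa [hu] using hgZ u hu
  · intro u hu
    simp [hu]

/-! ### Programs with bounded loops -/

theorem Memory.set_ne {m : Memory} {a i j v b : ℕ} (h : b ≠ a) : m.set a i j v b = m b := by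
  funext x y
  simp [Memory.set, h]

theorem Memory.set_same (m : Memory) (a i j v x y : ℕ) :
    m.set a i j v a x y = if x = i ∧ y = j then v else m a x y := by
  simp [Memory.set]

namespace Expr

/-- The entry of array `a` at `(0, 0)`, used as a register. -/
def reg (a : ℕ) : Expr := .read a (.const 0) (.const 0)

/-- Negation of a test. -/
def not (e : Expr) : Expr := .sub (.const 1) e

/-- Conjunction of two tests. -/
def and (e f : Expr) : Expr := not (.add (not e) (not f))

/-- The test that two expressions have different values. -/
def ne (e f : Expr) : Expr := .add (.sub e f) (.sub f e)

variable {m : Memory} {e f : Expr}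

@[simp] theorem val_const (c : ℕ) : (Expr.const c).val m = c := rfl

@[simp] theorem val_read (a : ℕ) (i j : Expr) :
    (Expr.read a i j).val m = m a (i.val m) (j.val m) := rfl

@[simp] theorem val_reg (a : ℕ) : (reg a).val m = m a 0 0 := rfl

@[simp] theorem val_add : (Expr.add e f).val m = e.val m + f.val m := rfl

@[simp] theorem val_not_eq_zero : (not e).val m = 0 ↔ e.val m ≠ 0 := by
  simp only [not, Expr.val]
  omega

@[simp] theorem val_and_eq_zero : (and e f).val m = 0 ↔ e.val m = 0 ∨ f.val m = 0 := by
  simp only [and, not, Expr.val]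
  omega

@[simp] theorem val_ne_eq_zero : (ne e f).val m = 0 ↔ e.val m = f.val m := by
  simp only [ne, Expr.val]
  omega

end Expr

/-- Programs whose only loops are counting loops. `rep i b P` runs `P` with the register `i` going
through the values below the register `b`. -/
inductive Code : Type where
  | skip : Code
  | write (a : ℕ) (i j e : Expr) : Code
  | seq (P Q : Code) : Code
  | cond (e : Expr) (P Q : Code) : Code
  | rep (i b : ℕ) (P : Code) : Code

namespace Code

/-- The program of the random access machine that is denoted by a code. -/
def compile : Code → Program
  | skip => .skip
  | write a i j e => .write a i j e
  | seq P Q => .seq P.compile Q.compile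
  | cond e P Q => .cond e P.compile Q.compile
  | rep i b P => .seq (.write i (.const 0) (.const 0) (.const 0))
      (.loop (.sub (.reg b) (.reg i))
        (.seq P.compile (.write i (.const 0) (.const 0) (.add (.reg i) (.const 1)))))

/-- The memory after the execution of a code. For loops this presupposes that the body does not
change the counter and the bound, see `Code.Ok`. -/
def exec : Code → Memory → Memory
  | skip, m => m
  | write a i j e, m => m.set a (i.val m) (j.val m) (e.val m)
  | seq P Q, m => Q.exec (P.exec m)
  | cond e P Q, m => if e.val m = 0 then Q.exec m else P.exec m
  | rep i b P, m => Nat.rec (m.set i 0 0 0) (fun k m' => (P.exec m').set i 0 0 (k + 1)) (m b 0 0)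

/-- The arrays that a code may change. -/
def writes : Code → List ℕ
  | skip => []
  | write a _ _ _ => [a]
  | seq P Q => P.writes ++ Q.writes
  | cond _ P Q => P.writes ++ Q.writes
  | rep i _ P => i :: P.writes

/-- All loops are bounded by registers in `B`, nothing in `B` is ever changed, and no loop body
changes its own counter. -/
def Ok (B : List ℕ) : Code → Prop
  | skip => True
  | write a _ _ _ => a ∉ B
  | seq P Q => P.Ok B ∧ Q.Ok B
  | cond _ P Q => P.Ok B ∧ Q.Ok B
  | rep i b P => b ∈ B ∧ i ∉ B ∧ i ∉ P.writes ∧ P.Ok B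

instance decidableOk (B : List ℕ) : ∀ P : Code, Decidable (P.Ok B)
  | skip => inferInstanceAs (Decidable True)
  | write a _ _ _ => inferInstanceAs (Decidable (a ∉ B))
  | seq P Q => @instDecidableAnd _ _ (decidableOk B P) (decidableOk B Q)
  | cond _ P Q => @instDecidableAnd _ _ (decidableOk B P) (decidableOk B Q)
  | rep i b P =>
    have := decidableOk B P
    inferInstanceAs (Decidable (b ∈ B ∧ i ∉ B ∧ i ∉ P.writes ∧ P.Ok B))

/-- A bound for the number of steps when every loop has at most `N` rounds. -/
def cost (N : ℕ) : Code → ℕ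
  | skip => 1
  | write _ _ _ _ => 1
  | seq P Q => P.cost N + Q.cost N
  | cond _ P Q => P.cost N + Q.cost N + 1
  | rep _ _ P => N * (P.cost N + 2) + 2

theorem exists_polynomial_cost (P : Code) : ∃ p : ℕ[X], ∀ N, P.cost N = p.eval N := by
  induction P with
  | skip => exact ⟨1, fun N => by simp [cost]⟩
  | write => exact ⟨1, fun N => by simp [cost]⟩
  | seq P Q hP hQ =>
    obtain ⟨p, hp⟩ := hP
    obtain ⟨q, hq⟩ := hQ
    exact ⟨p + q, fun N => by simp [cost, hp, hq]⟩
  | cond e P Q hP hQ =>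
    obtain ⟨p, hp⟩ := hP
    obtain ⟨q, hq⟩ := hQ
    exact ⟨p + q + 1, fun N => by simp [cost, hp, hq]⟩
  | rep i b P hP =>
    obtain ⟨p, hp⟩ := hP
    exact ⟨.X * (p + 2) + 2, fun N => by simp [cost, hp]⟩

theorem exec_of_not_mem_writes {P : Code} {a : ℕ} (ha : a ∉ P.writes) (m : Memory) :
    P.exec m a = m a := by
  induction P generalizing m with
  | skip => rfl
  | write b i j e =>
    simp only [writes, List.mem_singleton] at ha
    exact Memory.set_ne ha
  | seq P Q hP hQ =>
    simp only [writes, List.mem_append, not_or] at ha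
    exact (hQ ha.2 _).trans (hP ha.1 _)
  | cond e P Q hP hQ =>
    simp only [writes, List.mem_append, not_or] at ha
    simp only [exec]
    split
    · exact hQ ha.2 _
    · exact hP ha.1 _
  | rep i b P hP =>
    simp only [writes, List.mem_cons, not_or] at ha
    simp only [exec]
    generalize m b 0 0 = K
    induction K with
    | zero => exact Memory.set_ne ha.1
    | succ k ih => exact (Memory.set_ne ha.1).trans ((hP ha.2 _).trans ih)

theorem Ok.not_mem_writes {B : List ℕ} {P : Code} (h : P.Ok B) {b : ℕ} (hb : b ∈ B) :
    b ∉ P.writes := by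
  induction P with
  | skip => simp [writes]
  | write a i j e =>
    simp only [writes, List.mem_singleton]
    rintro rfl
    exact h hb
  | seq P Q hP hQ => simpa [writes] using ⟨hP h.1, hQ h.2⟩
  | cond e P Q hP hQ => simpa [writes] using ⟨hP h.1, hQ h.2⟩
  | rep i c P hP =>
    simp only [writes, List.mem_cons, not_or]
    refine ⟨?_, hP h.2.2.2⟩
    rintro rfl
    exact h.2.1 hb

/-- Induction along a counting loop. The hypothesis for a single round includes the value of the
counter and the fact that only the arrays written by the loop have changed. -/
theorem exec_rep_induction {i b : ℕ} {P : Code} {m : Memory} (I : ℕ → Memory → Prop)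
    (h₀ : I 0 (m.set i 0 0 0))
    (hstep : ∀ k < m b 0 0, ∀ m' : Memory, m' i 0 0 = k →
      (∀ a, a ∉ (rep i b P).writes → m' a = m a) → I k m' →
      I (k + 1) ((P.exec m').set i 0 0 (k + 1))) :
    I (m b 0 0) ((rep i b P).exec m) := by
  simp only [exec]
  generalize m b 0 0 = K at hstep
  suffices h : ∀ k ≤ K, ∀ m', m' = (Nat.rec (m.set i 0 0 0)
      (fun k m' => (P.exec m').set i 0 0 (k + 1)) k : Memory) →
      m' i 0 0 = k ∧ (∀ a, a ∉ (rep i b P).writes → m' a = m a) ∧ I k m' from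
    (h K le_rfl _ rfl).2.2
  intro k
  induction k with
  | zero =>
    rintro - m' rfl
    refine ⟨by simp [Memory.set_same], fun a ha => ?_, h₀⟩
    simp only [writes, List.mem_cons, not_or] at ha
    exact Memory.set_ne ha.1
  | succ k ih =>
    rintro hk m' rfl
    obtain ⟨h1, h2, h3⟩ := ih (by omega) _ rfl
    refine ⟨by simp [Memory.set_same], fun a ha => ?_, hstep k (by omega) _ h1 h2 h3⟩
    have ha' := ha
    simp only [writes, List.mem_cons, not_or] at ha'
    exact (Memory.set_ne ha'.1).trans ((exec_of_not_mem_writes ha'.2 _).trans (h2 a ha))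

/-- Exhaustive search by a counting loop: if all rounds preserve `Q`, then so does the loop, and if
the round in which the counter has the value `k₀` establishes `Q`, then `Q` holds in the end. -/
theorem exec_rep_search {i b : ℕ} {P : Code} {m : Memory} (Q : Memory → Prop)
    (hQset : ∀ m k, Q m → Q (m.set i 0 0 k))
    (hQ : ∀ m' : Memory, (∀ a, a ∉ (rep i b P).writes → m' a = m a) → m' i 0 0 < m b 0 0 →
      Q m' → Q (P.exec m')) :
    (Q m → Q ((rep i b P).exec m)) ∧
      ∀ k₀ < m b 0 0, (∀ m' : Memory, (∀ a, a ∉ (rep i b P).writes → m' a = m a) →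
        m' i 0 0 = k₀ → Q (P.exec m')) → Q ((rep i b P).exec m) := by
  refine ⟨fun hm => ?_, fun k₀ hk₀ hgoal => ?_⟩
  · exact exec_rep_induction (fun _ m => Q m) (hQset _ _ hm)
      fun k hk m' hk' hfr h => hQset _ _ (hQ _ hfr (by omega) h)
  · refine exec_rep_induction (fun k m => k₀ < k → Q m) (fun h => by omega)
      (fun k hk m' hk' hfr h hlt => hQset _ _ ?_) hk₀
    rcases (show k₀ < k ∨ k = k₀ by omega) with h1 | rfl
    · exact hQ _ hfr (by omega) (h h1)
    · exact hgoal _ hfr hk'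

/-- A counting loop with `K` rounds of at most `T` steps takes at most `K * (T + 2) + 2` steps. -/
theorem run_rep {i b : ℕ} {P : Code} (hib : i ≠ b) (hi : i ∉ P.writes) (hb : b ∉ P.writes)
    {T : ℕ} (J : Memory → Prop) (hJset : ∀ m k, J m → J (m.set i 0 0 k))
    (hrun : ∀ m, J m → J (P.exec m) ∧ ∃ t ≤ T, P.compile.Run m (P.exec m) t)
    (m : Memory) (hm : J m) :
    ∃ t ≤ m b 0 0 * (T + 2) + 2, (rep i b P).compile.Run m ((rep i b P).exec m) t := by
  have hib' : b ≠ i := fun h => hib h.symm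
  -- The loop is entered with `k` rounds done and `d` rounds left.
  have key : ∀ d k : ℕ, ∀ m' : Memory, J m' → m' i 0 0 = k → m' b 0 0 = k + d →
      ∃ t ≤ d * (T + 2) + 1, Program.Run
        (.loop (.sub (.reg b) (.reg i))
          (.seq P.compile (.write i (.const 0) (.const 0) (.add (.reg i) (.const 1)))))
        m' (Nat.rec m' (fun j m'' => (P.exec m'').set i 0 0 (k + j + 1)) d) t := by
    intro d
    induction d with
    | zero =>
      intro k m' _ hk hb
      exact ⟨1, by omega, .loop_false (by simp [Expr.val, hk, hb])⟩
    | succ d ih =>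
      intro k m' hJ hk hb'
      obtain ⟨hJ', t, ht, hr⟩ := hrun m' hJ
      have hi' : P.exec m' i = m' i := exec_of_not_mem_writes hi m'
      have hw := Program.Run.write (P.exec m') i (.const 0) (.const 0) (.add (.reg i) (.const 1))
      simp only [Expr.val_const, Expr.val_add, Expr.val_reg, hi', hk] at hw
      obtain ⟨t', ht', hr'⟩ := ih (k + 1) ((P.exec m').set i 0 0 (k + 1)) (hJset _ _ hJ')
        (by simp [Memory.set_same])
        (by rw [Memory.set_ne hib', exec_of_not_mem_writes hb, hb']; omega)
      have hrec : ∀ d, (Nat.rec ((P.exec m').set i 0 0 (k + 1))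
          (fun j m'' => (P.exec m'').set i 0 0 (k + 1 + j + 1)) d : Memory) =
          Nat.rec m' (fun j m'' => (P.exec m'').set i 0 0 (k + j + 1)) (d + 1) := by
        intro d
        induction d with
        | zero => rfl
        | succ d ihd =>
          refine (congrArg (fun x => (P.exec x).set i 0 0 (k + 1 + d + 1)) ihd).trans ?_
          simp only [show k + 1 + d + 1 = k + (d + 1) + 1 by omega]
      rw [hrec] at hr'
      refine ⟨t + 1 + t' + 1, ?_, .loop_true ?_ (hr.seq hw) hr'⟩
      · have : (d + 1) * (T + 2) = d * (T + 2) + (T + 2) := by ring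
        omega
      · simp [Expr.val, hk, hb']
  obtain ⟨t, ht, hr⟩ := key (m b 0 0) 0 (m.set i 0 0 0) (hJset _ _ hm)
    (by simp [Memory.set_same]) (by rw [Memory.set_ne hib', Nat.zero_add])
  have hw := Program.Run.write m i (.const 0) (.const 0) (.const 0)
  simp only [Nat.zero_add] at hr
  exact ⟨1 + t, by omega, hw.seq hr⟩

/-- A code all of whose loop bounds are at most `N` halts within `cost N` steps. -/
theorem Ok.run {B : List ℕ} {P : Code} (h : P.Ok B) {N : ℕ} {m : Memory}
    (hm : ∀ b ∈ B, m b 0 0 ≤ N) : ∃ t ≤ P.cost N, P.compile.Run m (P.exec m) t := by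
  induction P generalizing m with
  | skip => exact ⟨1, le_rfl, .skip m⟩
  | write a i j e => exact ⟨1, le_rfl, .write m a i j e⟩
  | seq P Q hP hQ =>
    obtain ⟨t, ht, hr⟩ := hP h.1 hm
    obtain ⟨t', ht', hr'⟩ := hQ h.2 (m := P.exec m)
      fun b hb => by rw [exec_of_not_mem_writes (h.1.not_mem_writes hb)]; exact hm b hb
    exact ⟨t + t', by simp only [cost]; omega, hr.seq hr'⟩
  | cond e P Q hP hQ =>
    simp only [exec]
    split
    · rename_i he
      obtain ⟨t, ht, hr⟩ := hQ h.2 hm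
      exact ⟨t + 1, by simp only [cost]; omega, .cond_false he hr⟩
    · rename_i he
      obtain ⟨t, ht, hr⟩ := hP h.1 hm
      exact ⟨t + 1, by simp only [cost]; omega, .cond_true he hr⟩
  | rep i b P hP =>
    obtain ⟨hb, hi, hiP, hOk⟩ := h
    obtain ⟨t, ht, hr⟩ := run_rep (i := i) (b := b) (P := P) (T := P.cost N)
      (by rintro rfl; exact hi hb) hiP (hOk.not_mem_writes hb)
      (fun m => ∀ b ∈ B, m b 0 0 ≤ N)
      (fun m k h c hc => by rw [Memory.set_ne (by rintro rfl; exact hi hc)]; exact h c hc)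
      (fun m h => ⟨fun c hc => by
        rw [exec_of_not_mem_writes (hOk.not_mem_writes hc)]; exact h c hc, hP hOk h⟩) m hm
    refine ⟨t, ht.trans ?_, hr⟩
    simp only [cost]
    gcongr
    exact hm b hb

end Code

/-! ### Renaming arrays -/

/-- The expression with all array names raised by `d`. -/
def Expr.shift (d : ℕ) : Expr → Expr
  | .const c => .const c
  | .read a i j => .read (a + d) (i.shift d) (j.shift d)
  | .add e f => .add (e.shift d) (f.shift d)
  | .sub e f => .sub (e.shift d) (f.shift d)

/-- The program with all array names raised by `d`. -/
def Program.shift (d : ℕ) : Program → Program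
  | .skip => .skip
  | .write a i j e => .write (a + d) (i.shift d) (j.shift d) (e.shift d)
  | .seq P Q => .seq (P.shift d) (Q.shift d)
  | .cond e P Q => .cond (e.shift d) (P.shift d) (Q.shift d)
  | .loop e P => .loop (e.shift d) (P.shift d)

theorem Expr.val_shift {d : ℕ} {m M : Memory} (h : ∀ a, M (a + d) = m a) (e : Expr) :
    (e.shift d).val M = e.val m := by
  induction e with
  | const c => rfl
  | read a i j hi hj => simp [Expr.shift, Expr.val, hi, hj, h]
  | add e f he hf => simp [Expr.shift, Expr.val, he, hf]
  | sub e f he hf => simp [Expr.shift, Expr.val, he, hf]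

/-- A program with raised array names does the same as the original one on the upper arrays, in the
same number of steps, and leaves the lower arrays alone. -/
theorem Program.Run.shift {d : ℕ} {P : Program} {m m' : Memory} {t : ℕ} (h : P.Run m m' t)
    {M : Memory} (hM : ∀ a, M (a + d) = m a) :
    ∃ M', (P.shift d).Run M M' t ∧ (∀ a, M' (a + d) = m' a) ∧ ∀ a < d, M' a = M a := by
  induction h generalizing M with
  | skip m => exact ⟨M, .skip M, hM, fun _ _ => rfl⟩
  | write m a i j e =>
    refine ⟨_, .write M (a + d) _ _ _, fun b => ?_, fun b hb => Memory.set_ne (by omega)⟩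
    funext x y
    simp [Memory.set, Expr.val_shift hM, hM]
  | seq _ _ ih ih' =>
    obtain ⟨M₁, h1, h2, h3⟩ := ih hM
    obtain ⟨M₂, h4, h5, h6⟩ := ih' h2
    exact ⟨M₂, h1.seq h4, h5, fun a ha => (h6 a ha).trans (h3 a ha)⟩
  | cond_true he _ ih =>
    obtain ⟨M₁, h1, h2, h3⟩ := ih hM
    exact ⟨M₁, .cond_true (by rwa [Expr.val_shift hM]) h1, h2, h3⟩
  | cond_false he _ ih =>
    obtain ⟨M₁, h1, h2, h3⟩ := ih hM
    exact ⟨M₁, .cond_false (by rwa [Expr.val_shift hM]) h1, h2, h3⟩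
  | loop_true he _ _ ih ih' =>
    obtain ⟨M₁, h1, h2, h3⟩ := ih hM
    obtain ⟨M₂, h4, h5, h6⟩ := ih' h2
    exact ⟨M₂, .loop_true (by rwa [Expr.val_shift hM]) h1 h4, h5,
      fun a ha => (h6 a ha).trans (h3 a ha)⟩
  | loop_false he => exact ⟨M, .loop_false (by rwa [Expr.val_shift hM]), hM, fun _ _ => rfl⟩

/-! ### Unit propagation -/

/-- The graph `G` without the edges that meet `X`. Its components are those of `G - X` and the
single vertices of `X`. -/
def core {V : Type*} (G : SimpleGraph V) (X : V → Prop) : SimpleGraph V where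
  Adj u v := G.Adj u v ∧ ¬ X u ∧ ¬ X v
  symm := ⟨fun _ _ h => ⟨h.1.symm, h.2.2, h.2.1⟩⟩
  loopless := ⟨fun _ h => G.irrefl h.1⟩

/-- The exclusions at `v` that an edge from `u` to `v` enforces. The column `3` of a table of
exclusions holds a set of vertices that spreads along the edges of `core G X`. -/
def Enforces {V : Type*} (X : V → Prop) (Z : V → ℕ → Prop) (u v : V) (c : ℕ) : Prop :=
  (c = 0 ∧ Z u 1 ∧ Z u 2) ∨ (c = 1 ∧ Z u 0 ∧ Z u 1) ∨ (c = 2 ∧ Z u 0 ∧ Z u 2) ∨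
    (c = 3 ∧ Z u 3 ∧ ¬ X u ∧ ¬ X v)

/-- A table of exclusions that is closed under unit propagation and whose column `3` is closed
under adjacency in `core G X`. -/
def PropClosed {V : Type*} (G : SimpleGraph V) (X : V → Prop) (Z : V → ℕ → Prop) : Prop :=
  ∀ u v c, G.Adj u v → Enforces X Z u v c → Z v c

theorem Enforces.mono {V : Type*} {X : V → Prop} {Z W : V → ℕ → Prop} (h : Z ≤ W) {u v : V} {c : ℕ}
    (hZ : Enforces X Z u v c) : Enforces X W u v c := by
  have := h u 0; have := h u 1; have := h u 2; have := h u 3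
  simp only [Enforces, le_Prop_eq] at *
  tauto

theorem PropClosed.unitClosed {V : Type*} {G : SimpleGraph V} {X : V → Prop} {Z : V → ℕ → Prop}
    (h : PropClosed G X Z) : UnitClosed G Z := by
  intro u v d c huv hd hc hF hdc
  refine h u v c huv ?_
  rcases (show (d = 0 ∧ c = 0) ∨ (d = 1 ∧ c = 2) ∨ (d = 2 ∧ c = 1) by omega) with
    ⟨rfl, rfl⟩ | ⟨rfl, rfl⟩ | ⟨rfl, rfl⟩
  · exact Or.inl ⟨rfl, hF 1 (by omega) (by omega), hF 2 (by omega) (by omega)⟩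
  · exact Or.inr (Or.inr (Or.inl ⟨rfl, hF 0 (by omega) (by omega), hF 2 (by omega) (by omega)⟩))
  · exact Or.inr (Or.inl ⟨rfl, hF 0 (by omega) (by omega), hF 1 (by omega) (by omega)⟩)

theorem PropClosed.reachable {V : Type*} {G : SimpleGraph V} {X : V → Prop} {Z : V → ℕ → Prop}
    (h : PropClosed G X Z) {r u : V} (hr : Z r 3) (hu : (core G X).Reachable r u) : Z u 3 := by
  rw [SimpleGraph.reachable_iff_reflTransGen] at hu
  induction hu with
  | refl => exact hr
  | tail _ huv ih => exact h _ _ 3 huv.1 (Or.inr (Or.inr (Or.inr ⟨rfl, ih, huv.2⟩)))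

/-- The largest table that a given labelling and a given component of `core G X` allow. -/
theorem IsLabelling.propClosed {V : Type*} {G : SimpleGraph V} {X : V → Prop} {f : V → ℕ}
    (hf : IsLabelling G f) (r : V) :
    PropClosed G X fun u c => (c < 3 → c ≠ f u) ∧ (c = 3 → (core G X).Reachable r u) := by
  intro u v c huv h
  have h1 := hf.adj u v huv
  have h2 := hf.lt_three u
  rcases h with ⟨rfl, h3, h4⟩ | ⟨rfl, h3, h4⟩ | ⟨rfl, h3, h4⟩ | ⟨rfl, h3, h4⟩
  · have := h3.1 (by omega); have := h4.1 (by omega)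
    exact ⟨fun _ => by omega, fun h => by omega⟩
  · have := h3.1 (by omega); have := h4.1 (by omega)
    exact ⟨fun _ => by omega, fun h => by omega⟩
  · have := h3.1 (by omega); have := h4.1 (by omega)
    exact ⟨fun _ => by omega, fun h => by omega⟩
  · exact ⟨fun h => by omega, fun _ =>
      (h3.2 rfl).trans (SimpleGraph.Adj.reachable (show (core G X).Adj u v from ⟨huv, h4⟩))⟩

/-- Column `3` alone: it may be any component of `core G X`, whatever is excluded. -/
theorem propClosed_component {V : Type*} (G : SimpleGraph V) (X : V → Prop) (r : V) :
    PropClosed G X fun u c => c = 3 → (core G X).Reachable r u := by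
  rintro u v c huv (⟨rfl, h3⟩ | ⟨rfl, h3⟩ | ⟨rfl, h3⟩ | ⟨rfl, h3, h4⟩) hc
  · omega
  · omega
  · omega
  · exact (h3 rfl).trans (SimpleGraph.Adj.reachable (show (core G X).Adj u v from ⟨huv, h4⟩))

/-- The memory `m` holds the number `n` of vertices, the adjacency matrix of `G` and the set `X`,
and the registers `13` and `14` hold the loop bounds `4 * n + 1` and `3`. -/
structure Env (n : ℕ) (G : SimpleGraph ℕ) (X : ℕ → Prop) (m : Memory) : Prop where
  size : m 0 0 0 = n
  adj : ∀ u v, m 1 u v ≠ 0 ↔ G.Adj u v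
  mem : ∀ u, m 5 u 0 ≠ 0 ↔ X u
  rounds : m 13 0 0 = 4 * n + 1
  three : m 14 0 0 = 3

theorem Env.congr {n : ℕ} {G : SimpleGraph ℕ} {X : ℕ → Prop} {m m' : Memory} (h : Env n G X m)
    (h' : ∀ a ∈ [0, 1, 5, 13, 14], m' a = m a) : Env n G X m' := by
  simp only [List.forall_mem_cons] at h'
  obtain ⟨h0, h1, h5, h13, h14, -⟩ := h'
  exact ⟨by rw [h0, h.size], by simpa [h1] using h.adj, by simpa [h5] using h.mem,
    by rw [h13, h.rounds], by rw [h14, h.three]⟩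

theorem Env.exec {n : ℕ} {G : SimpleGraph ℕ} {X : ℕ → Prop} {m : Memory} (h : Env n G X m)
    {P : Code} (hP : ∀ a ∈ [0, 1, 5, 13, 14], a ∉ P.writes) : Env n G X (P.exec m) :=
  h.congr fun a ha => Code.exec_of_not_mem_writes (hP a ha) m

/-- The table of exclusions in array `10`, restricted to its four columns and the `n` vertices. -/
def excluded (n : ℕ) (m : Memory) (u c : ℕ) : Prop := u < n ∧ c < 4 ∧ m 10 u c ≠ 0

theorem excluded_congr {n : ℕ} {m m' : Memory} (h : m' 10 = m 10) :
    excluded n m' = excluded n m := by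
  funext u c
  simp [excluded, h]

/-- The entry of the table of exclusions for the vertex in register `i` and the label `c`. -/
def exclE (i c : ℕ) : Expr := .read 10 (.reg i) (.const c)

@[simp] theorem val_exclE (i c : ℕ) (m : Memory) : (exclE i c).val m = m 10 (m i 0 0) c := rfl

namespace Code

/-- Unit propagation along the edge from the vertex in register `31` to that in register `32`. -/
def propagateEdge : Code :=
  cond (.read 1 (.reg 31) (.reg 32))
    (seq (write 10 (.reg 32) (.const 0) (.add (exclE 32 0) (.and (exclE 31 1) (exclE 31 2))))
    (seq (write 10 (.reg 32) (.const 1) (.add (exclE 32 1) (.and (exclE 31 0) (exclE 31 1))))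
    (seq (write 10 (.reg 32) (.const 2) (.add (exclE 32 2) (.and (exclE 31 0) (exclE 31 2))))
    (write 10 (.reg 32) (.const 3) (.add (exclE 32 3) (.and (exclE 31 3)
      (.and (.not (.read 5 (.reg 31) (.const 0))) (.not (.read 5 (.reg 32) (.const 0)))))))))) skip

/-- One round of unit propagation along all edges. -/
def propagateRound : Code := rep 31 0 (rep 32 0 propagateEdge)

/-- Unit propagation until nothing changes. -/
def propagate : Code := rep 30 13 propagateRound

end Code

section Propagate

open Code

variable {n : ℕ} {G : SimpleGraph ℕ} {X : ℕ → Prop} {m : Memory}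

theorem excluded_exclude {i c : ℕ} (hi : m i 0 0 < n) (hc : c < 4) (e : Expr) (x d : ℕ) :
    excluded n ((write 10 (.reg i) (.const c) (.add (exclE i c) e)).exec m) x d ↔
      excluded n m x d ∨ (x = m i 0 0 ∧ d = c ∧ e.val m ≠ 0) := by
  by_cases hx : x = m i 0 0 ∧ d = c
  · obtain ⟨rfl, rfl⟩ := hx
    simp [excluded, exec, Memory.set_same, hi, hc]
    tauto
  · simp [excluded, exec, Memory.set_same, hx]
    tauto

theorem excluded_propagateEdge (hn : ∀ u v, G.Adj u v → u < n) (h : Env n G X m) (x c : ℕ) :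
    excluded n (propagateEdge.exec m) x c ↔ excluded n m x c ∨
      (G.Adj (m 31 0 0) (m 32 0 0) ∧ x = m 32 0 0 ∧
        Enforces X (excluded n m) (m 31 0 0) (m 32 0 0) c) := by
  by_cases huv : G.Adj (m 31 0 0) (m 32 0 0)
  · have hu := hn _ _ huv
    have hv := hn _ _ huv.symm
    have hne := huv.ne
    have h1 := (h.adj _ _).2 huv
    simp only [propagateEdge, exec.eq_4, Expr.val_read, Expr.val_reg, h1, if_false]
    have key : ∀ (m' : Memory) (c : ℕ) (e : Expr), (∀ a, a ≠ 10 → m' a = m a) → c < 4 →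
        ∀ x d, excluded n ((write 10 (.reg 32) (.const c) (.add (exclE 32 c) e)).exec m') x d ↔
          excluded n m' x d ∨ (x = m 32 0 0 ∧ d = c ∧ e.val m' ≠ 0) := by
      intro m' c e hm' hc x d
      rw [excluded_exclude (by rwa [hm' 32 (by decide)]) hc, hm' 32 (by decide)]
    simp only [exec.eq_3]
    rw [key _ _ _ _ (by decide), key _ _ _ _ (by decide), key _ _ _ _ (by decide),
      key _ _ _ _ (by decide)]
    · have hX : ∀ u, m 5 u 0 = 0 ↔ ¬ X u := fun u => by rw [← h.mem u, not_not]
      have hex : ∀ c < 4, excluded n m (m 31 0 0) c ↔ m 10 (m 31 0 0) c ≠ 0 :=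
        fun c hc => by simp [excluded, hu, hc]
      simp [exec, Memory.set_ne, Memory.set_same, hne, huv, Enforces, hX, hex]
      tauto
    all_goals
      intro a ha
      simp [exec, Memory.set_ne, ha]
  · have h1 : m 1 (m 31 0 0) (m 32 0 0) = 0 := by
      by_contra h0
      exact huv ((h.adj _ _).1 h0)
    simp [propagateEdge, exec, h1, huv]

theorem excluded_set_ne {a : ℕ} (ha : a ≠ 10) (i j v : ℕ) :
    excluded n (m.set a i j v) = excluded n m :=
  excluded_congr (Memory.set_ne ha.symm)

/-- The state within a round of unit propagation that started with the table `Z₀`, after the edges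
in `done` have been treated: nothing is lost, only consequences are added, and if nothing was
added, then `Z₀` is closed under propagation along the treated edges. -/
def RoundInvariant (G : SimpleGraph ℕ) (X : ℕ → Prop) (Z₀ : ℕ → ℕ → Prop)
    (done : ℕ → ℕ → Prop) (Z : ℕ → ℕ → Prop) : Prop :=
  Z₀ ≤ Z ∧ (∀ W, PropClosed G X W → Z₀ ≤ W → Z ≤ W) ∧
    (Z ≤ Z₀ → ∀ u v c, done u v → G.Adj u v → Enforces X Z₀ u v c → Z₀ v c)

theorem RoundInvariant.propagateEdge (hn : ∀ u v, G.Adj u v → u < n) (h : Env n G X m)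
    {Z₀ : ℕ → ℕ → Prop} {done done' : ℕ → ℕ → Prop}
    (hI : RoundInvariant G X Z₀ done (excluded n m))
    (hdone : ∀ u v, done' u v → done u v ∨ (u = m 31 0 0 ∧ v = m 32 0 0)) :
    RoundInvariant G X Z₀ done' (excluded n (propagateEdge.exec m)) := by
  obtain ⟨h1, h2, h3⟩ := hI
  have hex := excluded_propagateEdge hn h
  have hle : excluded n m ≤ excluded n (Code.propagateEdge.exec m) :=
    fun x c hx => (hex x c).2 (Or.inl hx)
  refine ⟨h1.trans hle, fun W hW hZW x c hx => ?_, fun hback u v c huv hadj henf => ?_⟩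
  · rcases (hex x c).1 hx with hx | ⟨hadj, rfl, henf⟩
    · exact h2 W hW hZW x c hx
    · exact hW _ _ c hadj (henf.mono (h2 W hW hZW))
  · rcases hdone u v huv with huv | ⟨rfl, rfl⟩
    · exact h3 (hle.trans hback) u v c huv hadj henf
    · exact hback _ c ((hex _ c).2 (Or.inr ⟨hadj, rfl, henf.mono h1⟩))

theorem roundInvariant_propagateRound (hn : ∀ u v, G.Adj u v → u < n) (h : Env n G X m) :
    RoundInvariant G X (excluded n m) (fun _ _ => True) (excluded n (propagateRound.exec m)) := by
  have houter := exec_rep_induction (i := 31) (b := 0) (P := rep 32 0 propagateEdge) (m := m)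
    (fun k m' => RoundInvariant G X (excluded n m) (fun u _ => u < k) (excluded n m')) ?_ ?_
  · rw [h.size] at houter
    obtain ⟨h1, h2, h3⟩ := houter
    exact ⟨h1, h2, fun hb u v c _ huv => h3 hb u v c (hn u v huv) huv⟩
  · rw [excluded_set_ne (by decide)]
    exact ⟨le_rfl, fun W _ hW => hW, fun _ u v c hu => absurd hu (by omega)⟩
  · intro k hk m' hk' hfr hI
    have henv : Env n G X m' := h.congr fun a ha => hfr a (by revert a; decide)
    rw [excluded_set_ne (by decide)]
    have hinner := exec_rep_induction (i := 32) (b := 0) (P := propagateEdge) (m := m')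
      (fun l m'' => RoundInvariant G X (excluded n m) (fun u v => u < k ∨ (u = k ∧ v < l))
        (excluded n m'')) ?_ ?_
    · rw [henv.size] at hinner
      obtain ⟨h1, h2, h3⟩ := hinner
      refine ⟨h1, h2, fun hb u v c hu huv => h3 hb u v c ?_ huv⟩
      have := hn _ _ huv.symm
      omega
    · rw [excluded_set_ne (by decide)]
      simpa using hI
    · intro l hl m'' hl' hfr' hI'
      rw [excluded_set_ne (by decide)]
      have h31 : m'' 31 0 0 = k := by rw [hfr' 31 (by decide), hk']
      refine hI'.propagateEdge hn (henv.congr fun a ha => hfr' a (by revert a; decide)) ?_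
      rw [h31, hl']
      intro u v huv
      omega

theorem finite_excluded (n : ℕ) (m : Memory) : {p : ℕ × ℕ | excluded n m p.1 p.2}.Finite :=
  ((Finset.range n) ×ˢ (Finset.range 4)).finite_toSet.subset fun p hp => by
    simpa using ⟨hp.1, hp.2.1⟩

theorem ncard_excluded_le (n : ℕ) (m : Memory) :
    {p : ℕ × ℕ | excluded n m p.1 p.2}.ncard ≤ 4 * n := by
  have := Set.ncard_le_ncard (s := {p : ℕ × ℕ | excluded n m p.1 p.2})
    (t := (((Finset.range n) ×ˢ (Finset.range 4) : Finset (ℕ × ℕ)) : Set (ℕ × ℕ)))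
    (fun p hp => by simpa using ⟨hp.1, hp.2.1⟩) (Finset.finite_toSet _)
  rw [Set.ncard_coe_finset, Finset.card_product, Finset.card_range, Finset.card_range] at this
  omega

/-- Propagation computes the least closed table above the given one: every round that does not
reach a closed table excludes something new, so `4 * n + 1` rounds suffice. -/
theorem propagate_spec (hn : ∀ u v, G.Adj u v → u < n) (h : Env n G X m) :
    excluded n m ≤ excluded n (propagate.exec m) ∧
      PropClosed G X (excluded n (propagate.exec m)) ∧
      ∀ W, PropClosed G X W → excluded n m ≤ W → excluded n (propagate.exec m) ≤ W := by
  have hloop := exec_rep_induction (i := 30) (b := 13) (P := propagateRound) (m := m)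
    (fun k m' => excluded n m ≤ excluded n m' ∧
      (∀ W, PropClosed G X W → excluded n m ≤ W → excluded n m' ≤ W) ∧
      (PropClosed G X (excluded n m') ∨ k ≤ {p : ℕ × ℕ | excluded n m' p.1 p.2}.ncard)) ?_ ?_
  · rw [h.rounds] at hloop
    obtain ⟨h1, h2, h3⟩ := hloop
    refine ⟨h1, h3.resolve_right fun h4 => ?_, h2⟩
    have := h4.trans (ncard_excluded_le n _)
    omega
  · rw [excluded_set_ne (by decide)]
    exact ⟨le_rfl, fun W _ hW => hW, Or.inr (Nat.zero_le _)⟩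
  · intro k hk m' hk' hfr ⟨h1, h2, h3⟩
    have henv : Env n G X m' := h.congr fun a ha => hfr a (by revert a; decide)
    rw [excluded_set_ne (by decide)]
    obtain ⟨h4, h5, h6⟩ := roundInvariant_propagateRound hn henv
    refine ⟨h1.trans h4, fun W hW hZW => h5 W hW (h2 W hW hZW), ?_⟩
    by_cases hback : excluded n (propagateRound.exec m') ≤ excluded n m'
    · left
      rw [le_antisymm hback h4]
      exact fun u v c huv henf => h6 hback u v c trivial huv henf
    · right
      rcases h3 with h3 | h3
      · exact absurd (h5 _ h3 le_rfl) hback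
      · refine Nat.lt_of_le_of_lt h3 (Set.ncard_lt_ncard ⟨fun p hp => h4 _ _ hp, fun hb => ?_⟩
          (finite_excluded n _))
        exact hback fun u c hu => @hb (u, c) hu

end Propagate

/-! ### Programs that extend a labelling over one component -/

namespace Code

/-- Exclude all labels except `c` at the vertex in register `i`. -/
def fixLabel (i : ℕ) (c : Expr) : Code :=
  seq (write 10 (.reg i) (.const 0) (.add (exclE i 0) (.ne c (.const 0))))
  (seq (write 10 (.reg i) (.const 1) (.add (exclE i 1) (.ne c (.const 1))))
  (write 10 (.reg i) (.const 2) (.add (exclE i 2) (.ne c (.const 2)))))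

/-- Exclude at the vertices of `X` all labels except those given by array `6`. -/
def initTable : Code :=
  rep 31 0 (seq (write 10 (.reg 31) (.const 0) (.const 0))
    (seq (write 10 (.reg 31) (.const 1) (.const 0))
    (seq (write 10 (.reg 31) (.const 2) (.const 0))
    (seq (write 10 (.reg 31) (.const 3) (.const 0))
    (cond (.read 5 (.reg 31) (.const 0)) (fixLabel 31 (.read 6 (.reg 31) (.const 0))) skip)))))

/-- The table that the guessed labels prescribe: array `6` on `X`, label `1` for the vertex in
register `20`, label `2` for the vertex in register `21`. Column `3` is started at the vertex in
register `22`. -/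
def startTable : Code :=
  seq initTable (seq (write 10 (.reg 22) (.const 3) (.const 1))
    (seq (fixLabel 20 (.const 1)) (fixLabel 21 (.const 2))))

/-- Additional restrictions on the component in column `3`. If register `26` is zero, then the
vertices in the registers `23`, `24`, `25` get the labels `1`, `0`, `2`. Otherwise register `26`
holds a label that is excluded on the whole component. -/
def restrict : Code :=
  cond (.reg 26)
    (rep 31 0 (cond (exclE 31 3) (write 10 (.reg 31) (.reg 26) (.const 1)) skip))
    (seq (fixLabel 23 (.const 1)) (seq (fixLabel 24 (.const 0)) (fixLabel 25 (.const 2))))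

/-- Copy the table in array `a` to array `b`. -/
def copyTable (a b : ℕ) : Code :=
  rep 31 0 (seq (write b (.reg 31) (.const 0) (.read a (.reg 31) (.const 0)))
    (seq (write b (.reg 31) (.const 1) (.read a (.reg 31) (.const 1)))
    (seq (write b (.reg 31) (.const 2) (.read a (.reg 31) (.const 2)))
    (write b (.reg 31) (.const 3) (.read a (.reg 31) (.const 3))))))

/-- Set register `35` if all three labels are excluded at some vertex, and clear it otherwise. -/
def testEmpty : Code :=
  seq (write 35 (.const 0) (.const 0) (.const 0))
    (rep 31 0 (cond (.and (exclE 31 0) (.and (exclE 31 1) (exclE 31 2)))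
      (write 35 (.const 0) (.const 0) (.const 1)) skip))

/-- Try the label in register `34` for the vertex in register `33`, if that vertex belongs to the
component: keep the consequences unless they leave some vertex without a label. -/
def tryLabel : Code :=
  cond (exclE 33 3)
    (seq (copyTable 10 11) (seq (fixLabel 33 (.reg 34)) (seq propagate (seq testEmpty
      (cond (.reg 35) (copyTable 11 10) skip))))) skip

/-- Try all labels for all vertices of the component. -/
def greedy : Code := rep 33 0 (rep 34 14 tryLabel)

/-- The test that exactly one label is left at the vertex in register `31`. -/
def singleE : Expr :=
  .add (.and (.not (exclE 31 0)) (.and (exclE 31 1) (exclE 31 2)))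
    (.add (.and (.not (exclE 31 1)) (.and (exclE 31 0) (exclE 31 2)))
      (.and (.not (exclE 31 2)) (.and (exclE 31 0) (exclE 31 1))))

/-- Set register `35` if some vertex of the component does not have exactly one label left. -/
def testSingle : Code :=
  seq (write 35 (.const 0) (.const 0) (.const 0))
    (rep 31 0 (cond (.and (exclE 31 3) (.not singleE))
      (write 35 (.const 0) (.const 0) (.const 1)) skip))

/-- Store the remaining labels on the component in array `12`, if they are unique. -/
def record : Code :=
  seq testSingle (cond (.reg 35) skip
    (rep 31 0 (cond (exclE 31 3)
      (cond (exclE 31 0)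
        (cond (exclE 31 1) (write 12 (.reg 31) (.const 0) (.const 2))
          (write 12 (.reg 31) (.const 0) (.const 1)))
        (write 12 (.reg 31) (.const 0) (.const 0))) skip)))

/-- An attempt to extend the guessed labels over the component of the vertex in register `22`. -/
def attempt : Code :=
  seq startTable (seq propagate (seq restrict (seq propagate (seq greedy record))))

end Code

section Tables

open Code

variable {n : ℕ} {G : SimpleGraph ℕ} {X : ℕ → Prop} {m : Memory}

theorem excluded_fixLabel {i : ℕ} {c : Expr} (hi : m i 0 0 < n) (hi10 : i ≠ 10)
    (hc : ∀ (m : Memory) x y v, c.val (m.set 10 x y v) = c.val m) (u d : ℕ) :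
    excluded n ((fixLabel i c).exec m) u d ↔
      excluded n m u d ∨ (u = m i 0 0 ∧ d < 3 ∧ d ≠ c.val m) := by
  simp only [fixLabel, exec.eq_3]
  rw [excluded_exclude (by simpa [exec, Memory.set_ne hi10] using hi) (by decide),
    excluded_exclude (by simpa [exec, Memory.set_ne hi10] using hi) (by decide),
    excluded_exclude hi (by decide)]
  simp only [exec, Memory.set_ne hi10, hc, ne_eq, Expr.val_ne_eq_zero, Expr.val_const]
  constructor
  · rintro (((h | ⟨rfl, rfl, h⟩) | ⟨rfl, rfl, h⟩) | ⟨rfl, rfl, h⟩)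
    · exact Or.inl h
    all_goals exact Or.inr ⟨rfl, by omega, fun h' => h h'.symm⟩
  · rintro (h | ⟨rfl, hd, h⟩)
    · exact Or.inl (Or.inl (Or.inl h))
    · rcases (show d = 0 ∨ d = 1 ∨ d = 2 by omega) with rfl | rfl | rfl
      · exact Or.inl (Or.inl (Or.inr ⟨rfl, rfl, fun h' => h h'.symm⟩))
      · exact Or.inl (Or.inr ⟨rfl, rfl, fun h' => h h'.symm⟩)
      · exact Or.inr ⟨rfl, rfl, fun h' => h h'.symm⟩

theorem excluded_initTable (h : Env n G X m) (u c : ℕ) :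
    excluded n (initTable.exec m) u c ↔ u < n ∧ X u ∧ c < 3 ∧ c ≠ m 6 u 0 := by
  classical
  have hloop := exec_rep_induction (i := 31) (b := 0) (m := m)
    (P := seq (write 10 (.reg 31) (.const 0) (.const 0))
    (seq (write 10 (.reg 31) (.const 1) (.const 0))
    (seq (write 10 (.reg 31) (.const 2) (.const 0))
    (seq (write 10 (.reg 31) (.const 3) (.const 0))
    (cond (.read 5 (.reg 31) (.const 0)) (fixLabel 31 (.read 6 (.reg 31) (.const 0))) skip)))))
    (fun k m' => ∀ u < k, ∀ c, excluded n m' u c ↔ u < n ∧ X u ∧ c < 3 ∧ c ≠ m 6 u 0) ?_ ?_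
  · rw [h.size] at hloop
    by_cases hu : u < n
    · exact hloop u hu c
    · exact iff_of_false (fun h => hu h.1) (fun h => hu h.1)
  · intro u hu
    omega
  · intro k hk m' hk' hfr hI u hu c
    rw [h.size] at hk
    rw [excluded_set_ne (by decide)]
    have h5 : m' 5 = m 5 := hfr 5 (by decide)
    have h6 : m' 6 = m 6 := hfr 6 (by decide)
    have hX : m 5 k 0 = 0 ↔ ¬ X k := by rw [← h.mem k, not_not]
    -- The first four steps clear the row `k`.
    obtain ⟨m₁, hm₁⟩ : ∃ m₁, m₁ = (((m'.set 10 k 0 0).set 10 k 1 0).set 10 k 2 0).set 10 k 3 0 :=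
      ⟨_, rfl⟩
    have hrow : ∀ u c, excluded n m₁ u c ↔ u ≠ k ∧ excluded n m' u c := by
      intro u c
      subst hm₁
      by_cases huk : u = k
      · subst huk
        simp only [excluded, Memory.set_same, ne_eq, not_true_eq_false, false_and, iff_false]
        rintro ⟨-, hc, h⟩
        rcases (show c = 0 ∨ c = 1 ∨ c = 2 ∨ c = 3 by omega) with rfl | rfl | rfl | rfl <;>
          simp at h
      · simp [excluded, Memory.set_same, huk]
    have hne : ∀ a, a ≠ 10 → m₁ a = m' a := fun a ha => by
      subst hm₁
      simp [Memory.set_ne, ha]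
    have hexec : ∀ P Q : Code, (seq (write 10 (.reg 31) (.const 0) (.const 0))
        (seq (write 10 (.reg 31) (.const 1) (.const 0))
        (seq (write 10 (.reg 31) (.const 2) (.const 0))
        (seq (write 10 (.reg 31) (.const 3) (.const 0))
        (cond (.read 5 (.reg 31) (.const 0)) P Q))))).exec m' =
          if X k then P.exec m₁ else Q.exec m₁ := by
      intro P Q
      subst hm₁
      by_cases hXk : X k <;> simp [exec, Memory.set_ne, hk', h5, hX, hXk]
    rw [hexec]
    have hold : u ≠ k → (excluded n m' u c ↔ u < n ∧ X u ∧ c < 3 ∧ c ≠ m 6 u 0) :=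
      fun hne => hI u (by omega) c
    have h31 : m₁ 31 0 0 = k := by rw [hne 31 (by decide), hk']
    have h6' : m₁ 6 = m 6 := by rw [hne 6 (by decide), h6]
    split
    · rename_i hXk
      rw [excluded_fixLabel (by rwa [h31]) (by decide)
        (fun m x y v => by simp [Memory.set_ne]), hrow]
      simp only [Expr.val_read, Expr.val_reg, Expr.val_const, h31, h6']
      by_cases huk : u = k
      · subst huk
        simp [hXk, hk]
      · simp [huk, hold huk]
    · rename_i hXk
      rw [exec.eq_1, hrow]
      by_cases huk : u = k
      · subst huk
        simp [hXk]
      · simp [huk, hold huk]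

/-- The table that `startTable` produces. -/
def startExcluded (n : ℕ) (X : ℕ → Prop) (T : ℕ → ℕ) (a b r u c : ℕ) : Prop :=
  u < n ∧ ((X u ∧ c < 3 ∧ c ≠ T u) ∨ (u = a ∧ c < 3 ∧ c ≠ 1) ∨ (u = b ∧ c < 3 ∧ c ≠ 2) ∨
    (u = r ∧ c = 3))

theorem excluded_startTable (h : Env n G X m) {a b r : ℕ} (ha : m 20 0 0 = a) (hb : m 21 0 0 = b)
    (hr : m 22 0 0 = r) (han : a < n) (hbn : b < n) (hrn : r < n) (u c : ℕ) :
    excluded n (startTable.exec m) u c ↔ startExcluded n X (fun u => m 6 u 0) a b r u c := by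
  simp only [startTable, exec.eq_3]
  obtain ⟨m₁, hm₁⟩ : ∃ m₁, m₁ = initTable.exec m := ⟨_, rfl⟩
  have hfr : ∀ a ∈ [20, 21, 22], m₁ a = m a := fun a ha => by
    rw [hm₁]
    exact exec_of_not_mem_writes (by revert a; decide) m
  have hinit := excluded_initTable h u c
  rw [← hm₁] at hinit ⊢
  have h20 : m₁ 20 0 0 = a := by rw [hfr 20 (by decide), ha]
  have h21 : m₁ 21 0 0 = b := by rw [hfr 21 (by decide), hb]
  have h22 : m₁ 22 0 0 = r := by rw [hfr 22 (by decide), hr]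
  rw [excluded_fixLabel (i := 21) (by
      rwa [exec_of_not_mem_writes (by decide), exec_of_not_mem_writes (by decide), h21])
      (by decide) (fun m x y v => rfl),
    excluded_fixLabel (i := 20) (by rwa [exec_of_not_mem_writes (by decide), h20])
      (by decide) (fun m x y v => rfl)]
  rw [exec_of_not_mem_writes (a := 21) (by decide), exec_of_not_mem_writes (a := 21) (by decide),
    exec_of_not_mem_writes (a := 20) (by decide), h20, h21]
  have h10 : excluded n ((write 10 (.reg 22) (.const 3) (.const 1)).exec m₁) u c ↔
      excluded n m₁ u c ∨ (u = r ∧ c = 3) := by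
    by_cases huc : u = r ∧ c = 3
    · simp [excluded, exec, Memory.set_same, h22, huc, hrn]
    · simp [excluded, exec, Memory.set_same, h22, huc]
  rw [h10, hinit]
  simp only [startExcluded, Expr.val_const]
  constructor
  · rintro (((⟨h1, h2⟩ | h2) | h2) | h2)
    · exact ⟨h1, Or.inl h2⟩
    · exact ⟨h2.1 ▸ hrn, Or.inr (Or.inr (Or.inr h2))⟩
    · exact ⟨h2.1 ▸ han, Or.inr (Or.inl h2)⟩
    · exact ⟨h2.1 ▸ hbn, Or.inr (Or.inr (Or.inl h2))⟩
  · rintro ⟨h1, h2 | h2 | h2 | h2⟩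
    · exact Or.inl (Or.inl (Or.inl ⟨h1, h2⟩))
    · exact Or.inl (Or.inr h2)
    · exact Or.inr h2
    · exact Or.inl (Or.inl (Or.inr h2))

theorem copyTable_spec {a b : ℕ} (hab : a ≠ b) (ha : a ≠ 31) (hb : b ≠ 31) (h0 : m 0 0 0 = n)
    {u c : ℕ} (hu : u < n) (hc : c < 4) : (copyTable a b).exec m b u c = m a u c := by
  have hloop := exec_rep_induction (i := 31) (b := 0) (m := m)
    (P := seq (write b (.reg 31) (.const 0) (.read a (.reg 31) (.const 0)))
    (seq (write b (.reg 31) (.const 1) (.read a (.reg 31) (.const 1)))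
    (seq (write b (.reg 31) (.const 2) (.read a (.reg 31) (.const 2)))
    (write b (.reg 31) (.const 3) (.read a (.reg 31) (.const 3))))))
    (fun k m' => ∀ u < k, ∀ c < 4, m' b u c = m a u c) ?_ ?_
  · rw [h0] at hloop
    exact hloop u hu c hc
  · intro u hu
    omega
  · intro k hk m' hk' hfr hI u hu c hc
    have hfa : m' a = m a := hfr a (by simp [writes, hab, ha])
    rw [Memory.set_ne hb]
    by_cases huk : u = k
    · subst huk
      rcases (show c = 0 ∨ c = 1 ∨ c = 2 ∨ c = 3 by omega) with rfl | rfl | rfl | rfl <;>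
        simp [exec, Memory.set_same, Memory.set_ne, hab, hb.symm, hk', hfa]
    · have := hI u (by omega) c hc
      simpa [exec, Memory.set_same, Memory.set_ne, hb.symm, hk', huk] using this

end Tables

/-! ### Tests, restrictions and the record of labels -/

section Checks

open Code

variable {n : ℕ} {G : SimpleGraph ℕ} {X : ℕ → Prop} {m : Memory}

/-- A loop that sets register `35` as soon as a test succeeds decides whether it ever succeeds. -/
theorem exec_flag {i : ℕ} {e : Expr} {p : ℕ → Prop} (hi : i ≠ 35)
    (hp : ∀ k < m 0 0 0, ∀ m' : Memory, m' i 0 0 = k → (∀ a, a ≠ i → a ≠ 35 → m' a = m a) →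
      (e.val m' ≠ 0 ↔ p k)) :
    (rep i 0 (cond e (write 35 (.const 0) (.const 0) (.const 1)) skip)).exec m 35 0 0 ≠ 0 ↔
      m 35 0 0 ≠ 0 ∨ ∃ k < m 0 0 0, p k := by
  refine exec_rep_induction (i := i) (b := 0) (m := m)
    (fun k m' => m' 35 0 0 ≠ 0 ↔ m 35 0 0 ≠ 0 ∨ ∃ j < k, p j) ?_ ?_
  · simp [Memory.set_ne hi.symm]
  · intro k hk m' hk' hfr hI
    have he := hp k hk m' hk' fun a h1 h2 => hfr a (by simp [writes, h1, h2])
    have hsucc : (∃ j < k + 1, p j) ↔ (∃ j < k, p j) ∨ p k := by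
      simp only [Nat.lt_succ_iff_lt_or_eq, or_and_right, exists_or, exists_eq_left]
    rw [Memory.set_ne hi.symm, hsucc, ← or_assoc, ← hI, ← he]
    by_cases h0 : e.val m' = 0 <;> simp [exec, h0, Memory.set_same]

theorem testEmpty_spec (h : Env n G X m) :
    (testEmpty.exec m) 35 0 0 ≠ 0 ↔
      ∃ u < n, excluded n m u 0 ∧ excluded n m u 1 ∧ excluded n m u 2 := by
  simp only [testEmpty, exec.eq_3]
  rw [exec_flag (i := 31)
    (p := fun u => excluded n m u 0 ∧ excluded n m u 1 ∧ excluded n m u 2) (by decide)]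
  · simp [exec, Memory.set_same, Memory.set_ne, h.size]
  · intro k hk m' hk' hfr
    have h10 : m' 10 = m 10 := by rw [hfr 10 (by decide) (by decide)]; rfl
    have hkn : k < n := by simpa [exec, Memory.set_ne, h.size] using hk
    simp [excluded, hk', h10, hkn]

theorem testSingle_spec (h : Env n G X m) :
    (testSingle.exec m) 35 0 0 = 0 ↔ ∀ u, excluded n m u 3 →
      ∃ c < 3, Forces (excluded n m) u c ∧ ¬ excluded n m u c := by
  rw [← not_iff_not, ← ne_eq]
  simp only [testSingle, exec.eq_3]
  rw [exec_flag (i := 31) (p := fun u => excluded n m u 3 ∧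
    ¬ ∃ c < 3, Forces (excluded n m) u c ∧ ¬ excluded n m u c) (by decide)]
  · have h0 : (write 35 (.const 0) (.const 0) (.const 0)).exec m 0 0 0 = n := by
      simp [exec, Memory.set_ne, h.size]
    have h35 : (write 35 (.const 0) (.const 0) (.const 0)).exec m 35 0 0 = 0 := by
      simp [exec, Memory.set_same]
    rw [h0, h35]
    constructor
    · rintro (h1 | ⟨k, -, h1, h2⟩) h3
      · exact h1 rfl
      · exact h2 (h3 k h1)
    · intro h1
      obtain ⟨u, hu⟩ := not_forall.1 h1
      obtain ⟨hu3, hno⟩ := Classical.not_imp.1 hu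
      exact Or.inr ⟨u, hu3.1, hu3, hno⟩
  · intro k hk m' hk' hfr
    have h10 : m' 10 = m 10 := by rw [hfr 10 (by decide) (by decide)]; rfl
    have hkn : k < n := by simpa [exec, Memory.set_ne, h.size] using hk
    have hs : singleE.val m' ≠ 0 ↔ ∃ c < 3, Forces (excluded n m) k c ∧ ¬ excluded n m k c := by
      have hE : ∀ c < 4, excluded n m k c ↔ m 10 k c ≠ 0 := fun c hc => by simp [excluded, hkn, hc]
      have hF : ∀ c, Forces (excluded n m) k c ↔
          (0 ≠ c → m 10 k 0 ≠ 0) ∧ (1 ≠ c → m 10 k 1 ≠ 0) ∧ (2 ≠ c → m 10 k 2 ≠ 0) := by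
        intro c
        rw [← hE 0 (by decide), ← hE 1 (by decide), ← hE 2 (by decide)]
        refine ⟨fun h => ⟨h 0 (by decide), h 1 (by decide), h 2 (by decide)⟩, ?_⟩
        rintro ⟨h0, h1, h2⟩ d hd hdc
        interval_cases d <;> tauto
      have hex : (∃ c < 3, Forces (excluded n m) k c ∧ ¬ excluded n m k c) ↔
          (Forces (excluded n m) k 0 ∧ ¬ excluded n m k 0) ∨
          (Forces (excluded n m) k 1 ∧ ¬ excluded n m k 1) ∨
          (Forces (excluded n m) k 2 ∧ ¬ excluded n m k 2) := by
        constructor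
        · rintro ⟨c, hc, h⟩
          interval_cases c <;> tauto
        · rintro (h | h | h)
          exacts [⟨0, by decide, h⟩, ⟨1, by decide, h⟩, ⟨2, by decide, h⟩]
      rw [hex, hF, hF, hF, hE 0 (by decide), hE 1 (by decide), hE 2 (by decide)]
      simp [singleE, hk', h10]
      tauto
    rw [← hs]
    simp [excluded, hk', h10, hkn]

theorem excluded_restrict_triple {x y z : ℕ} (hm : m 26 0 0 = 0) (hx : m 23 0 0 = x)
    (hy : m 24 0 0 = y) (hz : m 25 0 0 = z) (hxn : x < n) (hyn : y < n) (hzn : z < n) (u c : ℕ) :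
    excluded n (restrict.exec m) u c ↔ excluded n m u c ∨ (u = x ∧ c < 3 ∧ c ≠ 1) ∨
      (u = y ∧ c < 3 ∧ c ≠ 0) ∨ (u = z ∧ c < 3 ∧ c ≠ 2) := by
  have hex : restrict.exec m = (fixLabel 25 (.const 2)).exec ((fixLabel 24 (.const 0)).exec
      ((fixLabel 23 (.const 1)).exec m)) := by
    rw [restrict, exec.eq_4, if_pos (by simpa using hm)]
    rfl
  have hw : ∀ i c, 10 ∉ [i] → ∀ m, (fixLabel i (.const c)).exec m i = m i := fun i c hi m =>
    exec_of_not_mem_writes (by simpa [fixLabel, writes, eq_comm] using hi) m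
  have hw' : ∀ i j c, j ≠ 10 → ∀ m, (fixLabel i (.const c)).exec m j = m j := fun i j c hj m =>
    exec_of_not_mem_writes (by simp [fixLabel, writes, hj]) m
  rw [hex, excluded_fixLabel (i := 25) (by simpa [hw', hz] using hzn) (by decide)
      (fun m x y v => rfl),
    excluded_fixLabel (i := 24) (by simpa [hw', hy] using hyn) (by decide) (fun m x y v => rfl),
    excluded_fixLabel (i := 23) (by simpa [hx] using hxn) (by decide) (fun m x y v => rfl)]
  simp only [hw' _ 25 _ (by decide), hw' _ 24 _ (by decide), hx, hy, hz, Expr.val_const, or_assoc]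

theorem excluded_restrict_label {d : ℕ} (h : Env n G X m) (hm : m 26 0 0 = d) (hd0 : 0 < d)
    (hd : d < 3) (u c : ℕ) :
    excluded n (restrict.exec m) u c ↔ excluded n m u c ∨ (excluded n m u 3 ∧ c = d) := by
  have hex : restrict.exec m =
      (rep 31 0 (cond (exclE 31 3) (write 10 (.reg 31) (.reg 26) (.const 1)) skip)).exec m := by
    rw [restrict, exec.eq_4, if_neg (by simp; omega)]
  rw [hex]
  have hloop := exec_rep_induction (i := 31) (b := 0) (m := m)
    (P := cond (exclE 31 3) (write 10 (.reg 31) (.reg 26) (.const 1)) skip)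
    (fun k m' => ∀ u c, excluded n m' u c ↔ excluded n m u c ∨ (excluded n m u 3 ∧ c = d ∧ u < k))
    ?_ ?_
  · rw [h.size] at hloop
    rw [hloop]
    have : excluded n m u 3 → u < n := fun h => h.1
    tauto
  · intro u c
    rw [excluded_set_ne (by decide)]
    simp
  · intro k hk m' hk' hfr hI u c
    rw [h.size] at hk
    rw [excluded_set_ne (by decide)]
    have h26 : m' 26 0 0 = d := by rw [hfr 26 (by decide), hm]
    have h3 : m' 10 k 3 = 0 ↔ ¬ excluded n m k 3 := by
      have := hI k 3
      simp only [show ¬ (3 = d) by omega, false_and, and_false, or_false] at this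
      rw [← this]
      simp [excluded, hk]
    by_cases hk3 : excluded n m k 3
    · have : (cond (exclE 31 3) (write 10 (.reg 31) (.reg 26) (.const 1)) skip).exec m' =
          m'.set 10 k d 1 := by
        simp [exec, hk', h3, hk3, h26]
      rw [this]
      by_cases huc : u = k ∧ c = d
      · obtain ⟨rfl, rfl⟩ := huc
        simp only [excluded, Memory.set_same, hk]
        simp [excluded] at hk3
        simp [hk3]
        omega
      · have h1 : excluded n (m'.set 10 k d 1) u c ↔ excluded n m' u c := by
          simp [excluded, Memory.set_same, huc]
        rw [h1, hI]
        have : c = d → (u < k + 1 ↔ u < k) := by omega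
        exact or_congr_right (and_congr_right fun _ => and_congr_right fun hc => (this hc).symm)
    · have : (cond (exclE 31 3) (write 10 (.reg 31) (.reg 26) (.const 1)) skip).exec m' = m' := by
        simp [exec, hk', h3, hk3]
      rw [this, hI]
      constructor
      · rintro (h | ⟨h, rfl, h'⟩)
        · exact Or.inl h
        · exact Or.inr ⟨h, rfl, by omega⟩
      · rintro (h | ⟨h, rfl, h'⟩)
        · exact Or.inl h
        · refine Or.inr ⟨h, rfl, ?_⟩
          have : u ≠ k := by rintro rfl; exact hk3 h
          omega

/-- The labels stored by `record`: nothing changes outside the component, and if every vertex of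
the component has exactly one label left, then this label is stored. -/
theorem record_spec (h : Env n G X m) :
    (∀ u, ¬ excluded n m u 3 → record.exec m 12 u 0 = m 12 u 0) ∧
    (record.exec m 12 = m 12 ∨ ∀ u, excluded n m u 3 → record.exec m 12 u 0 < 3 ∧
      Forces (excluded n m) u (record.exec m 12 u 0) ∧
      ¬ excluded n m u (record.exec m 12 u 0)) ∧
    ((∀ u, excluded n m u 3 → ∃ c < 3, Forces (excluded n m) u c ∧ ¬ excluded n m u c) →
      ∀ u, excluded n m u 3 → record.exec m 12 u 0 < 3 ∧
      Forces (excluded n m) u (record.exec m 12 u 0) ∧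
      ¬ excluded n m u (record.exec m 12 u 0)) := by
  have hts := testSingle_spec h
  obtain ⟨m₁, hm₁⟩ : ∃ m₁, m₁ = testSingle.exec m := ⟨_, rfl⟩
  have hfr : ∀ a, a ≠ 31 → a ≠ 35 → m₁ a = m a := fun a h1 h2 => by
    rw [hm₁]
    exact exec_of_not_mem_writes (by simp [testSingle, writes, h1, h2]) m
  rw [← hm₁] at hts
  have h12 : m₁ 12 = m 12 := hfr 12 (by decide) (by decide)
  by_cases h35 : m₁ 35 0 0 = 0
  · have hsingle := hts.1 h35
    have hex : record.exec m = (rep 31 0 (cond (exclE 31 3)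
        (cond (exclE 31 0)
        (cond (exclE 31 1) (write 12 (.reg 31) (.const 0) (.const 2))
          (write 12 (.reg 31) (.const 0) (.const 1)))
        (write 12 (.reg 31) (.const 0) (.const 0))) skip)).exec m₁ := by
      rw [record, exec.eq_3, ← hm₁, exec.eq_4, if_pos (by simpa using h35)]
    rw [hex]
    have hloop := exec_rep_induction (i := 31) (b := 0) (m := m₁) (P := cond (exclE 31 3)
        (cond (exclE 31 0)
        (cond (exclE 31 1) (write 12 (.reg 31) (.const 0) (.const 2))
          (write 12 (.reg 31) (.const 0) (.const 1)))
        (write 12 (.reg 31) (.const 0) (.const 0))) skip)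
      (fun k m' => (∀ u, ¬ excluded n m u 3 → m' 12 u 0 = m 12 u 0) ∧
        ∀ u < k, excluded n m u 3 → m' 12 u 0 < 3 ∧ Forces (excluded n m) u (m' 12 u 0) ∧
          ¬ excluded n m u (m' 12 u 0)) ?_ ?_
    · have h0 : m₁ 0 0 0 = n := by rw [hfr 0 (by decide) (by decide), h.size]
      rw [h0] at hloop
      exact ⟨hloop.1, Or.inr fun u hu => hloop.2 u hu.1 hu, fun _ u hu => hloop.2 u hu.1 hu⟩
    · exact ⟨fun u _ => by rw [Memory.set_ne (by decide), h12], fun u hu => by omega⟩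
    · intro k hk m' hk' hfr' ⟨hI, hI'⟩
      have h0 : m₁ 0 0 0 = n := by rw [hfr 0 (by decide) (by decide), h.size]
      rw [h0] at hk
      rw [Memory.set_ne (by decide)]
      have h10 : m' 10 = m 10 := by rw [hfr' 10 (by decide), hfr 10 (by decide) (by decide)]
      have hE : ∀ c < 4, excluded n m k c ↔ m 10 k c ≠ 0 := fun c hc => by simp [excluded, hk, hc]
      have hE3 := hE 3 (by decide)
      by_cases h3 : m 10 k 3 = 0
      · have : (cond (exclE 31 3)
          (cond (exclE 31 0)
          (cond (exclE 31 1) (write 12 (.reg 31) (.const 0) (.const 2))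
            (write 12 (.reg 31) (.const 0) (.const 1)))
          (write 12 (.reg 31) (.const 0) (.const 0))) skip).exec m' = m' := by
          simp [exec, hk', h10, h3]
        rw [this]
        refine ⟨hI, fun u hu hu3 => hI' u ?_ hu3⟩
        have : u ≠ k := by rintro rfl; exact (hE3.1 hu3) h3
        omega
      · obtain ⟨c, hc, hF, hcn⟩ := hsingle k (hE3.2 h3)
        have : (cond (exclE 31 3)
          (cond (exclE 31 0)
          (cond (exclE 31 1) (write 12 (.reg 31) (.const 0) (.const 2))
            (write 12 (.reg 31) (.const 0) (.const 1)))
          (write 12 (.reg 31) (.const 0) (.const 0))) skip).exec m' = m'.set 12 k 0 c := by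
          have hF0 := hF 0 (by decide)
          have hF1 := hF 1 (by decide)
          rw [hE _ (by decide)] at hF0 hF1
          rw [hE _ (by omega), not_not] at hcn
          simp only [exec, val_exclE, hk', h10, h3, if_false]
          rcases (show c = 0 ∨ c = 1 ∨ c = 2 by omega) with rfl | rfl | rfl
          · simp [hcn, hk']
          · simp [hcn, hk', hF0]
          · simp [hk', hF0, hF1]
        rw [this]
        refine ⟨fun u hu => ?_, fun u hu hu3 => ?_⟩
        · have : u ≠ k := by rintro rfl; exact hu (hE3.2 h3)
          simpa [Memory.set_same, this] using hI u hu
        · by_cases huk : u = k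
          · subst huk
            simpa [Memory.set_same] using ⟨hc, hF, hcn⟩
          · simpa [Memory.set_same, huk] using hI' u (by omega) hu3
  · have hex : record.exec m 12 = m 12 := by
      rw [record, exec.eq_3, ← hm₁, exec.eq_4, if_neg (by simpa using h35)]
      exact h12
    exact ⟨fun u _ => by rw [hex], Or.inl hex, fun hs => absurd (hts.2 hs) h35⟩

end Checks

/-! ### Greedy choice among two labels -/

section Greedy

open Code

/-- The table `Z` is closed, contains the guessed labels, and its column `3` is the component
of `r`. -/
structure IsExtension (n : ℕ) (G : SimpleGraph ℕ) (X : ℕ → Prop) (T : ℕ → ℕ) (a b r : ℕ)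
    (Z : ℕ → ℕ → Prop) : Prop where
  closed : PropClosed G X Z
  start_le : startExcluded n X T a b r ≤ Z
  reachable : ∀ u, Z u 3 → (core G X).Reachable r u

/-- The labelling `f` of `G` respects the exclusions in `Z`. -/
def Respects (G : SimpleGraph ℕ) (Z : ℕ → ℕ → Prop) (f : ℕ → ℕ) : Prop :=
  IsLabelling G f ∧ ∀ u, ¬ Z u (f u)

/-- The label of `u` agrees with the guessed labels, which are those of `T` on `X` and the labels
`1` and `2` of `a` and `b`, and it is compatible with the labels of the neighbours of `u` in `X`
and in the component of `u`. -/
structure LabelOK (G : SimpleGraph ℕ) (X : ℕ → Prop) (T : ℕ → ℕ) (a b : ℕ) (l : ℕ → ℕ) (u : ℕ) :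
    Prop where
  lt_three : l u < 3
  eq_of_mem : X u → l u = T u
  eq_one : u = a → l u = 1
  eq_two : u = b → l u = 2
  boundary : ∀ v, G.Adj u v → X v → (l u + T v) % 3 ≠ 0
  adj : ∀ v, (core G X).Adj u v → (l u + l v) % 3 ≠ 0

variable {n : ℕ} {G : SimpleGraph ℕ} {X : ℕ → Prop} {m : Memory} {T : ℕ → ℕ} {a b r : ℕ}
  {Z : ℕ → ℕ → Prop} {f : ℕ → ℕ}

theorem Respects.anti {Z' : ℕ → ℕ → Prop} (h : Respects G Z' f) (hZ : Z ≤ Z') : Respects G Z f :=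
  ⟨h.1, fun u hu => h.2 u (hZ _ _ hu)⟩

theorem IsExtension.col_three (h : IsExtension n G X T a b r Z) (hr : r < n) (u : ℕ) :
    Z u 3 ↔ (core G X).Reachable r u :=
  ⟨h.reachable u, h.closed.reachable
    (h.start_le _ _ ⟨hr, Or.inr (Or.inr (Or.inr ⟨rfl, rfl⟩))⟩)⟩

theorem IsExtension.forces_of_mem (h : IsExtension n G X T a b r Z) {u : ℕ} (hu : u < n)
    (hX : X u) : Forces Z u (T u) :=
  fun _ hc hcT => h.start_le _ _ ⟨hu, Or.inl ⟨hX, hc, hcT⟩⟩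

theorem propagate_isExtension (hn : ∀ u v, G.Adj u v → u < n) (h : Env n G X m)
    (hs : startExcluded n X T a b r ≤ excluded n m)
    (hr : ∀ u, excluded n m u 3 → (core G X).Reachable r u) :
    excluded n m ≤ excluded n (propagate.exec m) ∧
    IsExtension n G X T a b r (excluded n (propagate.exec m)) ∧
    ∀ f, Respects G (excluded n m) f → Respects G (excluded n (propagate.exec m)) f := by
  obtain ⟨h1, h2, h3⟩ := propagate_spec hn h
  refine ⟨h1, ⟨h2, hs.trans h1, fun u hu => ?_⟩, fun f hf => ⟨hf.1, fun u hu => ?_⟩⟩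
  · refine h3 _ (propClosed_component G X r) (fun u _ hu hc => ?_) u 3 hu rfl
    subst hc
    exact hr u hu
  · refine (h3 _ (hf.1.propClosed r) (fun u c hu => ⟨fun _ hc => ?_, fun hc => ?_⟩) u _ hu).1
      (hf.1.lt_three u) rfl
    · subst hc
      exact hf.2 u hu
    · subst hc
      exact hr u hu

theorem tryLabel_spec (hn : ∀ u v, G.Adj u v → u < n) (h : Env n G X m) {v c : ℕ} (hvn : v < n)
    (hv : m 33 0 0 = v) (hc : m 34 0 0 = c) (hc3 : c < 3)
    (hE : IsExtension n G X T a b r (excluded n m)) :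
    IsExtension n G X T a b r (excluded n (tryLabel.exec m)) ∧
    excluded n m ≤ excluded n (tryLabel.exec m) ∧
    ((∀ u, excluded n m u 3 → ∃ c < 3, excluded n m u c) → excluded n m v 3 →
      (∃ f, Respects G (excluded n m) f) → (∃ f, Respects G (excluded n (tryLabel.exec m)) f) ∧
      ((∃ c < 3, Forces (excluded n (tryLabel.exec m)) v c) ∨
        ∀ f, Respects G (excluded n (tryLabel.exec m)) f → f v ≠ c)) := by
  by_cases h3 : m 10 v 3 = 0
  · have hex : tryLabel.exec m = m := by simp [tryLabel, exec, hv, h3]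
    rw [hex]
    exact ⟨hE, le_rfl, fun _ hv3 => absurd h3 hv3.2.2⟩
  have hv3 : excluded n m v 3 := ⟨hvn, by decide, h3⟩
  -- `m₁`, `m₂`, `m₃`, `m₄` are the memories after the copy, the choice of the label, propagation
  -- and the test.
  obtain ⟨m₁, hm₁⟩ : ∃ m₁, m₁ = (copyTable 10 11).exec m := ⟨_, rfl⟩
  obtain ⟨m₂, hm₂⟩ : ∃ m₂, m₂ = (fixLabel 33 (.reg 34)).exec m₁ := ⟨_, rfl⟩
  obtain ⟨m₃, hm₃⟩ : ∃ m₃, m₃ = propagate.exec m₂ := ⟨_, rfl⟩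
  obtain ⟨m₄, hm₄⟩ : ∃ m₄, m₄ = testEmpty.exec m₃ := ⟨_, rfl⟩
  have hex : tryLabel.exec m = if m₄ 35 0 0 = 0 then m₄ else (copyTable 11 10).exec m₄ := by
    simp only [tryLabel, exec, val_exclE, hv, h3, if_false, ← hm₁, ← hm₂, ← hm₃, ← hm₄,
      Expr.val_reg]
  have hf₁ : ∀ a, a ∉ (copyTable 10 11).writes → m₁ a = m a := fun a ha => by
    rw [hm₁, exec_of_not_mem_writes ha]
  have hf₂ : ∀ a, a ∉ (fixLabel 33 (.reg 34)).writes → m₂ a = m₁ a := fun a ha => by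
    rw [hm₂, exec_of_not_mem_writes ha]
  have hf₃ : ∀ a, a ∉ propagate.writes → m₃ a = m₂ a := fun a ha => by
    rw [hm₃, exec_of_not_mem_writes ha]
  have hf₄ : ∀ a, a ∉ testEmpty.writes → m₄ a = m₃ a := fun a ha => by
    rw [hm₄, exec_of_not_mem_writes ha]
  have henv₁ : Env n G X m₁ := hm₁ ▸ h.exec (by decide)
  have henv₂ : Env n G X m₂ := hm₂ ▸ henv₁.exec (by decide)
  have henv₃ : Env n G X m₃ := hm₃ ▸ henv₂.exec (by decide)
  have henv₄ : Env n G X m₄ := hm₄ ▸ henv₃.exec (by decide)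
  have hZ₁ : excluded n m₁ = excluded n m := excluded_congr (hf₁ 10 (by decide))
  have hZ₂ : ∀ u d, excluded n m₂ u d ↔ excluded n m u d ∨ (u = v ∧ d < 3 ∧ d ≠ c) := by
    intro u d
    have h33 : m₁ 33 0 0 = v := by rw [hf₁ 33 (by decide), hv]
    have h34 : m₁ 34 0 0 = c := by rw [hf₁ 34 (by decide), hc]
    rw [hm₂, excluded_fixLabel (by rwa [h33]) (by decide) (fun m x y v => rfl), hZ₁, h33,
      Expr.val_reg, h34]
  have hle₂ : excluded n m ≤ excluded n m₂ := fun u d hu => (hZ₂ u d).2 (Or.inl hu)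
  obtain ⟨hle₃, hE₃, hresp⟩ := propagate_isExtension hn henv₂ (hE.start_le.trans hle₂)
    (fun u hu => hE.reachable u (((hZ₂ u 3).1 hu).resolve_right (by omega)))
  rw [← hm₃] at hle₃ hE₃ hresp
  have hZ₄ : excluded n m₄ = excluded n m₃ := excluded_congr (hf₄ 10 (by decide))
  have htest := testEmpty_spec henv₃
  rw [← hm₄] at htest
  rw [hex]
  split
  · rename_i h35
    rw [hZ₄]
    have hne : ∀ u, u < n → ∃ d < 3, ¬ excluded n m₃ u d := by
      intro u hu
      by_contra! hno
      exact (htest.2 ⟨u, hu, hno 0 (by decide), hno 1 (by decide), hno 2 (by decide)⟩) h35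
    have hle : excluded n m ≤ excluded n m₃ := hle₂.trans hle₃
    have hforce : Forces (excluded n m₃) v c :=
      fun d hd hdc => hle₃ _ _ ((hZ₂ v d).2 (Or.inr ⟨rfl, hd, hdc⟩))
    refine ⟨hE₃, hle, fun htwo _ ⟨f, hf⟩ => ⟨?_, Or.inl ⟨c, hc3, hforce⟩⟩⟩
    have hX : ∀ u, X u ∧ u < n → Forces (excluded n m) u (f u) := by
      rintro u ⟨hu, hun⟩
      have hF := hE.forces_of_mem hun hu
      have : T u = f u := by
        by_contra hne
        exact hf.2 u (hF _ (hf.1.lt_three u) fun h => hne h.symm)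
      rwa [this] at hF
    have hsep : ∀ u w, excluded n m u 3 → ¬ excluded n m w 3 → G.Adj u w →
        (X u ∧ u < n) ∨ (X w ∧ w < n) := by
      intro u w hu hw huw
      have hwn := hn _ _ huw.symm
      by_cases hXu : X u
      · exact Or.inl ⟨hXu, hu.1⟩
      by_cases hXw : X w
      · exact Or.inr ⟨hXw, hwn⟩
      exact absurd (hE.closed u w 3 huw (Or.inr (Or.inr (Or.inr ⟨rfl, hu, hXu, hXw⟩)))) hw
    obtain ⟨f', hf', hC, hout⟩ := hf.1.exists_relabelling (Z := excluded n m)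
      (Z' := excluded n m₃) (C := fun u => excluded n m u 3) (X := fun u => X u ∧ u < n)
      (fun u _ d _ hu => hle u d hu) hE₃.closed.unitClosed (fun u hu => hne u hu.1)
      (fun u _ => hf.2 u) htwo hX hsep
    refine ⟨f', hresp f' ⟨hf', fun u hu => ?_⟩⟩
    by_cases huC : excluded n m u 3
    · exact hC u huC (hle₃ _ _ hu)
    · rw [hout u huC] at hu
      rcases (hZ₂ _ _).1 hu with hu | ⟨rfl, -⟩
      · exact hf.2 u hu
      · exact huC hv3
  · rename_i h35
    have hback : excluded n ((copyTable 11 10).exec m₄) = excluded n m := by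
      funext u d
      by_cases hud : u < n ∧ d < 4
      · have h11 : m₄ 11 = m₁ 11 := by
          rw [hf₄ 11 (by decide), hf₃ 11 (by decide), hf₂ 11 (by decide)]
        simp only [excluded, copyTable_spec (a := 11) (b := 10) (by decide) (by decide) (by decide)
          henv₄.size hud.1 hud.2, h11, hm₁, copyTable_spec (a := 10) (b := 11) (by decide)
          (by decide) (by decide) h.size hud.1 hud.2]
      · exact propext ⟨fun hu => absurd ⟨hu.1, hu.2.1⟩ hud, fun hu => absurd ⟨hu.1, hu.2.1⟩ hud⟩
    rw [hback]
    refine ⟨hE, le_rfl, fun _ _ hex => ⟨hex, Or.inr fun f hf hfv => ?_⟩⟩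
    obtain ⟨u, hu, h0, h1, h2⟩ := htest.1 h35
    have hf₃ := hresp f ⟨hf.1, fun w hw => by
      rcases (hZ₂ _ _).1 hw with hw | ⟨rfl, -, hne⟩
      · exact hf.2 w hw
      · exact hne hfv⟩
    have hlt := hf.1.lt_three u
    have := hf₃.2 u
    rcases (show f u = 0 ∨ f u = 1 ∨ f u = 2 by omega) with h' | h' | h' <;> rw [h'] at this
    exacts [this h0, this h1, this h2]

/-- After `greedy`, every vertex of the component has a unique label, if initially no vertex of the
component had three labels and some labelling respected the table. -/
theorem greedy_spec (hn : ∀ u v, G.Adj u v → u < n) (h : Env n G X m) (hrn : r < n)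
    (hE : IsExtension n G X T a b r (excluded n m)) :
    IsExtension n G X T a b r (excluded n (greedy.exec m)) ∧
    ((∀ u, excluded n m u 3 → ∃ c < 3, excluded n m u c) → (∃ f, Respects G (excluded n m) f) →
      ∀ u, excluded n (greedy.exec m) u 3 → ∃ c < 3, Forces (excluded n (greedy.exec m)) u c ∧
        ¬ excluded n (greedy.exec m) u c) := by
  have hloop := exec_rep_induction (i := 33) (b := 0) (P := rep 34 14 tryLabel) (m := m)
    (fun k m' => IsExtension n G X T a b r (excluded n m') ∧ excluded n m ≤ excluded n m' ∧
      ((∀ u, excluded n m u 3 → ∃ c < 3, excluded n m u c) → (∃ f, Respects G (excluded n m) f) →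
      (∃ f, Respects G (excluded n m') f) ∧
      ∀ u < k, excluded n m u 3 → ∃ c < 3, Forces (excluded n m') u c)) ?_ ?_
  · rw [h.size] at hloop
    obtain ⟨h1, h2, h3⟩ := hloop
    refine ⟨h1, fun htwo hsol u hu => ?_⟩
    obtain ⟨⟨f, hf⟩, h4⟩ := h3 htwo hsol
    obtain ⟨c, hc, hF⟩ := h4 u hu.1 ((hE.col_three hrn u).2 (h1.reachable u hu))
    refine ⟨c, hc, hF, ?_⟩
    have hfc : f u = c := by
      by_contra hne
      exact hf.2 u (hF _ (hf.1.lt_three u) hne)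
    exact hfc ▸ hf.2 u
  · rw [excluded_set_ne (by decide)]
    exact ⟨hE, le_rfl, fun _ hsol => ⟨hsol, fun u hu => by omega⟩⟩
  · intro k hk m' hk' hfr ⟨hE', hle', hsol'⟩
    rw [h.size] at hk
    rw [excluded_set_ne (by decide)]
    have henv : Env n G X m' := h.congr fun a ha => hfr a (by revert a; decide)
    have hinner := exec_rep_induction (i := 34) (b := 14) (P := tryLabel) (m := m')
      (fun c m'' => IsExtension n G X T a b r (excluded n m'') ∧ excluded n m' ≤ excluded n m'' ∧
        ((∀ u, excluded n m u 3 → ∃ c < 3, excluded n m u c) → excluded n m k 3 →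
        (∃ f, Respects G (excluded n m') f) → (∃ f, Respects G (excluded n m'') f) ∧
        ((∃ d < 3, Forces (excluded n m'') k d) ∨
          ∀ d < c, ∀ f, Respects G (excluded n m'') f → f k ≠ d)) ∧
        (¬ excluded n m k 3 → excluded n m'' = excluded n m')) ?_ ?_
    · rw [henv.three] at hinner
      obtain ⟨h1, h2, h3, h4⟩ := hinner
      refine ⟨h1, hle'.trans h2, fun htwo hsol => ?_⟩
      obtain ⟨hf', hdone⟩ := hsol' htwo hsol
      have hmono : ∀ u < k, excluded n m u 3 →
          ∃ c < 3, Forces (excluded n ((rep 34 14 tryLabel).exec m')) u c := fun u hu hu3 => by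
        obtain ⟨c, hc, hF⟩ := hdone u hu hu3
        exact ⟨c, hc, hF.mono fun d _ hd => h2 _ _ hd⟩
      by_cases hk3 : excluded n m k 3
      · obtain ⟨⟨f, hf⟩, hor⟩ := h3 htwo hk3 hf'
        refine ⟨⟨f, hf⟩, fun u hu hu3 => ?_⟩
        rcases (show u < k ∨ u = k by omega) with hu | rfl
        · exact hmono u hu hu3
        · exact hor.resolve_right fun hno => hno _ (hf.1.lt_three u) f hf rfl
      · rw [h4 hk3]
        refine ⟨hf', fun u hu hu3 => ?_⟩
        have : u ≠ k := by rintro rfl; exact hk3 hu3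
        exact hdone u (by omega) hu3
    · rw [excluded_set_ne (by decide)]
      exact ⟨hE', le_rfl, fun _ _ hf' => ⟨hf', Or.inr fun d hd => by omega⟩, fun _ => rfl⟩
    · intro c hc m'' hc' hfr' ⟨h1, h2, h3, h4⟩
      rw [henv.three] at hc
      rw [excluded_set_ne (by decide)]
      have henv' : Env n G X m'' := henv.congr fun a ha => hfr' a (by revert a; decide)
      have h33 : m'' 33 0 0 = k := by rw [hfr' 33 (by decide), hk']
      obtain ⟨h5, h6, h7⟩ := tryLabel_spec hn henv' hk h33 hc' hc h1
      have hcol : ∀ u, excluded n m'' u 3 ↔ excluded n m u 3 := fun u => by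
        rw [h1.col_three hrn, hE.col_three hrn]
      refine ⟨h5, h2.trans h6, fun htwo hk3 hf' => ?_, fun hk3 => ?_⟩
      · obtain ⟨hf'', hor⟩ := h3 htwo hk3 hf'
        obtain ⟨h8, h9⟩ := h7 (fun u hu => by
          obtain ⟨d, hd, hd'⟩ := htwo u ((hcol u).1 hu)
          exact ⟨d, hd, h2 _ _ (hle' _ _ hd')⟩) ((hcol k).2 hk3) hf''
        refine ⟨h8, ?_⟩
        rcases hor with ⟨d, hd, hF⟩ | hno
        · exact Or.inl ⟨d, hd, hF.mono fun e _ he => h6 _ _ he⟩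
        · refine h9.imp id fun hno' d hd f hf => ?_
          rcases (show d < c ∨ d = c by omega) with hd | rfl
          · exact hno d hd f (hf.anti h6)
          · exact hno' f hf
      · have h10 : m'' 10 k 3 = 0 := by
          by_contra h0
          exact hk3 ((hcol k).1 ⟨hk, by decide, h0⟩)
        have : tryLabel.exec m'' = m'' := by simp [tryLabel, exec, h33, h10]
        rw [this, h4 hk3]

end Greedy

/-! ### Attempts on a component -/

section Attempt

open Code

variable {n : ℕ} {G : SimpleGraph ℕ} {X : ℕ → Prop} {m : Memory} {T : ℕ → ℕ} {a b r : ℕ}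
  {Z : ℕ → ℕ → Prop} {f : ℕ → ℕ}

/-- The restriction with parameters `x, y, z, d` respects the labelling `f` and leaves at most two
labels at each vertex of the component of `r`. -/
def Suitable (G : SimpleGraph ℕ) (X : ℕ → Prop) (f : ℕ → ℕ) (r x y z d : ℕ) : Prop :=
  (d = 0 ∧ f x = 1 ∧ f y = 0 ∧ f z = 2 ∧ ∀ Z, UnitClosed (core G X) Z → Forces Z x 1 →
    Forces Z y 0 → Forces Z z 2 → ∀ u, (core G X).Reachable r u → ∃ c < 3, Z u c) ∨
  (0 < d ∧ ∀ u, (core G X).Reachable r u → f u ≠ d)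

theorem exists_suitable (hn : ∀ u v, G.Adj u v → u < n) (hP : NoInducedP5 (core G X))
    (hf : IsLabelling G f) (hr : r < n) :
    ∃ x < n, ∃ y < n, ∃ z < n, ∃ d < 3, Suitable G X f r x y z d := by
  by_cases h1 : ∃ u, (core G X).Reachable r u ∧ f u = 1
  swap
  · exact ⟨r, hr, r, hr, r, hr, 1, by decide, Or.inr ⟨by decide, fun u hu h => h1 ⟨u, hu, h⟩⟩⟩
  by_cases h2 : ∃ u, (core G X).Reachable r u ∧ f u = 2
  swap
  · exact ⟨r, hr, r, hr, r, hr, 2, by decide, Or.inr ⟨by decide, fun u hu h => h2 ⟨u, hu, h⟩⟩⟩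
  obtain ⟨a₀, hra, ha⟩ := h1
  obtain ⟨b₀, hrb, hb⟩ := h2
  have hfin : ∀ v, ((core G X).neighborSet v).Finite := fun v =>
    (Set.finite_Iio n).subset fun w (hw : (core G X).Adj v w) => hn w v hw.1.symm
  have hf' : IsLabelling (core G X) f := ⟨hf.lt_three, fun u v huv => hf.adj u v huv.1⟩
  obtain ⟨x, y, z, -, hyx, hyz, hx, hy, hz, hZ⟩ := hf'.exists_triple hP hfin hra hrb ha hb
  exact ⟨x, hn _ _ hyx.1.symm, y, hn _ _ hyx.1, z, hn _ _ hyz.1.symm, 0, by decide,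
    Or.inl ⟨rfl, hx, hy, hz, hZ⟩⟩

theorem LabelOK.congr {l l' : ℕ → ℕ} {u : ℕ} (h : LabelOK G X T a b l u) (hu : l' u = l u)
    (hadj : ∀ v, (core G X).Adj u v → l' v = l v) : LabelOK G X T a b l' u :=
  ⟨by rw [hu]; exact h.lt_three, by rw [hu]; exact h.eq_of_mem, by rw [hu]; exact h.eq_one,
    by rw [hu]; exact h.eq_two, by rw [hu]; exact h.boundary,
    fun v hv => by rw [hu, hadj v hv]; exact h.adj v hv⟩

/-- Unique remaining labels in a closed table form a correct labelling of the component. -/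
theorem IsExtension.labelOK (hn : ∀ u v, G.Adj u v → u < n) (hT : ∀ u, X u → T u < 3)
    (hE : IsExtension n G X T a b r Z) (hZn : ∀ u, Z u 3 → u < n) {l : ℕ → ℕ}
    (hl : ∀ u, Z u 3 → l u < 3 ∧ Forces Z u (l u) ∧ ¬ Z u (l u)) {u : ℕ} (hu : Z u 3) :
    LabelOK G X T a b l u := by
  obtain ⟨h1, h2, h3⟩ := hl u hu
  have hun := hZn u hu
  refine ⟨h1, fun hX => ?_, fun ha => ?_, fun hb => ?_, fun v huv hXv hcon => ?_,
    fun v huv hcon => ?_⟩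
  · by_contra hne
    exact h3 (hE.forces_of_mem hun hX _ h1 hne)
  · by_contra hne
    exact h3 (hE.start_le _ _ ⟨hun, Or.inr (Or.inl ⟨ha, h1, hne⟩)⟩)
  · by_contra hne
    exact h3 (hE.start_le _ _ ⟨hun, Or.inr (Or.inr (Or.inl ⟨hb, h1, hne⟩))⟩)
  · exact h3 (hE.closed.unitClosed v u (T v) (l u) huv.symm (hT v hXv) h1
      (hE.forces_of_mem (hn _ _ huv.symm) hXv) (by omega))
  · obtain ⟨h4, -, h6⟩ := hl v (hE.closed u v 3 huv.1 (Or.inr (Or.inr (Or.inr ⟨rfl, hu, huv.2⟩))))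
    exact h6 (hE.closed.unitClosed u v (l u) (l v) huv.1 h1 h4 h2 hcon)

/-- What `restrict` does to an extension: column `3` stays, only labels are excluded, and for
suitable parameters at most two labels are left after propagation. -/
theorem restrict_spec (h : Env n G X m) {x y z d : ℕ} (hx : m 23 0 0 = x) (hy : m 24 0 0 = y)
    (hz : m 25 0 0 = z) (hd : m 26 0 0 = d) (hxn : x < n) (hyn : y < n) (hzn : z < n)
    (hd3 : d < 3) (hr : r < n) (hE : IsExtension n G X T a b r (excluded n m)) :
    excluded n m ≤ excluded n (restrict.exec m) ∧
    (∀ u, excluded n (restrict.exec m) u 3 → excluded n m u 3) ∧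
    ∀ f, Suitable G X f r x y z d → Respects G (excluded n m) f →
      Respects G (excluded n (restrict.exec m)) f ∧
      ∀ Z, UnitClosed G Z → excluded n (restrict.exec m) ≤ Z →
        ∀ u, (core G X).Reachable r u → ∃ c < 3, Z u c := by
  rcases Nat.eq_zero_or_pos d with rfl | hd0
  · have hex := excluded_restrict_triple (n := n) hd hx hy hz hxn hyn hzn
    refine ⟨fun u c hu => (hex u c).2 (Or.inl hu),
      fun u hu => ((hex u 3).1 hu).resolve_right (by omega), ?_⟩
    rintro f (⟨-, hfx, hfy, hfz, hZ⟩ | ⟨hd0, -⟩) hf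
    swap
    · omega
    refine ⟨⟨hf.1, fun u hu => ?_⟩, fun Z hcl hle u hu => ?_⟩
    · rcases (hex _ _).1 hu with hu | ⟨rfl, -, hne⟩ | ⟨rfl, -, hne⟩ | ⟨rfl, -, hne⟩
      · exact hf.2 u hu
      · exact hne hfx
      · exact hne hfy
      · exact hne hfz
    · refine hZ Z (fun u v d c huv => hcl u v d c huv.1) ?_ ?_ ?_ u hu
      · exact fun c hc hne => hle _ _ ((hex x c).2 (Or.inr (Or.inl ⟨rfl, hc, hne⟩)))
      · exact fun c hc hne => hle _ _ ((hex y c).2 (Or.inr (Or.inr (Or.inl ⟨rfl, hc, hne⟩))))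
      · exact fun c hc hne => hle _ _ ((hex z c).2 (Or.inr (Or.inr (Or.inr ⟨rfl, hc, hne⟩))))
  · have hex := excluded_restrict_label h hd hd0 hd3
    refine ⟨fun u c hu => (hex u c).2 (Or.inl hu),
      fun u hu => ((hex u 3).1 hu).resolve_right (by omega), ?_⟩
    rintro f (⟨hd0', -⟩ | ⟨-, hfd⟩) hf
    · omega
    refine ⟨⟨hf.1, fun u hu => ?_⟩, fun Z _ hle u hu => ?_⟩
    · rcases (hex _ _).1 hu with hu | ⟨hu, hfu⟩
      · exact hf.2 u hu
      · exact hfd u (hE.reachable u hu) hfu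
    · exact ⟨d, hd3, hle _ _ ((hex u d).2 (Or.inr ⟨(hE.col_three hr u).2 hu, rfl⟩))⟩

/-- An attempt never spoils a correctly labelled component, and it labels the component of `r`
correctly if its parameters are suitable for some labelling that extends the guessed labels. -/
theorem attempt_spec (hn : ∀ u v, G.Adj u v → u < n) (h : Env n G X m)
    (hT : ∀ u, X u → m 6 u 0 < 3) {x y z d : ℕ} (ha : m 20 0 0 = a) (hb : m 21 0 0 = b)
    (hr : m 22 0 0 = r) (hx : m 23 0 0 = x) (hy : m 24 0 0 = y)
    (hz : m 25 0 0 = z) (hd : m 26 0 0 = d) (han : a < n) (hbn : b < n) (hrn : r < n) (hxn : x < n)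
    (hyn : y < n) (hzn : z < n) (hd3 : d < 3) :
    (∀ u, LabelOK G X (fun u => m 6 u 0) a b (fun u => m 12 u 0) u →
      LabelOK G X (fun u => m 6 u 0) a b (fun u => attempt.exec m 12 u 0) u) ∧
    ∀ f, IsLabelling G f → (∀ u, u < n → X u → f u = m 6 u 0) → f a = 1 → f b = 2 →
      Suitable G X f r x y z d →
      LabelOK G X (fun u => m 6 u 0) a b (fun u => attempt.exec m 12 u 0) r := by
  obtain ⟨m₁, hm₁⟩ : ∃ m₁, m₁ = startTable.exec m := ⟨_, rfl⟩
  obtain ⟨m₂, hm₂⟩ : ∃ m₂, m₂ = propagate.exec m₁ := ⟨_, rfl⟩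
  obtain ⟨m₃, hm₃⟩ : ∃ m₃, m₃ = restrict.exec m₂ := ⟨_, rfl⟩
  obtain ⟨m₄, hm₄⟩ : ∃ m₄, m₄ = propagate.exec m₃ := ⟨_, rfl⟩
  obtain ⟨m₅, hm₅⟩ : ∃ m₅, m₅ = greedy.exec m₄ := ⟨_, rfl⟩
  have hex : attempt.exec m = record.exec m₅ := by
    simp only [attempt, exec, ← hm₁, ← hm₂, ← hm₃, ← hm₄, ← hm₅]
  have henv₁ : Env n G X m₁ := hm₁ ▸ h.exec (by decide)
  have henv₂ : Env n G X m₂ := hm₂ ▸ henv₁.exec (by decide)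
  have henv₃ : Env n G X m₃ := hm₃ ▸ henv₂.exec (by decide)
  have henv₄ : Env n G X m₄ := hm₄ ▸ henv₃.exec (by decide)
  have henv₅ : Env n G X m₅ := hm₅ ▸ henv₄.exec (by decide)
  have hfr₂ : ∀ a ∈ [23, 24, 25, 26], m₂ a = m a := fun a ha => by
    rw [hm₂, exec_of_not_mem_writes (by revert a; decide), hm₁,
      exec_of_not_mem_writes (by revert a; decide)]
  have h12 : m₅ 12 = m 12 := by
    rw [hm₅, exec_of_not_mem_writes (by decide), hm₄, exec_of_not_mem_writes (by decide), hm₃,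
      exec_of_not_mem_writes (by decide), hm₂, exec_of_not_mem_writes (by decide), hm₁,
      exec_of_not_mem_writes (by decide)]
  have hstart := excluded_startTable h ha hb hr han hbn hrn
  rw [← hm₁] at hstart
  obtain ⟨-, hE₂, hf₂⟩ := propagate_isExtension hn henv₁ (T := fun u => m 6 u 0) (a := a) (b := b)
    (r := r) (fun u c hu => (hstart u c).2 hu) (fun u hu => by
      obtain ⟨-, ⟨-, h3, -⟩ | ⟨-, h3, -⟩ | ⟨-, h3, -⟩ | ⟨rfl, -⟩⟩ := (hstart u 3).1 hu
      · omega
      · omega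
      · omega
      · exact SimpleGraph.Reachable.refl _)
  rw [← hm₂] at hE₂ hf₂
  obtain ⟨hle₃, hcol₃, hf₃⟩ := restrict_spec henv₂ (by rw [hfr₂ 23 (by decide), hx])
    (by rw [hfr₂ 24 (by decide), hy]) (by rw [hfr₂ 25 (by decide), hz])
    (by rw [hfr₂ 26 (by decide), hd]) hxn hyn hzn hd3 hrn hE₂
  rw [← hm₃] at hle₃ hcol₃ hf₃
  obtain ⟨hle₄, hE₄, hf₄⟩ := propagate_isExtension hn henv₃ (hE₂.start_le.trans hle₃)
    (fun u hu => hE₂.reachable u (hcol₃ u hu))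
  rw [← hm₄] at hle₄ hE₄ hf₄
  obtain ⟨hE₅, hgreedy⟩ := greedy_spec hn henv₄ hrn hE₄
  rw [← hm₅] at hE₅ hgreedy
  obtain ⟨hr1, hr2, hr3⟩ := record_spec henv₅
  rw [hex]
  refine ⟨fun u hu => ?_, fun f hf hfX hfa hfb hsuit => ?_⟩
  · rcases hr2 with hr2 | hr2
    · rw [hr2, h12]
      exact hu
    · by_cases hu3 : excluded n m₅ u 3
      · exact hE₅.labelOK hn hT (fun u hu => hu.1) hr2 hu3
      · refine hu.congr ?_ fun v huv => ?_
        · simp only [hr1 u hu3, h12]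
        · have hv3 : ¬ excluded n m₅ v 3 := fun hv => hu3
            (hE₅.closed v u 3 huv.1.symm (Or.inr (Or.inr (Or.inr ⟨rfl, hv, huv.2.2, huv.2.1⟩))))
          simp only [hr1 v hv3, h12]
  · have hfm₁ : Respects G (excluded n m₁) f := ⟨hf, fun u hu => by
      obtain ⟨hun, ⟨hX, -, hne⟩ | ⟨rfl, -, hne⟩ | ⟨rfl, -, hne⟩ | ⟨-, h3⟩⟩ := (hstart _ _).1 hu
      · exact hne (hfX u hun hX)
      · exact hne hfa
      · exact hne hfb
      · exact absurd (hf.lt_three u) (by omega)⟩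
    obtain ⟨hfm₃, htwo⟩ := hf₃ f hsuit (hf₂ f hfm₁)
    have hsingle := hgreedy
      (fun u hu => htwo _ hE₄.closed.unitClosed hle₄ u (hE₄.reachable u hu)) ⟨f, hf₄ f hfm₃⟩
    exact hE₅.labelOK hn hT (fun u hu => hu.1) (hr3 hsingle)
      ((hE₅.col_three hrn r).2 (SimpleGraph.Reachable.refl r))

end Attempt

/-! ### The search for a labelling -/

namespace Code

/-- The entry of array `12` for the vertex in register `i`. -/
def labelE (i : ℕ) : Expr := .read 12 (.reg i) (.const 0)

/-- All attempts for all components. -/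
def labelAll : Code := rep 22 0 (rep 23 0 (rep 24 0 (rep 25 0 (rep 26 14 attempt))))

/-- The test that the labels at the ends `31`, `32` of an edge are in conflict. -/
def conflictE : Expr :=
  .and (.read 1 (.reg 31) (.reg 32)) (.add (.and (.not (labelE 31)) (.not (labelE 32)))
    (.and (.and (labelE 31) (labelE 32)) (.ne (labelE 31) (labelE 32))))

/-- The test that register `35` is clear and that the vertices in the registers `20` and `21` have
different labels other than `0`. -/
def separatedE : Expr :=
  .and (.not (.reg 35)) (.and (.and (labelE 20) (labelE 21)) (.ne (labelE 20) (labelE 21)))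

/-- Write the answer `1` and the vertices with label `0`. -/
def store : Code :=
  seq (write 3 (.const 0) (.const 0) (.const 1))
    (rep 31 0 (write 4 (.reg 31) (.const 0) (.not (labelE 31))))

/-- Check the labels in array `12`, and store the result if they describe an independent cutset. -/
def finish : Code :=
  seq (write 35 (.const 0) (.const 0) (.const 0))
    (seq (rep 31 0 (rep 32 0
        (cond conflictE (write 35 (.const 0) (.const 0) (.const 1)) skip)))
      (cond separatedE store skip))

/-- Search with the given labels on `X`, for all choices of a vertex with label `1` and a vertex
with label `2`. -/
def searchPairs : Code := rep 20 0 (rep 21 0 (seq labelAll finish))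

end Code

/-- The labels `l` certify that the vertices with label `0` are an independent cutset of `G`, which
separates `a` from `b`. -/
def Certifies (G : SimpleGraph ℕ) (l : ℕ → ℕ) (a b : ℕ) : Prop :=
  (∀ u v, G.Adj u v → ¬ (l u = 0 ∧ l v = 0) ∧ ¬ ((l u ≠ 0 ∧ l v ≠ 0) ∧ l u ≠ l v)) ∧
    (l a ≠ 0 ∧ l b ≠ 0) ∧ l a ≠ l b

/-- The answer in the memory `m` is `0`, or it is `1` and the set in array `4` is certified to be an
independent cutset. -/
def SoundAnswer (n : ℕ) (G : SimpleGraph ℕ) (m : Memory) : Prop :=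
  m 3 0 0 = 0 ∨ (m 3 0 0 = 1 ∧ ∃ l a b, a < n ∧ b < n ∧ Certifies G l a b ∧
    ∀ u < n, m 4 u 0 ≠ 0 ↔ l u = 0)

section Search

open Code

variable {n : ℕ} {G : SimpleGraph ℕ} {X : ℕ → Prop} {m : Memory} {T : ℕ → ℕ} {a b r : ℕ}
  {f : ℕ → ℕ}

/-- On memories that satisfy `H`, the code `P` preserves all correct labels in array `12`, and it
produces a correct label for the vertex in register `22` if moreover `S` holds. -/
def Improves (G : SimpleGraph ℕ) (X : ℕ → Prop) (T : ℕ → ℕ) (a b : ℕ) (H : Memory → Prop)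
    (P : Code) (S : Memory → Prop) : Prop :=
  ∀ m, H m → (∀ u, LabelOK G X T a b (fun u => m 12 u 0) u →
      LabelOK G X T a b (fun u => P.exec m 12 u 0) u) ∧
    (S m → LabelOK G X T a b (fun u => P.exec m 12 u 0) (m 22 0 0))

theorem Improves.rep {i c : ℕ} {P : Code} {H H' S S' : Memory → Prop}
    (h : Improves G X T a b H' P S') (hi : i ≠ 12) (h22 : 22 ∉ (rep i c P).writes)
    (hH : ∀ m m' : Memory, H m → (∀ a, a ∉ (rep i c P).writes → m' a = m a) →
      m' i 0 0 < m c 0 0 → H' m')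
    (hS : ∀ m, H m → S m → ∃ k < m c 0 0, ∀ m' : Memory,
      (∀ a, a ∉ (rep i c P).writes → m' a = m a) → m' i 0 0 = k → S' m') :
    Improves G X T a b H (rep i c P) S := by
  intro m hm
  have hQ : ∀ u, _ := fun u => exec_rep_search (i := i) (b := c) (P := P) (m := m)
    (fun m => LabelOK G X T a b (fun u => m 12 u 0) u)
    (fun m k hm => by simpa only [Memory.set_ne hi.symm] using hm)
    (fun m' hfr hlt hm' => (h m' (hH m m' hm hfr hlt)).1 u hm')
  refine ⟨fun u => (hQ u).1, fun hs => ?_⟩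
  obtain ⟨k, hk, hSk⟩ := hS m hm hs
  refine (hQ (m 22 0 0)).2 k hk fun m' hfr hk' => ?_
  rw [← hfr 22 h22]
  exact (h m' (hH m m' hm hfr (by omega))).2 (hSk m' hfr hk')

/-- The memory contains the environment, the guessed labels, and registers `i ∈ L` with vertices. -/
structure Guess (n : ℕ) (G : SimpleGraph ℕ) (X : ℕ → Prop) (T : ℕ → ℕ) (a b : ℕ) (L : List ℕ)
    (m : Memory) : Prop where
  env : Env n G X m
  labels : ∀ u, m 6 u 0 = T u
  one : m 20 0 0 = a
  two : m 21 0 0 = b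
  lt : ∀ i ∈ L, m i 0 0 < n

theorem Guess.congr {L L' : List ℕ} {m' : Memory} (h : Guess n G X T a b L m)
    (h' : ∀ a ∈ [0, 1, 5, 13, 14] ++ [6, 20, 21], m' a = m a)
    (hL : ∀ i ∈ L', (i ∈ L ∧ m' i = m i) ∨ m' i 0 0 < n) : Guess n G X T a b L' m' where
  env := h.env.congr fun a ha => h' a (List.mem_append_left _ ha)
  labels u := by rw [h' 6 (by decide), h.labels]
  one := by rw [h' 20 (by decide), h.one]
  two := by rw [h' 21 (by decide), h.two]
  lt i hi := by
    rcases hL i hi with ⟨h1, h2⟩ | h1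
    · rw [h2]
      exact h.lt i h1
    · exact h1

theorem labelAll_spec (hn : ∀ u v, G.Adj u v → u < n) (hT : ∀ u, X u → T u < 3)
    (han : a < n) (hbn : b < n) (hP : NoInducedP5 (core G X)) (hf : IsLabelling G f)
    (hfX : ∀ u, u < n → X u → f u = T u) (hfa : f a = 1) (hfb : f b = 2)
    (hm : Guess n G X T a b [] m) {r : ℕ} (hr : r < n) :
    LabelOK G X T a b (fun u => labelAll.exec m 12 u 0) r := by
  have h₀ : Improves G X T a b
      (fun m => Guess n G X T a b [22, 23, 24, 25] m ∧ m 26 0 0 < 3) attempt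
      (fun m => Suitable G X f (m 22 0 0) (m 23 0 0) (m 24 0 0) (m 25 0 0) (m 26 0 0)) := by
    rintro m ⟨hm, hd⟩
    have hTm : T = fun u => m 6 u 0 := funext fun u => (hm.labels u).symm
    subst hTm
    obtain ⟨h1, h2⟩ := attempt_spec hn hm.env hT hm.one hm.two rfl rfl rfl rfl rfl han hbn
      (hm.lt 22 (by decide)) (hm.lt 23 (by decide)) (hm.lt 24 (by decide)) (hm.lt 25 (by decide)) hd
    exact ⟨h1, h2 f hf hfX hfa hfb⟩
  have h₁ : Improves G X T a b (Guess n G X T a b [22, 23, 24, 25]) (rep 26 14 attempt)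
      (fun m => ∃ d < 3, Suitable G X f (m 22 0 0) (m 23 0 0) (m 24 0 0) (m 25 0 0) d) := by
    refine h₀.rep (by decide) (by decide) (fun m m' hm hfr hlt => ⟨hm.congr
      (fun a ha => hfr a (by revert a; decide)) fun i hi => ?_, ?_⟩) ?_
    · exact Or.inl ⟨hi, hfr i (by revert i; decide)⟩
    · rwa [hm.env.three] at hlt
    · rintro m hm ⟨d, hd, hs⟩
      refine ⟨d, by rwa [hm.env.three], fun m' hfr hk => ?_⟩
      rwa [hk, hfr 22 (by decide), hfr 23 (by decide), hfr 24 (by decide), hfr 25 (by decide)]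
  have h₂ : Improves G X T a b (Guess n G X T a b [22, 23, 24]) (rep 25 0 (rep 26 14 attempt))
      (fun m => ∃ z < n, ∃ d < 3, Suitable G X f (m 22 0 0) (m 23 0 0) (m 24 0 0) z d) := by
    refine h₁.rep (by decide) (by decide) (fun m m' hm hfr hlt => hm.congr
      (fun a ha => hfr a (by revert a; decide)) fun i hi => ?_) ?_
    · rw [hm.env.size] at hlt
      rcases (show i ∈ [22, 23, 24] ∨ i = 25 by simp at hi ⊢; omega) with hi | rfl
      · exact Or.inl ⟨hi, hfr i (by revert i; decide)⟩
      · exact Or.inr hlt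
    · rintro m hm ⟨z, hz, hs⟩
      refine ⟨z, by rwa [hm.env.size], fun m' hfr hk => ?_⟩
      rwa [hk, hfr 22 (by decide), hfr 23 (by decide), hfr 24 (by decide)]
  have h₃ : Improves G X T a b (Guess n G X T a b [22, 23])
      (rep 24 0 (rep 25 0 (rep 26 14 attempt)))
      (fun m => ∃ y < n, ∃ z < n, ∃ d < 3, Suitable G X f (m 22 0 0) (m 23 0 0) y z d) := by
    refine h₂.rep (by decide) (by decide) (fun m m' hm hfr hlt => hm.congr
      (fun a ha => hfr a (by revert a; decide)) fun i hi => ?_) ?_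
    · rw [hm.env.size] at hlt
      rcases (show i ∈ [22, 23] ∨ i = 24 by simp at hi ⊢; omega) with hi | rfl
      · exact Or.inl ⟨hi, hfr i (by revert i; decide)⟩
      · exact Or.inr hlt
    · rintro m hm ⟨y, hy, hs⟩
      refine ⟨y, by rwa [hm.env.size], fun m' hfr hk => ?_⟩
      rwa [hk, hfr 22 (by decide), hfr 23 (by decide)]
  have h₄ : Improves G X T a b (Guess n G X T a b [22])
      (rep 23 0 (rep 24 0 (rep 25 0 (rep 26 14 attempt))))
      (fun m => ∃ x < n, ∃ y < n, ∃ z < n, ∃ d < 3, Suitable G X f (m 22 0 0) x y z d) := by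
    refine h₃.rep (by decide) (by decide) (fun m m' hm hfr hlt => hm.congr
      (fun a ha => hfr a (by revert a; decide)) fun i hi => ?_) ?_
    · rw [hm.env.size] at hlt
      rcases (show i ∈ [22] ∨ i = 23 by simp at hi ⊢; omega) with hi | rfl
      · exact Or.inl ⟨hi, hfr i (by revert i; decide)⟩
      · exact Or.inr hlt
    · rintro m hm ⟨x, hx, hs⟩
      refine ⟨x, by rwa [hm.env.size], fun m' hfr hk => ?_⟩
      rwa [hk, hfr 22 (by decide)]
  have hguess : ∀ m' : Memory, (∀ a, a ∉ labelAll.writes → m' a = m a) → m' 22 0 0 < m 0 0 0 →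
      Guess n G X T a b [22] m' := fun m' hfr hlt =>
    hm.congr (fun a ha => hfr a (by revert a; decide)) fun i hi => Or.inr (by
      rw [hm.env.size] at hlt
      rwa [List.mem_singleton.1 hi])
  refine (exec_rep_search (i := 22) (b := 0) (m := m)
    (fun m => LabelOK G X T a b (fun u => m 12 u 0) r)
    (fun m k hm => by simpa only [Memory.set_ne (show 12 ≠ 22 by decide)] using hm)
    (fun m' hfr hlt => (h₄ m' (hguess m' hfr hlt)).1 r)).2 r (by rwa [hm.env.size])
    fun m' hfr hk => ?_
  have := (h₄ m' (hguess m' hfr (by rwa [hk, hm.env.size]))).2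
    (by simpa only [hk] using exists_suitable hn hP hf hr)
  rwa [hk] at this

theorem store_spec (hsize : m 0 0 0 = n) : store.exec m 3 0 0 = 1 ∧
    ∀ u < n, store.exec m 4 u 0 ≠ 0 ↔ m 12 u 0 = 0 := by
  simp only [store, exec.eq_3]
  constructor
  · rw [exec_of_not_mem_writes (by decide)]
    simp [exec, Memory.set_same]
  · have hloop := exec_rep_induction (i := 31) (b := 0)
      (m := (write 3 (.const 0) (.const 0) (.const 1)).exec m)
      (P := write 4 (.reg 31) (.const 0) (.not (labelE 31)))
      (fun k m' => ∀ u < k, m' 4 u 0 ≠ 0 ↔ m 12 u 0 = 0) ?_ ?_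
    · have : (write 3 (.const 0) (.const 0) (.const 1)).exec m 0 0 0 = n := by
        simp [exec, Memory.set_ne, hsize]
      rwa [this] at hloop
    · intro u hu
      omega
    · intro k hk m' hk' hfr hI u hu
      rw [Memory.set_ne (by decide)]
      have h12 : m' 12 = m 12 := by rw [hfr 12 (by decide)]; rfl
      by_cases huk : u = k
      · subst huk
        simp [exec, Memory.set_same, labelE, hk', h12]
      · have := hI u (by omega)
        simpa [exec, Memory.set_same, hk', huk] using this

theorem finish_spec (hn : ∀ u v, G.Adj u v → u < n) (h : Env n G X m) (ha : m 20 0 0 = a)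
    (hb : m 21 0 0 = b) :
    (Certifies G (fun u => m 12 u 0) a b → finish.exec m 3 0 0 = 1 ∧
      ∀ u < n, finish.exec m 4 u 0 ≠ 0 ↔ m 12 u 0 = 0) ∧
    (¬ Certifies G (fun u => m 12 u 0) a b →
      finish.exec m 3 = m 3 ∧ finish.exec m 4 = m 4) := by
  obtain ⟨m₁, hm₁⟩ : ∃ m₁, m₁ = (write 35 (.const 0) (.const 0) (.const 0)).exec m := ⟨_, rfl⟩
  obtain ⟨m₂, hm₂⟩ : ∃ m₂, m₂ = (rep 31 0 (rep 32 0
      (cond conflictE (write 35 (.const 0) (.const 0) (.const 1)) skip))).exec m₁ := ⟨_, rfl⟩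
  have hfr₂ : ∀ a, a ∉ [31, 32, 35] → m₂ a = m a := fun a ha => by
    simp only [List.mem_cons, List.not_mem_nil, or_false, not_or] at ha
    rw [hm₂, exec_of_not_mem_writes (by simp [writes, ha]), hm₁,
      exec_of_not_mem_writes (by simp [writes, ha])]
  have h₁ : m₁ 0 0 0 = n := by simp [hm₁, exec, Memory.set_ne, h.size]
  have h35 : m₂ 35 0 0 ≠ 0 ↔ ∃ u < n, ∃ v < n, G.Adj u v ∧
      ((m 12 u 0 = 0 ∧ m 12 v 0 = 0) ∨
        ((m 12 u 0 ≠ 0 ∧ m 12 v 0 ≠ 0) ∧ m 12 u 0 ≠ m 12 v 0)) := by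
    rw [hm₂, ← h₁]
    refine exec_rep_induction (i := 31) (b := 0) (m := m₁)
      (fun k m' => m' 35 0 0 ≠ 0 ↔ ∃ u < k, ∃ v < m₁ 0 0 0, G.Adj u v ∧
      ((m 12 u 0 = 0 ∧ m 12 v 0 = 0) ∨
        ((m 12 u 0 ≠ 0 ∧ m 12 v 0 ≠ 0) ∧ m 12 u 0 ≠ m 12 v 0))) ?_ ?_
    · simp [hm₁, exec, Memory.set_ne, Memory.set_same]
    · intro k hk m' hk' hfr hI
      have h0 : m' 0 = m₁ 0 := hfr 0 (by decide)
      have h1 : m' 1 = m 1 := by rw [hfr 1 (by decide), hm₁]; rfl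
      have h12 : m' 12 = m 12 := by rw [hfr 12 (by decide), hm₁]; rfl
      rw [Memory.set_ne (by decide), exec_flag (i := 32) (p := fun v => G.Adj k v ∧
        ((m 12 k 0 = 0 ∧ m 12 v 0 = 0) ∨
        ((m 12 k 0 ≠ 0 ∧ m 12 v 0 ≠ 0) ∧ m 12 k 0 ≠ m 12 v 0))) (by decide), hI, h0]
      · simp only [Nat.lt_succ_iff_lt_or_eq, or_and_right, exists_or, exists_eq_left]
      · intro v hv m'' hv' hfr'
        have h31 : m'' 31 = m' 31 := hfr' 31 (by decide) (by decide)
        have h1' : m'' 1 = m 1 := by rw [hfr' 1 (by decide) (by decide), h1]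
        have h12' : m'' 12 = m 12 := by rw [hfr' 12 (by decide) (by decide), h12]
        rw [← h.adj k v]
        simp [conflictE, labelE, h31, hk', hv', h1', h12']
        tauto
  have hsep : separatedE.val m₂ ≠ 0 ↔ Certifies G (fun u => m 12 u 0) a b := by
    have h12 : m₂ 12 = m 12 := hfr₂ 12 (by decide)
    have h20 : m₂ 20 0 0 = a := by rw [hfr₂ 20 (by decide), ha]
    have h21 : m₂ 21 0 0 = b := by rw [hfr₂ 21 (by decide), hb]
    have : m₂ 35 0 0 = 0 ↔ ∀ u v, G.Adj u v → ¬ (m 12 u 0 = 0 ∧ m 12 v 0 = 0) ∧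
        ¬ ((m 12 u 0 ≠ 0 ∧ m 12 v 0 ≠ 0) ∧ m 12 u 0 ≠ m 12 v 0) := by
      rw [← not_iff_not, ← ne_eq, h35]
      constructor
      · rintro ⟨u, -, v, -, huv, hor⟩ hall
        exact hor.elim (hall u v huv).1 (hall u v huv).2
      · intro hno
        by_contra hex
        refine hno fun u v huv => ⟨fun hc => hex ?_, fun hc => hex ?_⟩
        · exact ⟨u, hn _ _ huv, v, hn _ _ huv.symm, huv, Or.inl hc⟩
        · exact ⟨u, hn _ _ huv, v, hn _ _ huv.symm, huv, Or.inr hc⟩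
    rw [Certifies, ← this]
    simp [separatedE, labelE, h12, h20, h21]
  have hex : finish.exec m = if separatedE.val m₂ = 0 then m₂ else store.exec m₂ := by
    rw [finish, exec.eq_3, exec.eq_3, ← hm₁, ← hm₂, exec.eq_4, exec.eq_1]
  rw [hex]
  constructor
  · intro hc
    rw [if_neg (hsep.2 hc)]
    have := store_spec (m := m₂) (n := n) (by rw [hfr₂ 0 (by decide), h.size])
    rwa [hfr₂ 12 (by decide)] at this
  · intro hc
    rw [if_pos (by by_contra h0; exact hc (hsep.1 h0))]
    exact ⟨hfr₂ 3 (by decide), hfr₂ 4 (by decide)⟩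

end Search

section Search

open Code

variable {n : ℕ} {G : SimpleGraph ℕ} {X : ℕ → Prop} {m : Memory} {T : ℕ → ℕ} {a b r : ℕ}
  {f : ℕ → ℕ}

theorem certifies_of_labelOK (hn : ∀ u v, G.Adj u v → u < n) {l : ℕ → ℕ} (han : a < n) (hbn : b < n)
    (hl : ∀ u < n, LabelOK G X T a b l u) : Certifies G l a b := by
  have ha := (hl a han).eq_one rfl
  have hb := (hl b hbn).eq_two rfl
  refine ⟨fun u v huv => ?_, by omega, by omega⟩
  have hu := hl u (hn _ _ huv)
  have hv := hl v (hn _ _ huv.symm)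
  have h1 := hu.lt_three
  have h2 := hv.lt_three
  have hsum : (l u + l v) % 3 ≠ 0 := by
    by_cases hXv : X v
    · rw [hv.eq_of_mem hXv]
      exact hu.boundary v huv hXv
    by_cases hXu : X u
    · rw [hu.eq_of_mem hXu, add_comm]
      exact hv.boundary u huv.symm hXu
    exact hu.adj v ⟨huv, hXu, hXv⟩
  omega

theorem SoundAnswer.congr {m' : Memory} (h : SoundAnswer n G m) (h3 : m' 3 = m 3)
    (h4 : m' 4 = m 4) : SoundAnswer n G m' := by
  simpa only [SoundAnswer, h3, h4] using h

theorem soundAnswer_finish (hn : ∀ u v, G.Adj u v → u < n) (h : Env n G X m)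
    (han : m 20 0 0 < n) (hbn : m 21 0 0 < n) :
    (SoundAnswer n G m → SoundAnswer n G (finish.exec m)) ∧
      (m 3 0 0 = 1 → finish.exec m 3 0 0 = 1) := by
  obtain ⟨h1, h2⟩ := finish_spec hn h rfl rfl
  by_cases hc : Certifies G (fun u => m 12 u 0) (m 20 0 0) (m 21 0 0)
  · exact ⟨fun _ => Or.inr ⟨(h1 hc).1, _, _, _, han, hbn, hc, (h1 hc).2⟩, fun _ => (h1 hc).1⟩
  · exact ⟨fun hs => hs.congr (h2 hc).1 (h2 hc).2, fun h3 => by rw [(h2 hc).1, h3]⟩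

theorem searchPairs_spec (hn : ∀ u v, G.Adj u v → u < n) (h : Env n G X m) :
    (SoundAnswer n G m → SoundAnswer n G (searchPairs.exec m)) ∧
    (m 3 0 0 = 1 → searchPairs.exec m 3 0 0 = 1) ∧
    (NoInducedP5 (core G X) → (∀ u, X u → m 6 u 0 < 3) → ∀ f, IsLabelling G f →
      (∀ u, u < n → X u → f u = m 6 u 0) → (∃ a < n, f a = 1) → (∃ b < n, f b = 2) →
      searchPairs.exec m 3 0 0 = 1) := by
  -- Soundness and persistence of a positive answer, for one pair and for the inner loop.
  have hbody : ∀ m : Memory, Env n G X m → m 20 0 0 < n → m 21 0 0 < n →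
      (SoundAnswer n G m → SoundAnswer n G ((seq labelAll finish).exec m)) ∧
      (m 3 0 0 = 1 → (seq labelAll finish).exec m 3 0 0 = 1) := by
    intro m h han hbn
    have hfr : ∀ a, a ∉ labelAll.writes → labelAll.exec m a = m a :=
      fun a ha => exec_of_not_mem_writes ha m
    obtain ⟨h1, h2⟩ := soundAnswer_finish hn (h.exec (P := labelAll) (by decide))
      (by rwa [hfr 20 (by decide)]) (by rwa [hfr 21 (by decide)])
    exact ⟨fun hs => h1 (hs.congr (hfr 3 (by decide)) (hfr 4 (by decide))),
      fun h3 => h2 (by rwa [hfr 3 (by decide)])⟩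
  have hset : ∀ i ∈ [20, 21], ∀ (m : Memory) k,
      (SoundAnswer n G m → SoundAnswer n G (m.set i 0 0 k)) ∧
      (m 3 0 0 = 1 → m.set i 0 0 k 3 0 0 = 1) := by
    intro i hi m k
    have h3 : m.set i 0 0 k 3 = m 3 := Memory.set_ne (by rintro rfl; revert hi; decide)
    have h4 : m.set i 0 0 k 4 = m 4 := Memory.set_ne (by rintro rfl; revert hi; decide)
    exact ⟨fun hs => hs.congr h3 h4, fun h => by rw [h3, h]⟩
  have hinner : ∀ m : Memory, Env n G X m → m 20 0 0 < n →
      (SoundAnswer n G m → SoundAnswer n G ((rep 21 0 (seq labelAll finish)).exec m)) ∧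
      (m 3 0 0 = 1 → (rep 21 0 (seq labelAll finish)).exec m 3 0 0 = 1) := by
    intro m h han
    have hb : ∀ m' : Memory, (∀ a, a ∉ (rep 21 0 (seq labelAll finish)).writes → m' a = m a) →
        m' 21 0 0 < m 0 0 0 → _ := fun m' hfr hlt => hbody m'
      (h.congr fun a ha => hfr a (by revert a; decide)) (by rwa [hfr 20 (by decide)])
      (by rwa [h.size] at hlt)
    exact ⟨(exec_rep_search (SoundAnswer n G) (fun m k => (hset 21 (by decide) m k).1)
        fun m' hfr hlt => (hb m' hfr hlt).1).1,
      (exec_rep_search (fun m => m 3 0 0 = 1) (fun m k => (hset 21 (by decide) m k).2)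
        fun m' hfr hlt => (hb m' hfr hlt).2).1⟩
  have hb : ∀ m' : Memory, (∀ a, a ∉ searchPairs.writes → m' a = m a) →
      m' 20 0 0 < m 0 0 0 → _ := fun m' hfr hlt => hinner m'
    (h.congr fun a ha => hfr a (by revert a; decide)) (by rwa [h.size] at hlt)
  refine ⟨(exec_rep_search (SoundAnswer n G) (fun m k => (hset 20 (by decide) m k).1)
      fun m' hfr hlt => (hb m' hfr hlt).1).1,
    (exec_rep_search (fun m => m 3 0 0 = 1) (fun m k => (hset 20 (by decide) m k).2)
      fun m' hfr hlt => (hb m' hfr hlt).2).1, ?_⟩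
  rintro hP hT f hf hfX ⟨a, han, ha⟩ ⟨b, hbn, hb'⟩
  refine (exec_rep_search (fun m => m 3 0 0 = 1) (fun m k => (hset 20 (by decide) m k).2)
      fun m' hfr hlt => (hb m' hfr hlt).2).2 a (by rwa [h.size]) fun m' hfr hk => ?_
  have h' : Env n G X m' := h.congr fun a ha => hfr a (by revert a; decide)
  refine (exec_rep_search (fun m => m 3 0 0 = 1) (fun m k => (hset 21 (by decide) m k).2)
    fun m'' hfr' hlt => (hbody m'' (h'.congr fun a ha => hfr' a (by revert a; decide))
      (by rwa [hfr' 20 (by decide), hk]) (by rwa [h'.size] at hlt)).2).2 b (by rwa [h'.size])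
    fun m'' hfr' hk' => ?_
  have h'' : Env n G X m'' := h'.congr fun a ha => hfr' a (by revert a; decide)
  have h20 : m'' 20 0 0 = a := by rw [hfr' 20 (by decide), hk]
  have h6 : m'' 6 = m 6 := by rw [hfr' 6 (by decide), hfr 6 (by decide)]
  have hguess : Guess n G X (fun u => m 6 u 0) a b [] m'' :=
    ⟨h'', fun u => by rw [h6], h20, hk', by simp⟩
  have hcert := certifies_of_labelOK hn han hbn fun r hr =>
    labelAll_spec hn hT han hbn hP hf hfX ha hb' hguess hr
  refine ((finish_spec hn (h''.exec (P := labelAll) (by decide)) ?_ ?_).1 hcert).1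
  · rw [exec_of_not_mem_writes (by decide), h20]
  · rw [exec_of_not_mem_writes (by decide), hk']

end Search

/-! ### Enumerating the labellings of the hitting set -/

open Classical in
/-- The number of labellings of the members of `X` below `v` with three labels. -/
noncomputable def weight (X : ℕ → Prop) : ℕ → ℕ
  | 0 => 1
  | v + 1 => if X v then 3 * weight X v else weight X v

open Classical in
/-- The number whose base `3` digits are the labels of the members of `X` below `v`. -/
noncomputable def digitValue (X : ℕ → Prop) (T : ℕ → ℕ) : ℕ → ℕ
  | 0 => 0
  | v + 1 => if X v then digitValue X T v + T v * weight X v else digitValue X T v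

section Digits

variable {X : ℕ → Prop} {T T' : ℕ → ℕ} {v : ℕ}

theorem weight_succ_of_mem (h : X v) : weight X (v + 1) = 3 * weight X v := by
  simp [weight, h]

theorem weight_succ_of_notMem (h : ¬ X v) : weight X (v + 1) = weight X v := by
  simp [weight, h]

theorem digitValue_succ_of_mem (h : X v) :
    digitValue X T (v + 1) = digitValue X T v + T v * weight X v := by
  simp [digitValue, h]

theorem digitValue_succ_of_notMem (h : ¬ X v) :
    digitValue X T (v + 1) = digitValue X T v := by
  simp [digitValue, h]

theorem digitValue_lt_weight (hT : ∀ u, X u → T u < 3) (v : ℕ) :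
    digitValue X T v < weight X v := by
  induction v with
  | zero => simp [digitValue, weight]
  | succ v ih =>
    by_cases h : X v
    · rw [digitValue_succ_of_mem h, weight_succ_of_mem h]
      have : T v * weight X v ≤ 2 * weight X v :=
        Nat.mul_le_mul_right _ (by have := hT v h; omega)
      omega
    · rw [digitValue_succ_of_notMem h, weight_succ_of_notMem h]
      exact ih

theorem digitValue_inj (hT : ∀ u, X u → T u < 3) (hT' : ∀ u, X u → T' u < 3)
    (h : digitValue X T v = digitValue X T' v) : ∀ u < v, X u → T u = T' u := by
  induction v with
  | zero => intro u hu; omega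
  | succ v ih =>
    have hw := digitValue_lt_weight hT v
    have hw' := digitValue_lt_weight hT' v
    intro u hu hX
    by_cases hv : X v
    · rw [digitValue_succ_of_mem hv, digitValue_succ_of_mem hv] at h
      have hdiv : ∀ x t, x < weight X v → (x + t * weight X v) / weight X v = t := by
        intro x t hx
        rw [Nat.add_mul_div_right _ _ (by omega), Nat.div_eq_of_lt hx, Nat.zero_add]
      have hTv : T v = T' v := by rw [← hdiv _ (T v) hw, h, hdiv _ _ hw']
      rw [hTv] at h
      rcases (show u < v ∨ u = v by omega) with huv | rfl
      · exact ih (by omega) u huv hX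
      · exact hTv
    · rw [digitValue_succ_of_notMem hv, digitValue_succ_of_notMem hv] at h
      have : u ≠ v := by rintro rfl; exact hv hX
      exact ih h u (by omega) hX

theorem digitValue_congr (h : ∀ u < v, T u = T' u) : digitValue X T v = digitValue X T' v := by
  induction v with
  | zero => rfl
  | succ v ih =>
    have ih' := ih fun u hu => h u (by omega)
    by_cases hv : X v
    · rw [digitValue_succ_of_mem hv, digitValue_succ_of_mem hv, ih', h v (by omega)]
    · rw [digitValue_succ_of_notMem hv, digitValue_succ_of_notMem hv, ih']

theorem weight_eq_pow (X : ℕ → Prop) (v : ℕ) : weight X v = 3 ^ {u | u < v ∧ X u}.ncard := by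
  induction v with
  | zero => simp [weight]
  | succ v ih =>
    have hfin : {u | u < v ∧ X u}.Finite := (Set.finite_Iio v).subset fun u hu => hu.1
    by_cases h : X v
    · have : {u | u < v + 1 ∧ X u} = insert v {u | u < v ∧ X u} := by
        ext u
        simp only [Set.mem_ofPred_eq, Set.mem_insert_iff]
        constructor
        · rintro ⟨h1, h2⟩
          rcases (show u = v ∨ u < v by omega) with rfl | h3
          exacts [Or.inl rfl, Or.inr ⟨h3, h2⟩]
        · rintro (rfl | ⟨h1, h2⟩)
          exacts [⟨by omega, h⟩, ⟨by omega, h2⟩]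
      rw [weight_succ_of_mem h, ih, this, Set.ncard_insert_of_notMem (by simp) hfin, pow_succ,
        mul_comm]
    · have : {u | u < v + 1 ∧ X u} = {u | u < v ∧ X u} := by
        ext u
        simp only [Set.mem_ofPred_eq]
        constructor
        · rintro ⟨h1, h2⟩
          have : u ≠ v := by rintro rfl; exact h h2
          exact ⟨by omega, h2⟩
        · rintro ⟨h1, h2⟩
          exact ⟨by omega, h2⟩
      rw [weight_succ_of_notMem h, ih, this]

end Digits

namespace Code

/-- Add one to the number whose base `3` digits are the labels in array `6` of the members of `X`.
Register `9` is the carry. -/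
def increment : Code :=
  seq (write 9 (.const 0) (.const 0) (.const 1))
    (rep 31 0 (cond (.and (.reg 9) (.read 5 (.reg 31) (.const 0)))
      (cond (.sub (.read 6 (.reg 31) (.const 0)) (.const 1))
        (write 6 (.reg 31) (.const 0) (.const 0))
        (seq (write 6 (.reg 31) (.const 0) (.add (.read 6 (.reg 31) (.const 0)) (.const 1)))
          (write 9 (.const 0) (.const 0) (.const 0)))) skip))

/-- Set up the loop bounds; register `7` receives the number of labellings of `X`. -/
def prepare : Code :=
  seq (write 13 (.const 0) (.const 0)
    (.add (.add (.reg 0) (.reg 0)) (.add (.add (.reg 0) (.reg 0)) (.const 1))))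
  (seq (write 14 (.const 0) (.const 0) (.const 3))
  (seq (write 7 (.const 0) (.const 0) (.const 1))
  (rep 31 0 (cond (.read 5 (.reg 31) (.const 0))
    (write 7 (.const 0) (.const 0) (.add (.reg 7) (.add (.reg 7) (.reg 7)))) skip))))

/-- The search for one labelling of `X`, followed by the step to the next labelling. -/
def searchRound : Code := seq searchPairs increment

/-- The search over all labellings of `X`. -/
def searchAll : Code := rep 8 7 searchRound

end Code

section Enumerate

open Code

variable {n : ℕ} {G : SimpleGraph ℕ} {X : ℕ → Prop} {m : Memory}

theorem increment_spec (h : Env n G X m) (hT : ∀ u, X u → m 6 u 0 < 3) :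
    (∀ u, X u → increment.exec m 6 u 0 < 3) ∧
    ∃ carry, digitValue X (fun u => increment.exec m 6 u 0) n + carry * weight X n =
      digitValue X (fun u => m 6 u 0) n + 1 := by
  have h9 : ((write 9 (.const 0) (.const 0) (.const 1)).exec m) 9 0 0 = 1 := by
    simp [exec, Memory.set_same]
  have hne : ∀ a, a ≠ 9 → ((write 9 (.const 0) (.const 0) (.const 1)).exec m) a = m a :=
    fun a ha => Memory.set_ne ha
  simp only [increment, exec.eq_3]
  generalize (write 9 (.const 0) (.const 0) (.const 1)).exec m = m₁ at h9 hne ⊢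
  have hloop := exec_rep_induction (i := 31) (b := 0) (m := m₁)
    (P := cond (.and (.reg 9) (.read 5 (.reg 31) (.const 0)))
      (cond (.sub (.read 6 (.reg 31) (.const 0)) (.const 1))
        (write 6 (.reg 31) (.const 0) (.const 0))
        (seq (write 6 (.reg 31) (.const 0) (.add (.read 6 (.reg 31) (.const 0)) (.const 1)))
          (write 9 (.const 0) (.const 0) (.const 0)))) skip)
    (fun k m' => (∀ u, X u → m' 6 u 0 < 3) ∧ (∀ u, k ≤ u → m' 6 u 0 = m 6 u 0) ∧ m' 9 0 0 ≤ 1 ∧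
      digitValue X (fun u => m' 6 u 0) k + m' 9 0 0 * weight X k =
        digitValue X (fun u => m 6 u 0) k + 1) ?_ ?_
  · rw [hne 0 (by decide), h.size] at hloop
    exact ⟨hloop.1, _, hloop.2.2.2⟩
  · simp only [Memory.set_ne (show 6 ≠ 31 by decide), Memory.set_ne (show 9 ≠ 31 by decide),
      hne 6 (by decide), h9]
    exact ⟨hT, fun u _ => trivial, le_rfl, by simp [digitValue, weight]⟩
  · intro k hk m' hk' hfr ⟨hI1, hI2, hI3, hI4⟩
    have h5 : m' 5 k 0 = 0 ↔ ¬ X k := by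
      rw [hfr 5 (by decide), hne 5 (by decide), ← h.mem k, not_not]
    simp only [Memory.set_ne (show 6 ≠ 31 by decide), Memory.set_ne (show 9 ≠ 31 by decide)]
    by_cases hact : m' 9 0 0 ≠ 0 ∧ X k
    · obtain ⟨hc, hX⟩ := hact
      have hc1 : m' 9 0 0 = 1 := by omega
      have htk := hI2 k le_rfl
      have htk3 := hI1 k hX
      by_cases ht : m' 6 k 0 - 1 = 0
      · have hex : (cond (.and (.reg 9) (.read 5 (.reg 31) (.const 0)))
            (cond (.sub (.read 6 (.reg 31) (.const 0)) (.const 1))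
            (write 6 (.reg 31) (.const 0) (.const 0))
            (seq (write 6 (.reg 31) (.const 0) (.add (.read 6 (.reg 31) (.const 0)) (.const 1)))
            (write 9 (.const 0) (.const 0) (.const 0)))) skip).exec m' =
            (m'.set 6 k 0 (m' 6 k 0 + 1)).set 9 0 0 0 := by
          simp [exec, Expr.val, hc, h5, hX, hk', ht]
        rw [hex]
        simp only [Memory.set_ne (show 6 ≠ 9 by decide), Memory.set_same]
        refine ⟨fun u hu => ?_, fun u hu => ?_, by simp, ?_⟩
        · split_ifs
          · omega
          · exact hI1 u hu
        · rw [if_neg (by omega)]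
          exact hI2 u (by omega)
        · rw [digitValue_succ_of_mem hX, digitValue_succ_of_mem hX,
            digitValue_congr (T' := fun u => m' 6 u 0) (fun u hu => if_neg (by omega))]
          simp only [and_self, if_true, htk]
          rw [hc1] at hI4
          linarith
      · have hex : (cond (.and (.reg 9) (.read 5 (.reg 31) (.const 0)))
            (cond (.sub (.read 6 (.reg 31) (.const 0)) (.const 1))
            (write 6 (.reg 31) (.const 0) (.const 0))
            (seq (write 6 (.reg 31) (.const 0) (.add (.read 6 (.reg 31) (.const 0)) (.const 1)))
            (write 9 (.const 0) (.const 0) (.const 0)))) skip).exec m' =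
            m'.set 6 k 0 0 := by
          simp [exec, Expr.val, hc, h5, hX, hk', ht]
        rw [hex]
        simp only [Memory.set_ne (show 9 ≠ 6 by decide), Memory.set_same]
        refine ⟨fun u hu => ?_, fun u hu => ?_, hI3, ?_⟩
        · split_ifs
          · omega
          · exact hI1 u hu
        · rw [if_neg (by omega)]
          exact hI2 u (by omega)
        · rw [digitValue_succ_of_mem hX, digitValue_succ_of_mem hX, weight_succ_of_mem hX,
            digitValue_congr (T' := fun u => m' 6 u 0) (fun u hu => if_neg (by omega))]
          have h2 : m 6 k 0 = 2 := by omega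
          simp only [and_self, if_true, h2]
          rw [hc1] at hI4 ⊢
          linarith
    · have hex : (cond (.and (.reg 9) (.read 5 (.reg 31) (.const 0)))
          (cond (.sub (.read 6 (.reg 31) (.const 0)) (.const 1))
          (write 6 (.reg 31) (.const 0) (.const 0))
          (seq (write 6 (.reg 31) (.const 0) (.add (.read 6 (.reg 31) (.const 0)) (.const 1)))
          (write 9 (.const 0) (.const 0) (.const 0)))) skip).exec m' = m' := by
        have : m' 9 0 0 = 0 ∨ ¬ X k := by tauto
        simp [exec, h5, hk', this]
      rw [hex]
      refine ⟨hI1, fun u hu => hI2 u (by omega), hI3, ?_⟩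
      by_cases hX : X k
      · have h0 : m' 9 0 0 = 0 := by tauto
        rw [h0] at hI4 ⊢
        rw [digitValue_succ_of_mem hX, digitValue_succ_of_mem hX, hI2 k le_rfl]
        linarith
      · rw [digitValue_succ_of_notMem hX, digitValue_succ_of_notMem hX, weight_succ_of_notMem hX]
        exact hI4

theorem prepare_spec (hsize : m 0 0 0 = n) (hadj : ∀ u v, m 1 u v ≠ 0 ↔ G.Adj u v)
    (hX : ∀ u, m 5 u 0 ≠ 0 ↔ X u) :
    Env n G X (prepare.exec m) ∧ prepare.exec m 7 0 0 = weight X n := by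
  obtain ⟨m₁, hm₁⟩ : ∃ m₁, m₁ = (write 7 (.const 0) (.const 0) (.const 1)).exec
      ((write 14 (.const 0) (.const 0) (.const 3)).exec ((write 13 (.const 0) (.const 0)
    (.add (.add (.reg 0) (.reg 0)) (.add (.add (.reg 0) (.reg 0)) (.const 1)))).exec m)) := ⟨_, rfl⟩
  have h₁ : Env n G X m₁ := by
    subst hm₁
    refine ⟨?_, fun u v => ?_, fun u => ?_, ?_, ?_⟩
    · simpa [exec, Memory.set_ne] using hsize
    · simpa [exec, Memory.set_ne] using hadj u v
    · simpa [exec, Memory.set_ne] using hX u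
    · simp [exec, Memory.set_ne, Memory.set_same, hsize]
      omega
    · simp [exec, Memory.set_ne, Memory.set_same]
  have hex : prepare.exec m = (rep 31 0 (cond (.read 5 (.reg 31) (.const 0))
    (write 7 (.const 0) (.const 0) (.add (.reg 7) (.add (.reg 7) (.reg 7)))) skip)).exec m₁ := by
    rw [hm₁]
    rfl
  rw [hex]
  refine ⟨h₁.exec (by decide), ?_⟩
  have hloop := exec_rep_induction (i := 31) (b := 0) (m := m₁)
    (P := cond (.read 5 (.reg 31) (.const 0))
    (write 7 (.const 0) (.const 0) (.add (.reg 7) (.add (.reg 7) (.reg 7)))) skip)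
    (fun k m' => m' 7 0 0 = weight X k) ?_ ?_
  · rwa [h₁.size] at hloop
  · simp [hm₁, exec, Memory.set_ne, Memory.set_same, weight]
  · intro k hk m' hk' hfr hI
    have h5 : m' 5 k 0 = 0 ↔ ¬ X k := by rw [hfr 5 (by decide), ← h₁.mem k, not_not]
    rw [Memory.set_ne (by decide)]
    by_cases hXk : X k
    · rw [weight_succ_of_mem hXk, ← hI]
      simp [exec, Memory.set_same, hk', h5, hXk]
      omega
    · rw [weight_succ_of_notMem hXk, ← hI]
      simp [exec, hk', h5, hXk]

/-- The search over all labellings of `X` gives a correct answer. -/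
theorem searchAll_spec (hn : ∀ u v, G.Adj u v → u < n) (h : Env n G X m)
    (h7 : m 7 0 0 = weight X n) (h6 : ∀ u, m 6 u 0 = 0) (h3 : m 3 0 0 = 0)
    (hP : NoInducedP5 (core G X)) :
    SoundAnswer n G (searchAll.exec m) ∧
    ∀ f, IsLabelling G f → (∃ a < n, f a = 1) → (∃ b < n, f b = 2) →
      searchAll.exec m 3 0 0 = 1 := by
  have hloop : ∀ f : ℕ → ℕ, _ := fun f => exec_rep_induction
    (i := 8) (b := 7) (P := searchRound) (m := m)
    (fun k m' => (∀ u, X u → m' 6 u 0 < 3) ∧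
      (k < weight X n → digitValue X (fun u => m' 6 u 0) n = k) ∧ SoundAnswer n G m' ∧
      (IsLabelling G f → (∃ a < n, f a = 1) → (∃ b < n, f b = 2) → digitValue X f n < k →
        m' 3 0 0 = 1)) ?_ ?_
  · rw [h7] at hloop
    exact ⟨(hloop 0).2.2.1, fun f hf ha hb =>
      (hloop f).2.2.2 hf ha hb (digitValue_lt_weight (fun u _ => hf.lt_three u) n)⟩
  · simp only [Memory.set_ne (show 6 ≠ 8 by decide), Memory.set_ne (show 3 ≠ 8 by decide), h6]
    have hzero : ∀ v, digitValue X (fun _ => 0) v = 0 := by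
      intro v
      induction v with
      | zero => rfl
      | succ v ih => simp [digitValue, ih]
    refine ⟨fun _ _ => by decide, fun _ => hzero n, Or.inl ?_, fun _ _ _ hlt => by omega⟩
    rw [Memory.set_ne (by decide), h3]
  · intro k hk m' hk' hfr ⟨hI1, hI2, hI3, hI4⟩
    rw [h7] at hk
    have h' : Env n G X m' := h.congr fun a ha => hfr a (by revert a; decide)
    obtain ⟨hs1, hs2, hs3⟩ := searchPairs_spec hn h'
    obtain ⟨m₁, hm₁⟩ : ∃ m₁, m₁ = searchPairs.exec m' := ⟨_, rfl⟩
    have henv₁ : Env n G X m₁ := hm₁ ▸ h'.exec (by decide)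
    have h6₁ : m₁ 6 = m' 6 := by rw [hm₁, exec_of_not_mem_writes (by decide)]
    have hex : searchRound.exec m' = increment.exec m₁ := by rw [hm₁]; rfl
    obtain ⟨hinc1, carry, hinc2⟩ := increment_spec henv₁ (by rwa [h6₁])
    have hinc3 : increment.exec m₁ 3 = m₁ 3 := exec_of_not_mem_writes (by decide) _
    have hinc4 : increment.exec m₁ 4 = m₁ 4 := exec_of_not_mem_writes (by decide) _
    rw [← hm₁] at hs1 hs2 hs3
    rw [hex]
    refine ⟨by rwa [Memory.set_ne (by decide)], fun hk1 => ?_,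
      (hs1 hI3).congr (by rw [Memory.set_ne (by decide), hinc3])
        (by rw [Memory.set_ne (by decide), hinc4]), fun hf ha hb hlt => ?_⟩
    · rw [Memory.set_ne (by decide)]
      rw [h6₁, hI2 hk] at hinc2
      -- A carry out of the last digit would make the value at least `weight X n`.
      rcases Nat.eq_zero_or_pos carry with rfl | hc
      · omega
      · have := Nat.le_mul_of_pos_left (weight X n) hc
        omega
    · rw [Memory.set_ne (by decide), hinc3]
      rcases (show digitValue X f n < k ∨ digitValue X f n = k by omega) with hlt | heq
      · exact hs2 (hI4 hf ha hb hlt)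
      · exact hs3 hP hI1 f hf (digitValue_inj (fun u _ => hf.lt_three u) hI1
          (by rw [heq, hI2 hk])) ha hb

end Enumerate

/-! ### Correctness and running time -/

/-- The solver of the independent cutset problem, for a memory that contains the graph and a set `X`
in array `5`. -/
def solver : Program := .seq Code.prepare.compile Code.searchAll.compile

theorem exists_solver_run : ∃ p : ℕ[X], ∀ (n : ℕ) (G : SimpleGraph ℕ) (X : ℕ → Prop) (m : Memory),
    (∀ u v, G.Adj u v → u < n) → m 0 0 0 = n → (∀ u v, m 1 u v ≠ 0 ↔ G.Adj u v) →
    (∀ u, m 5 u 0 ≠ 0 ↔ X u) → (∀ u, m 6 u 0 = 0) → m 3 0 0 = 0 → NoInducedP5 (core G X) →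
    ∃ m' t, solver.Run m m' t ∧ t ≤ weight X n * p.eval n ∧ SoundAnswer n G m' ∧
      ∀ f, IsLabelling G f → (∃ a < n, f a = 1) → (∃ b < n, f b = 2) → m' 3 0 0 = 1 := by
  obtain ⟨p, hp⟩ := Code.exists_polynomial_cost Code.prepare
  obtain ⟨q, hq⟩ := Code.exists_polynomial_cost Code.searchRound
  refine ⟨p + (q.comp (4 * .X + 3) + 4), fun n G X m hn hsize hadj hX h6 h3 hP => ?_⟩
  obtain ⟨henv, h7⟩ := prepare_spec (n := n) (G := G) (X := X) hsize hadj hX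
  have hfr : ∀ a ∈ [3, 6], Code.prepare.exec m a = m a := fun a ha =>
    Code.exec_of_not_mem_writes (by revert a; decide) m
  obtain ⟨t₁, ht₁, hr₁⟩ := (show Code.prepare.Ok [0] by decide).run (N := n) (m := m)
    (by simp [hsize])
  obtain ⟨t₂, ht₂, hr₂⟩ := Code.run_rep (i := 8) (b := 7) (P := Code.searchRound)
    (T := Code.searchRound.cost (4 * n + 3)) (by decide) (by decide) (by decide)
    (fun m => ∀ b ∈ [0, 13, 14], m b 0 0 ≤ 4 * n + 3)
    (fun m k h b hb => by
      rw [Memory.set_ne (by rintro rfl; revert hb; decide)]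
      exact h b hb)
    (fun m h => ⟨fun b hb => by
      rw [Code.exec_of_not_mem_writes (by revert b; decide)]
      exact h b hb, (show Code.searchRound.Ok [0, 13, 14] by decide).run h⟩)
    (Code.prepare.exec m)
    (by
      simp only [List.forall_mem_cons, henv.size, henv.rounds, henv.three]
      exact ⟨by omega, by omega, by omega, by simp⟩)
  obtain ⟨hs, hc⟩ := searchAll_spec hn henv h7 (by simpa only [hfr 6 (by decide)] using h6)
    (by rw [hfr 3 (by decide), h3]) hP
  refine ⟨_, _, hr₁.seq hr₂, ?_, hs, hc⟩
  have hw : 1 ≤ weight X n := by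
    rw [weight_eq_pow]
    exact Nat.one_le_pow _ _ (by decide)
  rw [h7, hq] at ht₂
  rw [hp] at ht₁
  have hev : (p + (q.comp (4 * .X + 3) + 4)).eval n =
      p.eval n + (q.eval (4 * n + 3) + 4) := by simp
  rw [hev]
  nlinarith [Nat.mul_le_mul_right (p.eval n) hw]

section Fin

variable {n : ℕ}

/-- The graph `G` on `Fin n` as a graph on the natural numbers. -/
abbrev natGraph (G : SimpleGraph (Fin n)) : SimpleGraph ℕ := G.map Fin.valEmbedding

theorem natGraph_adj (G : SimpleGraph (Fin n)) (u v : ℕ) :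
    (natGraph G).Adj u v ↔ ∃ (hu : u < n) (hv : v < n), G.Adj ⟨u, hu⟩ ⟨v, hv⟩ := by
  rw [SimpleGraph.map_adj]
  constructor
  · rintro ⟨a, b, hab, rfl, rfl⟩
    exact ⟨a.2, b.2, hab⟩
  · rintro ⟨hu, hv, huv⟩
    exact ⟨_, _, huv, rfl, rfl⟩

theorem natGraph_adj_lt (G : SimpleGraph (Fin n)) (u v : ℕ) (h : (natGraph G).Adj u v) : u < n :=
  ((natGraph_adj G u v).1 h).1

theorem IsP5HittingSet.noInducedP5 {G : SimpleGraph (Fin n)} {S : Set (Fin n)} {X : ℕ → Prop}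
    (hX : ∀ v : Fin n, X v ↔ v ∈ S) (h : IsP5HittingSet G S) :
    NoInducedP5 (core (natGraph G) X) := by
  intro p₀ p₁ p₂ p₃ p₄ h01 h12 h23 h34 h02 h03 h04 h13 h14 h24
  have hlift : ∀ p q, (core (natGraph G) X).Adj p q → ∃ v : (Sᶜ : Set (Fin n)), (v : Fin n) = p :=
    fun p q hpq => ⟨⟨⟨p, natGraph_adj_lt G _ _ hpq.1⟩, fun hS => hpq.2.1 ((hX _).2 hS)⟩, rfl⟩
  obtain ⟨q₀, rfl⟩ := hlift _ _ h01
  obtain ⟨q₁, rfl⟩ := hlift _ _ h12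
  obtain ⟨q₂, rfl⟩ := hlift _ _ h23
  obtain ⟨q₃, rfl⟩ := hlift _ _ h34
  obtain ⟨q₄, rfl⟩ := hlift _ _ h34.symm
  have hadj : ∀ u v : (Sᶜ : Set (Fin n)), (core (natGraph G) X).Adj (u : Fin n) (v : Fin n) ↔
      (G.induce Sᶜ).Adj u v := by
    intro u v
    have hu : ¬ X (u : Fin n) := fun h => u.2 ((hX _).1 h)
    have hv : ¬ X (v : Fin n) := fun h => v.2 ((hX _).1 h)
    simp [core, hu, hv, SimpleGraph.map_adj, Fin.val_inj]
  rw [hadj] at h01 h12 h23 h34 h02 h03 h04 h13 h14 h24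
  obtain ⟨φ, hφ⟩ : ∃ φ : Fin 5 → (Sᶜ : Set (Fin n)), φ = ![q₀, q₁, q₂, q₃, q₄] := ⟨_, rfl⟩
  have hmap : ∀ i j : Fin 5,
      (G.induce Sᶜ).Adj (φ i) (φ j) ↔ (i.val + 1 = j.val ∨ j.val + 1 = i.val) := by
    have hlt : ∀ i j : Fin 5, i < j →
        ((G.induce Sᶜ).Adj (φ i) (φ j) ↔ i.val + 1 = j.val) := by
      subst hφ
      intro i j hij
      fin_cases i <;> fin_cases j <;> first | (exfalso; revert hij; decide) | skip
      all_goals simp only [Fin.zero_eta, Fin.mk_one, Fin.reduceFinMk, Matrix.cons_val]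
      · exact iff_of_true h01 (by decide)
      · exact iff_of_false h02 (by decide)
      · exact iff_of_false h03 (by decide)
      · exact iff_of_false h04 (by decide)
      · exact iff_of_true h12 (by decide)
      · exact iff_of_false h13 (by decide)
      · exact iff_of_false h14 (by decide)
      · exact iff_of_true h23 (by decide)
      · exact iff_of_false h24 (by decide)
      · exact iff_of_true h34 (by decide)
    intro i j
    rcases lt_trichotomy i j with hij | rfl | hij
    · rw [hlt i j hij]
      omega
    · simp
    · rw [SimpleGraph.adj_comm, hlt j i hij]
      omega
  -- Distinct vertices of the path have distinct neighbourhoods.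
  have hinj : Function.Injective φ := by
    intro i j hij
    have hnb : ∀ k : Fin 5, (i.val + 1 = k.val ∨ k.val + 1 = i.val) ↔
        (j.val + 1 = k.val ∨ k.val + 1 = j.val) := fun k => by
      rw [← hmap, ← hmap, hij]
    clear hij
    revert i j
    decide
  exact h ⟨⟨⟨φ, hinj⟩, fun {i j} => by
    rw [SimpleGraph.pathGraph_adj]
    exact hmap i j⟩⟩

/-- An independent cutset gives a labelling: one of the components that it leaves gets label `1`,
and the other ones get label `2`. -/
theorem IsIndependentCutset.exists_labelling {G : SimpleGraph (Fin n)} {S : Set (Fin n)}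
    (h : IsIndependentCutset G S) :
    ∃ f, IsLabelling (natGraph G) f ∧ (∃ a < n, f a = 1) ∧ ∃ b < n, f b = 2 := by
  classical
  obtain ⟨hind, hcut⟩ := h
  simp only [IsCutset, SimpleGraph.Preconnected, not_forall] at hcut
  obtain ⟨a, b, hab⟩ := hcut
  have hside : ∀ u v : (Sᶜ : Set (Fin n)), G.Adj u v →
      ((G.induce Sᶜ).Reachable a u ↔ (G.induce Sᶜ).Reachable a v) := fun u v huv =>
    ⟨fun h => h.trans (SimpleGraph.Adj.reachable (show (G.induce Sᶜ).Adj u v from huv)),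
      fun h => h.trans (SimpleGraph.Adj.reachable (show (G.induce Sᶜ).Adj v u from huv.symm))⟩
  let g : Fin n → ℕ := fun v =>
    if hv : v ∈ S then 0 else if (G.induce Sᶜ).Reachable a ⟨v, hv⟩ then 1 else 2
  have hg3 : ∀ v, g v < 3 := fun v => by
    simp only [g]
    split_ifs <;> decide
  have hgadj : ∀ u v, G.Adj u v → (g u + g v) % 3 ≠ 0 := by
    intro u v huv
    by_cases hu : u ∈ S <;> by_cases hv : v ∈ S
    · exact absurd huv (hind hu hv huv.ne)
    · simp only [g, hu, hv, dif_pos, dif_neg, not_false_eq_true]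
      split_ifs <;> decide
    · simp only [g, hu, hv, dif_pos, dif_neg, not_false_eq_true]
      split_ifs <;> decide
    · simp only [g, hu, hv, dif_neg, not_false_eq_true, hside ⟨u, hu⟩ ⟨v, hv⟩ huv]
      split_ifs <;> decide
  have ha : (a : Fin n) ∉ S := a.2
  have hb : (b : Fin n) ∉ S := b.2
  refine ⟨fun u => if hu : u < n then g ⟨u, hu⟩ else 1, ⟨fun u => ?_, fun u v huv => ?_⟩,
    ⟨a.1, a.1.2, ?_⟩, ⟨b.1, b.1.2, ?_⟩⟩
  · split_ifs
    exacts [hg3 _, by decide]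
  · obtain ⟨hu, hv, huv⟩ := (natGraph_adj G u v).1 huv
    simpa only [hu, hv, dif_pos] using hgadj _ _ huv
  · simp [g, ha]
  · simp [g, hb, hab]

theorem Certifies.isIndependentCutset {G : SimpleGraph (Fin n)} {l : ℕ → ℕ} {a b : ℕ}
    (h : Certifies (natGraph G) l a b) (ha : a < n) (hb : b < n) :
    IsIndependentCutset G {v | l v = 0} := by
  obtain ⟨hl, ⟨ha0, hb0⟩, hab⟩ := h
  have hadj : ∀ u v : Fin n, G.Adj u v → (natGraph G).Adj u v := fun u v huv =>
    (natGraph_adj G u v).2 ⟨u.2, v.2, huv⟩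
  refine ⟨fun u hu v hv _ huv => (hl u v (hadj u v huv)).1 ⟨hu, hv⟩, fun hconn => ?_⟩
  have hconst : ∀ u v : ({v : Fin n | l v = 0}ᶜ : Set (Fin n)),
      (G.induce {v : Fin n | l v = 0}ᶜ).Reachable u v → l u = l v := by
    intro u v huv
    rw [SimpleGraph.reachable_iff_reflTransGen] at huv
    induction huv with
    | refl => rfl
    | @tail v w _ hvw ih =>
      by_contra hne
      exact (hl _ _ (hadj _ _ hvw)).2 ⟨⟨v.2, w.2⟩, fun heq => hne (ih.trans heq)⟩
  exact hab (hconst ⟨⟨a, ha⟩, ha0⟩ ⟨⟨b, hb⟩, hb0⟩ (hconn _ _))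

theorem SoundAnswer.solves {G : SimpleGraph (Fin n)} {m : Memory}
    (h : SoundAnswer n (natGraph G) m)
    (hf : ∀ f, IsLabelling (natGraph G) f → (∃ a < n, f a = 1) → (∃ b < n, f b = 2) → m 3 0 0 = 1) :
    SolvesIndependentCutset G m := by
  rcases h with h0 | ⟨h1, l, a, b, ha, hb, hc, hout⟩
  · refine Or.inr ⟨h0, ?_⟩
    rintro ⟨S, hS⟩
    obtain ⟨f, h1, h2, h3⟩ := hS.exists_labelling
    have := hf f h1 h2 h3
    omega
  · refine Or.inl ⟨h1, ?_⟩
    have : outputSet n m = {v : Fin n | l v = 0} := by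
      ext v
      exact hout v v.2
    rw [this]
    exact hc.isIndependentCutset ha hb

theorem input_size (G : SimpleGraph (Fin n)) (k : ℕ) : input G k 0 0 0 = n := by
  simp [input]

theorem input_adj (G : SimpleGraph (Fin n)) (k u v : ℕ) :
    input G k 1 u v ≠ 0 ↔ (natGraph G).Adj u v := by
  rw [natGraph_adj]
  simp [input]

theorem input_eq_zero (G : SimpleGraph (Fin n)) (k : ℕ) {a i j : ℕ} (ha : 3 ≤ a) :
    input G k a i j = 0 := by
  simp [input, show a ≠ 0 by omega, show a ≠ 1 by omega, show a ≠ 2 by omega]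

end Fin

theorem exists_polynomial_time_solver : ∃ (B : Program) (p : ℕ[X]),
    ∀ (n : ℕ) (G : SimpleGraph (Fin n)), P5Free G →
      ∃ (m : Memory) (t : ℕ), B.Run (input G 0) m t ∧ t ≤ p.eval n ∧
        SolvesIndependentCutset G m := by
  obtain ⟨p, hp⟩ := exists_solver_run
  refine ⟨solver, p, fun n G hG => ?_⟩
  have hhit : IsP5HittingSet G ∅ := by
    rintro ⟨φ⟩
    exact hG ⟨(SimpleGraph.Embedding.induce _).comp φ⟩
  obtain ⟨m, t, hrun, ht, hs, hf⟩ := hp n (natGraph G) (fun _ => False) (input G 0)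
    (natGraph_adj_lt G) (input_size G 0) (input_adj G 0)
    (fun u => by simp [input_eq_zero G 0 (show 3 ≤ 5 by decide)])
    (fun u => input_eq_zero G 0 (by decide)) (input_eq_zero G 0 (by decide))
    (hhit.noInducedP5 (by simp))
  refine ⟨m, t, hrun, ?_, hs.solves hf⟩
  simpa [weight_eq_pow] using ht

/-! ### Using an algorithm for hitting sets -/

namespace Code

/-- Copy the input to the arrays `100`, `101`, `102`. -/
def copyInput : Code :=
  seq (write 100 (.const 0) (.const 0) (.reg 0)) (seq (write 102 (.const 0) (.const 0) (.reg 2))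
    (rep 31 0 (rep 32 0 (write 101 (.reg 31) (.reg 32) (.read 1 (.reg 31) (.reg 32))))))

/-- Copy the vertex set in array `104` to array `5`. -/
def loadSet : Code :=
  rep 31 0 (write 5 (.reg 31) (.const 0) (.read 104 (.reg 31) (.const 0)))

end Code

section Hitting

open Code

variable {n : ℕ}

theorem copyInput_spec (G : SimpleGraph (Fin n)) (k a : ℕ) :
    copyInput.exec (input G k) (a + 100) = input G k a := by
  have hfr : ∀ b, b ∉ [100, 101, 102, 31, 32] → copyInput.exec (input G k) b = input G k b :=
    fun b hb => exec_of_not_mem_writes (by simpa [copyInput, writes] using by simp at hb; tauto) _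
  by_cases ha : a = 0 ∨ a = 1 ∨ a = 2
  swap
  · rw [hfr _ (by simp; omega)]
    funext i j
    rw [input_eq_zero G k (by omega), input_eq_zero G k (by omega)]
  have houter := exec_rep_induction (i := 31) (b := 0)
    (P := rep 32 0 (write 101 (.reg 31) (.reg 32) (.read 1 (.reg 31) (.reg 32))))
    (m := (write 102 (.const 0) (.const 0) (.reg 2)).exec
      ((write 100 (.const 0) (.const 0) (.reg 0)).exec (input G k)))
    (fun l m' => ∀ u v, m' 101 u v = if u < l ∧ v < n then input G k 1 u v else 0) ?_ ?_
  · have hsize : (write 102 (.const 0) (.const 0) (.reg 2)).exec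
      ((write 100 (.const 0) (.const 0) (.reg 0)).exec (input G k)) 0 0 0 = n := by
      simp [exec, Memory.set_ne, input_size]
    rw [hsize] at houter
    funext i j
    rcases ha with rfl | rfl | rfl
    · simp only [copyInput, exec.eq_3]
      rw [exec_of_not_mem_writes (by decide)]
      by_cases hij : i = 0 ∧ j = 0
      · simp [exec, Memory.set_ne, Memory.set_same, hij]
      · simp [exec, Memory.set_ne, Memory.set_same, hij, input_eq_zero]
        simp [input, hij]
    · simp only [copyInput, exec.eq_3]
      rw [houter]
      split_ifs with hij
      · rfl
      · by_contra hne
        have hadj := (input_adj G k i j).1 fun h => hne h.symm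
        exact hij ⟨natGraph_adj_lt G _ _ hadj, natGraph_adj_lt G _ _ hadj.symm⟩
    · simp only [copyInput, exec.eq_3]
      rw [exec_of_not_mem_writes (by decide)]
      by_cases hij : i = 0 ∧ j = 0
      · simp [exec, Memory.set_ne, Memory.set_same, hij]
      · simp [exec, Memory.set_ne, Memory.set_same, hij, input_eq_zero]
        simp [input, hij]
  · intro u v
    simp [exec, Memory.set_ne, input_eq_zero]
  · intro l hl m' hl' hfr' hI u v
    rw [Memory.set_ne (by decide)]
    have h0 : m' 0 0 0 = n := by
      rw [hfr' 0 (by decide)]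
      simp [exec, Memory.set_ne, input_size]
    have h1 : m' 1 = input G k 1 := by rw [hfr' 1 (by decide)]; rfl
    have hinner := exec_rep_induction (i := 32) (b := 0) (m := m')
      (P := write 101 (.reg 31) (.reg 32) (.read 1 (.reg 31) (.reg 32)))
      (fun c m'' => ∀ u v, m'' 101 u v =
        if (u < l ∧ v < n) ∨ (u = l ∧ v < c) then input G k 1 u v else 0) ?_ ?_
    · rw [h0] at hinner
      rw [hinner]
      exact if_congr (by omega) rfl rfl
    · intro u v
      rw [Memory.set_ne (by decide), hI]
      exact if_congr (by omega) rfl rfl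
    · intro c hc m'' hc' hfr'' hI' u v
      rw [Memory.set_ne (by decide)]
      have h31 : m'' 31 0 0 = l := by rw [hfr'' 31 (by decide), hl']
      have h1' : m'' 1 = input G k 1 := by rw [hfr'' 1 (by decide), h1]
      simp only [exec, Memory.set_same, Expr.val_reg, Expr.val_read, h31, hc', h1']
      by_cases huv : u = l ∧ v = c
      · obtain ⟨rfl, rfl⟩ := huv
        simp
      · rw [if_neg huv, hI']
        exact if_congr (by omega) rfl rfl

theorem loadSet_spec {m : Memory} (hsize : m 0 0 0 = n) (h5 : ∀ u, m 5 u 0 = 0) (u : ℕ) :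
    loadSet.exec m 5 u 0 ≠ 0 ↔ u < n ∧ m 104 u 0 ≠ 0 := by
  have hloop := exec_rep_induction (i := 31) (b := 0) (m := m)
    (P := write 5 (.reg 31) (.const 0) (.read 104 (.reg 31) (.const 0)))
    (fun k m' => ∀ u, m' 5 u 0 ≠ 0 ↔ u < k ∧ m 104 u 0 ≠ 0) ?_ ?_
  · rw [hsize] at hloop
    exact hloop u
  · intro u
    simp [Memory.set_ne, h5]
  · intro k hk m' hk' hfr hI u
    rw [Memory.set_ne (by decide)]
    have h104 : m' 104 = m 104 := hfr 104 (by decide)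
    by_cases huk : u = k
    · subst huk
      simp [exec, Memory.set_same, hk', h104]
    · have := hI u
      simp only [exec, Memory.set_same, Expr.val_reg, hk', huk, false_and, if_false, this]
      omega

end Hitting

/-- The algorithm of the parameterized result: run the given algorithm for hitting sets on a copy of
the input, and search over the labellings of the hitting set that it returns. -/
theorem exists_solver_of_hitting (A : Program) (f : ℕ → ℝ≥0) (D : InstanceSet)
    (hA : SolvesInOStar A D (fun _ G k m => SolvesP5Hitting G k m) f) :
    ∃ B : Program, SolvesInOStar B D
      (fun n G k m =>
        ((∃ X : Set (Fin n), IsP5HittingSet G X ∧ X.ncard ≤ k) ∧ SolvesIndependentCutset G m) ∨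
        ((¬ ∃ X : Set (Fin n), IsP5HittingSet G X ∧ X.ncard ≤ k) ∧ answer m = 2))
      (fun k => f k + 3 ^ k) := by
  obtain ⟨pA, hA⟩ := hA
  obtain ⟨p, hp⟩ := exists_solver_run
  obtain ⟨pc, hpc⟩ := Code.exists_polynomial_cost Code.copyInput
  obtain ⟨pl, hpl⟩ := Code.exists_polynomial_cost Code.loadSet
  refine ⟨.seq Code.copyInput.compile (.seq (A.shift 100) (.cond (.reg 103)
      (.seq Code.loadSet.compile solver) (.write 3 (.const 0) (.const 0) (.const 2)))),
    pA + (pc + pl + p + 2), fun n G k hD => ?_⟩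
  obtain ⟨mA, tA, hrunA, htA, hspec⟩ := hA n G k hD
  obtain ⟨tc, htc, hrunc⟩ := (show Code.copyInput.Ok [0] by decide).run (N := n) (m := input G k)
    (by simp [input_size])
  obtain ⟨M, hrunM, hMA, hM⟩ := hrunA.shift (copyInput_spec G k)
  rw [hpc] at htc
  have hlow : ∀ a < 100, a ∉ [31, 32] → M a = input G k a := fun a ha ha' => by
    rw [hM a ha, Code.exec_of_not_mem_writes]
    simp at ha'
    simp [Code.copyInput, Code.writes]
    omega
  have hans : M 103 0 0 = answer mA := congrFun (congrFun (hMA 3) 0) 0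
  -- The bound for the total time, from a bound for the part after the run of `A`.
  have htime : ∀ t' : ℕ, t' ≤ 3 ^ k * (pl.eval n + p.eval n + 2) →
      ((tc + (tA + t') : ℕ) : ℝ≥0) ≤
        (f k + 3 ^ k) * ((pA + (pc + pl + p + 2)).eval n : ℕ) := by
    intro t' ht'
    have h1 : tc + t' ≤ 3 ^ k * (pc.eval n + pl.eval n + p.eval n + 2) := by
      have : 1 ≤ 3 ^ k := Nat.one_le_pow _ _ (by decide)
      nlinarith [Nat.mul_le_mul_right (pc.eval n) this]
    have h2 : ((tc + t' : ℕ) : ℝ≥0) ≤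
        3 ^ k * ((pc.eval n + pl.eval n + p.eval n + 2 : ℕ) : ℝ≥0) := by
      exact_mod_cast h1
    have h3 : (pA + (pc + pl + p + 2)).eval n =
        pA.eval n + (pc.eval n + pl.eval n + p.eval n + 2) := by simp
    rw [h3]
    generalize pc.eval n + pl.eval n + p.eval n + 2 = c at h2
    calc ((tc + (tA + t') : ℕ) : ℝ≥0) = (tA : ℝ≥0) + ((tc + t' : ℕ) : ℝ≥0) := by
          push_cast
          ring
      _ ≤ f k * (pA.eval n : ℕ) + 3 ^ k * (c : ℝ≥0) := add_le_add htA h2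
      _ ≤ f k * (pA.eval n : ℕ) + 3 ^ k * (c : ℝ≥0) +
          (f k * (c : ℝ≥0) + 3 ^ k * (pA.eval n : ℕ)) := le_self_add
      _ = (f k + 3 ^ k) * ((pA.eval n + c : ℕ) : ℝ≥0) := by
          push_cast
          ring
  rcases hspec with ⟨h1, hhit, hcard⟩ | ⟨h0, hno⟩
  · obtain ⟨tl, htl, hrunl⟩ := (show Code.loadSet.Ok [0] by decide).run (N := n) (m := M)
      (by simp [hlow 0, input_size])
    rw [hpl] at htl
    have hsize : M 0 0 0 = n := by rw [hlow 0 (by decide) (by decide), input_size]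
    have hfr : ∀ a ∈ [0, 1, 3, 6], Code.loadSet.exec M a = input G k a := fun a ha => by
      rw [Code.exec_of_not_mem_writes (by revert a; decide),
        hlow a (by revert a; decide) (by revert a; decide)]
    have hX := loadSet_spec hsize
      (fun u => by rw [hlow 5 (by decide) (by decide), input_eq_zero G k (by decide)])
    have hmem : ∀ v : Fin n, ((v : ℕ) < n ∧ M 104 v 0 ≠ 0) ↔ v ∈ outputSet n mA := fun v => by
      rw [show M 104 = mA 4 from hMA 4]
      exact ⟨fun h => h.2, fun h => ⟨v.2, h⟩⟩
    obtain ⟨m, t, hrun, ht, hs, hf⟩ := hp n (natGraph G) (fun u => u < n ∧ M 104 u 0 ≠ 0)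
      (Code.loadSet.exec M) (natGraph_adj_lt G) (by rw [hfr 0 (by decide), input_size])
      (fun u v => by rw [hfr 1 (by decide), input_adj]) hX
      (fun u => by rw [hfr 6 (by decide), input_eq_zero G k (by decide)])
      (by rw [hfr 3 (by decide), input_eq_zero G k (by decide)]) (hhit.noInducedP5 hmem)
    have hweight : weight (fun u => u < n ∧ M 104 u 0 ≠ 0) n ≤ 3 ^ k := by
      rw [weight_eq_pow]
      refine Nat.pow_le_pow_right (by decide) (le_trans (le_of_eq ?_) hcard)
      rw [← Set.ncard_image_of_injective _ Fin.val_injective]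
      congr 1
      ext u
      simp only [Set.mem_ofPred_eq, Set.mem_image]
      constructor
      · rintro ⟨hu, hX⟩
        exact ⟨⟨u, hu⟩, (hmem ⟨u, hu⟩).1 hX, rfl⟩
      · rintro ⟨v, hv, rfl⟩
        exact ⟨v.2, (hmem v).2 hv⟩
    refine ⟨m, _, hrunc.seq (hrunM.seq (.cond_true ?_ (hrunl.seq hrun))), htime _ ?_,
      Or.inl ⟨⟨_, hhit, hcard⟩, hs.solves hf⟩⟩
    · rw [Expr.val_reg, hans, h1]
      decide
    · have h3 : 1 ≤ 3 ^ k := Nat.one_le_pow _ _ (by decide)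
      have h4 := Nat.mul_le_mul_right (p.eval n) hweight
      have h5 := Nat.mul_le_mul_right (pl.eval n) h3
      nlinarith
  · refine ⟨_, _, hrunc.seq (hrunM.seq (.cond_false ?_ (.write M 3 _ _ _))), htime _ ?_,
      Or.inr ⟨hno, ?_⟩⟩
    · rw [Expr.val_reg, hans, h0]
    · have h3 : 1 ≤ 3 ^ k := Nat.one_le_pow _ _ (by decide)
      nlinarith [Nat.zero_le (3 ^ k * (pl.eval n + p.eval n))]
    · simp [answer, Memory.set_same]

theorem mainTheorem10 :
    -- the parameterized result
    (∀ (f : ℕ → ℝ≥0) (D : InstanceSet),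
      (∀ (n : ℕ) (G : SimpleGraph (Fin n)) (k : ℕ), D n G k → G.Connected) →
      (∃ A : Program, SolvesInOStar A D (fun _ G k m => SolvesP5Hitting G k m) f) →
      ∃ B : Program, SolvesInOStar B D
        (fun n G k m =>
          ((∃ X : Set (Fin n), IsP5HittingSet G X ∧ X.ncard ≤ k) ∧ SolvesIndependentCutset G m) ∨
          ((¬ ∃ X : Set (Fin n), IsP5HittingSet G X ∧ X.ncard ≤ k) ∧ answer m = 2))
        (fun k => f k + 3 ^ k)) ∧
    -- connected `P₅`-free graphs
    (∃ (B : Program) (p : ℕ[X]), ∀ (n : ℕ) (G : SimpleGraph (Fin n)),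
      G.Connected → P5Free G →
        ∃ (m : Memory) (t : ℕ), B.Run (input G 0) m t ∧ t ≤ p.eval n ∧
          SolvesIndependentCutset G m) := by
  refine ⟨fun f D _ ⟨A, hA⟩ => exists_solver_of_hitting A f D hA, ?_⟩
  obtain ⟨B, p, hB⟩ := exists_polynomial_time_solver
  exact ⟨B, p, fun n G _ hG => hB n G hG⟩
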